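/- For a C*-algebra $D$ and $a,b\in D_+$ write $a\precsim b$ (Cuntz subequivalence) if there is a sequence $(x_n)$ in $D$ with $x_nbx_n^*\to a$ in norm, and $a\sim b$ if $a\precsim b\precsim a$. Let $\mathcal K$ be the compact operators on $\ell^2(\mathbb N)$. The Cuntz semigroup of a C*-algebra $A$ is $\mathrm{Cu}(A)=(A\otimes\mathcal K)_+/\!\sim$, ordered by $\precsim$, with addition $[x]+[y]=[\Theta(\mathrm{diag}(x,y))]$, where $\Theta\colon M_2(A\otimes\mathcal K)\to A\otimes\mathcal K$, $(x_{ij})\mapsto\sum_{i,j}w_ix_{ij}w_j^*$, is the inner isomorphism given by isometries $w_1,w_2$ in the multiplier algebra $M(A\otimes\mathcal K)$ with $w_1w_1^*+w_2w_2^*=1$. For $a\in A_+$ let $[a]\in\mathrm{Cu}(A)$ denote the class of $a\otimes e_{00}$, where $e_{00}\in\mathcal K$ is the projection onto the span of the first standard unit vector. $A$ is called stable if $A\cong A\otimes\mathcal K$. In an ordered semigroup $S$ write $s\ll t$ if, whenever $(z_n)$ is an increasing sequence with a supremum in $S$ and $t\le\sup_n z_n$, there is $m$ with $s\le z_m$.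 The category $\mathrm{Cu}$ consists of the commutative ordered monoids $S$ with least element $0$ such that every increasing sequence has a supremum, every element is the supremum of a sequence $(s_n)$ with $s_n\ll s_{n+1}$ for all $n$, $\sup_n(y_n+z_n)=\sup_n y_n+\sup_n z_n$ for increasing sequences $(y_n)$ and $(z_n)$, and $s'+t'\ll s+t$ whenever $s'\ll s$ and $t'\ll t$. For $S,T,R$ in $\mathrm{Cu}$, a $\ll$-bimorphism is a map $\varphi\colon S\times T\to R$ such that all the maps $\varphi(s,\cdot)$ and $\varphi(\cdot,t)$ preserve order, addition and suprema of increasing sequences, and $\varphi(s',t')\ll\varphi(s,t)$ whenever $s'\ll s$ in $S$ and $t'\ll t$ in $T$. **Proposition.** Let $A$ and $B$ be stable and nuclear C*-algebras. Then $\mathrm{Cu}(A)$, $\mathrm{Cu}(B)$ and $\mathrm{Cu}(A\otimes B)$ are in the category $\mathrm{Cu}$, and there is a unique map $\varphi\colon\mathrm{Cu}(A)\times\mathrm{Cu}(B)\to\mathrm{Cu}(A\otimes B)$ with $\varphi([a],[b])=[a\otimes b]$ for all $a\in A_+$ and $b\in B_+$; this map is a $\ll$-bimorphism. -/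

import Mathlib

noncomputable section

open scoped TensorProduct
open Filter Topology UniformSpace

universe u v w

namespace CuTensor

/-! ### Tensor products of C*-algebras -/

section AlgebraicTensor

variable (A : Type u) (B : Type v) [NonUnitalCStarAlgebra A] [NonUnitalCStarAlgebra B]

/-- The algebraic tensor product `A ⊙ B` over `ℂ` (a synonym that carries no norm of its own). -/
def AlgTensor : Type (max u v) := A ⊗[ℂ] B

instance : NonUnitalRing (AlgTensor A B) := inferInstanceAs (NonUnitalRing (A ⊗[ℂ] B))
instance : Module ℂ (AlgTensor A B) := inferInstanceAs (Module ℂ (A ⊗[ℂ] B))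
instance : IsScalarTower ℂ (AlgTensor A B) (AlgTensor A B) :=
  inferInstanceAs (IsScalarTower ℂ (A ⊗[ℂ] B) (A ⊗[ℂ] B))
instance : SMulCommClass ℂ (AlgTensor A B) (AlgTensor A B) :=
  inferInstanceAs (SMulCommClass ℂ (A ⊗[ℂ] B) (A ⊗[ℂ] B))

variable {A B}

/-- The elementary tensor `a ⊗ b` in `A ⊙ B`. -/
def AlgTensor.tmul (a : A) (b : B) : AlgTensor A B := (a ⊗ₜ[ℂ] b : A ⊗[ℂ] B)

theorem AlgTensor.induction {P : AlgTensor A B → Prop} (x : AlgTensor A B) (h0 : P 0)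
    (ht : ∀ a b, P (AlgTensor.tmul a b)) (ha : ∀ x y, P x → P y → P (x + y)) : P x :=
  TensorProduct.induction_on (motive := P) x h0 ht ha

theorem AlgTensor.tmul_mul_tmul (a a' : A) (b b' : B) :
    AlgTensor.tmul a b * AlgTensor.tmul a' b' = AlgTensor.tmul (a * a') (b * b') :=
  Algebra.TensorProduct.tmul_mul_tmul (R := ℂ) a a' b b'

instance : StarAddMonoid (AlgTensor A B) := inferInstanceAs (StarAddMonoid (A ⊗[ℂ] B))
instance : StarModule ℂ (AlgTensor A B) := inferInstanceAs (StarModule ℂ (A ⊗[ℂ] B))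

theorem AlgTensor.star_tmul (a : A) (b : B) :
    star (AlgTensor.tmul a b) = AlgTensor.tmul (star a) (star b) := rfl

instance : StarRing (AlgTensor A B) where
  star_add := star_add
  star_mul x y := by
    induction x using AlgTensor.induction with
    | h0 => simp
    | ha x x' hx hx' => simp [add_mul, mul_add, hx, hx']
    | ht a b =>
      induction y using AlgTensor.induction with
      | h0 => simp
      | ha x x' hx hx' => simp [add_mul, mul_add, hx, hx']
      | ht a' b' => simp [AlgTensor.tmul_mul_tmul, AlgTensor.star_tmul]

/-- A C*-seminorm on the *-algebra `A ⊙ B`. -/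
structure IsCStarSeminorm (p : Seminorm ℂ (AlgTensor A B)) : Prop where
  mul_le : ∀ x y, p (x * y) ≤ p x * p y
  star_mul_self : ∀ x, p (star x * x) = p x ^ 2

/-- A C*-norm on the *-algebra `A ⊙ B`. -/
structure IsCStarNorm (p : Seminorm ℂ (AlgTensor A B)) : Prop extends IsCStarSeminorm p where
  eq_zero : ∀ x, p x = 0 → x = 0

variable (A B)

/-- The subcross C*-seminorms on `A ⊙ B`. (Every C*-seminorm on the algebraic tensor product of
two C*-algebras is subcross, so that these are all the C*-seminorms; the redundant inequality makes
the finiteness of the supremum below evident.) -/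
def SubcrossSeminorm : Type (max u v) :=
  {p : Seminorm ℂ (AlgTensor A B) //
    IsCStarSeminorm p ∧ ∀ a b, p (AlgTensor.tmul a b) ≤ ‖a‖ * ‖b‖}

variable {A B}

instance : Nonempty (SubcrossSeminorm A B) :=
  ⟨⟨0, ⟨by simp, by simp⟩, fun a b => by simpa using by positivity⟩⟩

/-- The greatest C*-norm on `A ⊙ B`: the supremum of all C*-seminorms. -/
def maxNorm (x : AlgTensor A B) : ℝ := ⨆ p : SubcrossSeminorm A B, p.1 x

theorem bddAbove_subcross (x : AlgTensor A B) :
    BddAbove (Set.range fun p : SubcrossSeminorm A B => p.1 x) := by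
  suffices h : ∃ C : ℝ, ∀ p : SubcrossSeminorm A B, p.1 x ≤ C by
    obtain ⟨C, hC⟩ := h
    exact ⟨C, by rintro _ ⟨p, rfl⟩; exact hC p⟩
  induction x using AlgTensor.induction with
  | h0 => exact ⟨0, fun p => by simp⟩
  | ht a b => exact ⟨_, fun p => p.2.2 a b⟩
  | ha x y hx hy =>
    obtain ⟨C, hC⟩ := hx
    obtain ⟨D, hD⟩ := hy
    exact ⟨C + D, fun p => (map_add_le_add p.1 x y).trans (add_le_add (hC p) (hD p))⟩

theorem le_maxNorm (p : SubcrossSeminorm A B) (x : AlgTensor A B) : p.1 x ≤ maxNorm x :=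
  le_ciSup (bddAbove_subcross x) p

theorem maxNorm_le {x : AlgTensor A B} {C : ℝ} (h : ∀ p : SubcrossSeminorm A B, p.1 x ≤ C) :
    maxNorm x ≤ C := ciSup_le h

theorem maxNorm_nonneg (x : AlgTensor A B) : 0 ≤ maxNorm x :=
  (apply_nonneg (Classical.arbitrary (SubcrossSeminorm A B)).1 x).trans (le_maxNorm _ x)

theorem maxNorm_tmul_le (a : A) (b : B) : maxNorm (AlgTensor.tmul a b) ≤ ‖a‖ * ‖b‖ :=
  maxNorm_le fun p => p.2.2 a b

theorem maxNorm_mul_le (x y : AlgTensor A B) : maxNorm (x * y) ≤ maxNorm x * maxNorm y :=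
  maxNorm_le fun p => (p.2.1.mul_le x y).trans
    (mul_le_mul (le_maxNorm p x) (le_maxNorm p y) (apply_nonneg _ _) (maxNorm_nonneg x))

theorem maxNorm_sq_le (x : AlgTensor A B) : maxNorm x * maxNorm x ≤ maxNorm (star x * x) := by
  rw [← sq]
  refine (Real.le_sqrt (maxNorm_nonneg _) (maxNorm_nonneg _)).1 (maxNorm_le fun p => ?_)
  refine Real.le_sqrt_of_sq_le ?_
  rw [← p.2.1.star_mul_self]
  exact le_maxNorm p _

/-- `A ⊙ B` with the seminorm `maxNorm`. -/
instance : NonUnitalSeminormedRing (AlgTensor A B) where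
  __ := (inferInstance : NonUnitalRing (AlgTensor A B))
  norm := maxNorm
  dist x y := maxNorm (-x + y)
  dist_self x := le_antisymm (maxNorm_le fun p => by simp) (maxNorm_nonneg _)
  dist_comm x y := by
    simp only [maxNorm]
    congr 1; ext p
    rw [← map_neg_eq_map p.1]; congr 1; abel
  dist_triangle x y z := maxNorm_le fun p => by
    have h : -x + z = (-x + y) + (-y + z) := by abel
    rw [h]
    exact (map_add_le_add p.1 _ _).trans (add_le_add (le_maxNorm p _) (le_maxNorm p _))
  dist_eq _ _ := rfl
  norm_mul_le := maxNorm_mul_le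

theorem AlgTensor.norm_def (x : AlgTensor A B) : ‖x‖ = maxNorm x := rfl

instance : NormedSpace ℂ (AlgTensor A B) where
  norm_smul_le c x := maxNorm_le fun p => by
    rw [map_smul_eq_mul]
    exact mul_le_mul_of_nonneg_left (le_maxNorm p x) (norm_nonneg c)

theorem AlgTensor.norm_star_le (x : AlgTensor A B) : ‖star x‖ ≤ ‖x‖ := by
  by_contra! h
  have h1 : ‖star x‖ * ‖star x‖ ≤ ‖star (star x) * star x‖ := maxNorm_sq_le (star x)
  rw [star_star] at h1
  have h2 := norm_mul_le x (star x)
  have h3 : 0 ≤ ‖x‖ := norm_nonneg x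
  nlinarith

instance : NormedStarGroup (AlgTensor A B) := ⟨AlgTensor.norm_star_le⟩

end AlgebraicTensor

section Tensor

variable (A : Type u) (B : Type v) [NonUnitalCStarAlgebra A] [NonUnitalCStarAlgebra B]

/-- The C*-tensor product `A ⊗ B`: the completion of `A ⊙ B` in its greatest C*-norm. If `A` or `B`
is nuclear, this is the unique C*-norm on `A ⊙ B`. -/
def CTensor : Type (max u v) := Completion (AlgTensor A B)

instance : NormedAddCommGroup (CTensor A B) :=
  inferInstanceAs (NormedAddCommGroup (Completion (AlgTensor A B)))
instance : NormedSpace ℂ (CTensor A B) :=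
  inferInstanceAs (NormedSpace ℂ (Completion (AlgTensor A B)))
instance : CompleteSpace (CTensor A B) :=
  inferInstanceAs (CompleteSpace (Completion (AlgTensor A B)))

variable {A B}

namespace CTensor

/-- The canonical map `A ⊙ B → A ⊗ B`. -/
def of : AlgTensor A B →ₗᵢ[ℂ] CTensor A B := Completion.toComplₗᵢ (𝕜 := ℂ) (E := AlgTensor A B)

theorem isDenseInducing_of : IsDenseInducing (of : AlgTensor A B → CTensor A B) :=
  Completion.isDenseInducing_coe

theorem denseRange_of : DenseRange (of : AlgTensor A B → CTensor A B) := isDenseInducing_of.dense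

theorem continuous_of : Continuous (of : AlgTensor A B → CTensor A B) := of.continuous

theorem induction {P : CTensor A B → Prop} (x : CTensor A B) (hP : IsClosed {x | P x})
    (h : ∀ y, P (of y)) : P x := denseRange_of.induction_on x hP h

/-- The multiplication of `A ⊗ B`: the continuous extension of the multiplication of `A ⊙ B`. -/
@[irreducible]
def mulExt (x y : CTensor A B) : CTensor A B :=
  (isDenseInducing_of.prodMap isDenseInducing_of).extend
    (fun p : AlgTensor A B × AlgTensor A B => (of (p.1 * p.2) : CTensor A B)) (x, y)

/-- The involution of `A ⊗ B`: the continuous extension of the involution of `A ⊙ B`. -/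
@[irreducible]
def starExt (x : CTensor A B) : CTensor A B :=
  Completion.map (star : AlgTensor A B → AlgTensor A B) x

instance : Mul (CTensor A B) := ⟨mulExt⟩

instance : Star (CTensor A B) := ⟨starExt⟩

theorem mul_def (x y : CTensor A B) : x * y = mulExt x y := rfl

theorem star_def (x : CTensor A B) : star x = starExt x := rfl

theorem of_mul (x y : AlgTensor A B) : (of (x * y) : CTensor A B) = of x * of y := by
  rw [mul_def, mulExt]
  exact ((isDenseInducing_of.prodMap isDenseInducing_of).extend_eq
    (continuous_of.comp (continuous_mul (M := AlgTensor A B))) (x, y)).symm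

theorem of_star (x : AlgTensor A B) : (of (star x) : CTensor A B) = star (of x) := by
  rw [star_def, starExt]
  exact (Completion.map_coe
    (starₗᵢ ℂ : AlgTensor A B ≃ₗᵢ⋆[ℂ] AlgTensor A B).isometry.uniformContinuous x).symm

theorem continuous_mul_aux : Continuous fun p : CTensor A B × CTensor A B => p.1 * p.2 := by
  let i : AlgTensor A B →+ CTensor A B := of.toLinearMap.toAddMonoidHom
  let m : AlgTensor A B →+ AlgTensor A B →+ CTensor A B := AddMonoidHom.mul.compr₂ i
  have hm : Continuous fun p : AlgTensor A B × AlgTensor A B => m p.1 p.2 :=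
    continuous_of.comp continuous_mul
  have di : IsDenseInducing (i : AlgTensor A B → CTensor A B) := isDenseInducing_of
  have h : (fun p : CTensor A B × CTensor A B => p.1 * p.2) =
      (di.prodMap di).extend (fun p => m p.1 p.2) := by
    funext p
    rw [mul_def, mulExt]
    rfl
  rw [h]
  exact (di.extend_Z_bilin di hm :)

instance : ContinuousMul (CTensor A B) := ⟨continuous_mul_aux⟩

instance : ContinuousStar (CTensor A B) := ⟨by
  have h : (star : CTensor A B → CTensor A B) =
      Completion.map (star : AlgTensor A B → AlgTensor A B) := by
    funext x
    rw [star_def, starExt]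
  rw [h]
  exact Completion.continuous_map⟩

theorem left_distrib_aux (a b c : CTensor A B) : a * (b + c) = a * b + a * c := by
  induction a using induction with
  | hP => exact isClosed_eq (by fun_prop) (by fun_prop)
  | h a =>
  induction b using induction with
  | hP => exact isClosed_eq (by fun_prop) (by fun_prop)
  | h b =>
  induction c using induction with
  | hP => exact isClosed_eq (by fun_prop) (by fun_prop)
  | h c =>
  rw [← map_add, ← of_mul, ← of_mul, ← of_mul, ← map_add, mul_add]

theorem right_distrib_aux (a b c : CTensor A B) : (a + b) * c = a * c + b * c := by
  induction a using induction with
  | hP => exact isClosed_eq (by fun_prop) (by fun_prop)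
  | h a =>
  induction b using induction with
  | hP => exact isClosed_eq (by fun_prop) (by fun_prop)
  | h b =>
  induction c using induction with
  | hP => exact isClosed_eq (by fun_prop) (by fun_prop)
  | h c =>
  rw [← map_add, ← of_mul, ← of_mul, ← of_mul, ← map_add, add_mul]

theorem zero_mul_aux (a : CTensor A B) : 0 * a = 0 := by
  induction a using induction with
  | hP => exact isClosed_eq (by fun_prop) (by fun_prop)
  | h a =>
  rw [← map_zero of, ← of_mul, zero_mul]

theorem mul_zero_aux (a : CTensor A B) : a * 0 = 0 := by
  induction a using induction with
  | hP => exact isClosed_eq (by fun_prop) (by fun_prop)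
  | h a =>
  rw [← map_zero of, ← of_mul, mul_zero]

theorem mul_assoc_aux (a b c : CTensor A B) : a * b * c = a * (b * c) := by
  induction a using induction with
  | hP => exact isClosed_eq (by fun_prop) (by fun_prop)
  | h a =>
  induction b using induction with
  | hP => exact isClosed_eq (by fun_prop) (by fun_prop)
  | h b =>
  induction c using induction with
  | hP => exact isClosed_eq (by fun_prop) (by fun_prop)
  | h c =>
  rw [← of_mul, ← of_mul, ← of_mul, ← of_mul, mul_assoc]

theorem norm_mul_le_aux (a b : CTensor A B) : ‖a * b‖ ≤ ‖a‖ * ‖b‖ := by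
  induction a using induction with
  | hP => exact isClosed_le (by fun_prop) (by fun_prop)
  | h a =>
  induction b using induction with
  | hP => exact isClosed_le (by fun_prop) (by fun_prop)
  | h b =>
  rw [← of_mul, of.norm_map, of.norm_map, of.norm_map]
  exact norm_mul_le a b

theorem star_star_aux (a : CTensor A B) : star (star a) = a := by
  induction a using induction with
  | hP => exact isClosed_eq (by fun_prop) (by fun_prop)
  | h a =>
  rw [← of_star, ← of_star, star_star]

theorem star_mul_aux (a b : CTensor A B) : star (a * b) = star b * star a := by
  induction a using induction with
  | hP => exact isClosed_eq (by fun_prop) (by fun_prop)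
  | h a =>
  induction b using induction with
  | hP => exact isClosed_eq (by fun_prop) (by fun_prop)
  | h b =>
  rw [← of_mul, ← of_star, ← of_star, ← of_star, ← of_mul, star_mul]

theorem star_add_aux (a b : CTensor A B) : star (a + b) = star a + star b := by
  induction a using induction with
  | hP => exact isClosed_eq (by fun_prop) (by fun_prop)
  | h a =>
  induction b using induction with
  | hP => exact isClosed_eq (by fun_prop) (by fun_prop)
  | h b =>
  rw [← map_add, ← of_star, ← of_star, ← of_star, ← map_add, star_add]

theorem norm_sq_aux (a : CTensor A B) : ‖a‖ * ‖a‖ ≤ ‖star a * a‖ := by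
  induction a using induction with
  | hP => exact isClosed_le (by fun_prop) (by fun_prop)
  | h a =>
  rw [← of_star, ← of_mul, of.norm_map, of.norm_map]
  exact maxNorm_sq_le a

theorem continuous_smul_aux (c : ℂ) : Continuous fun a : CTensor A B => c • a :=
  continuous_const_smul c

theorem smul_mul_aux (c : ℂ) (a b : CTensor A B) : c • a * b = c • (a * b) := by
  induction a using induction with
  | hP =>
    exact isClosed_eq ((continuous_smul_aux (A := A) (B := B) c).mul continuous_const)
      ((continuous_smul_aux (A := A) (B := B) c).comp (continuous_id.mul continuous_const))
  | h a =>
  induction b using induction with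
  | hP =>
    exact isClosed_eq (continuous_const.mul continuous_id)
      ((continuous_smul_aux (A := A) (B := B) c).comp (continuous_const.mul continuous_id))
  | h b => rw [← map_smul, ← of_mul, ← of_mul, ← map_smul, smul_mul_assoc]

theorem mul_smul_aux (c : ℂ) (a b : CTensor A B) : a * c • b = c • (a * b) := by
  induction a using induction with
  | hP =>
    exact isClosed_eq (continuous_id.mul continuous_const)
      ((continuous_smul_aux (A := A) (B := B) c).comp (continuous_id.mul continuous_const))
  | h a =>
  induction b using induction with
  | hP =>
    exact isClosed_eq (continuous_const.mul (continuous_smul_aux (A := A) (B := B) c))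
      ((continuous_smul_aux (A := A) (B := B) c).comp (continuous_const.mul continuous_id))
  | h b => rw [← map_smul, ← of_mul, ← of_mul, ← map_smul, mul_smul_comm]

theorem star_smul_aux (c : ℂ) (a : CTensor A B) : star (c • a) = star c • star a := by
  induction a using induction with
  | hP =>
    exact isClosed_eq (continuous_star.comp (continuous_smul_aux (A := A) (B := B) c))
      ((continuous_smul_aux (A := A) (B := B) (star c)).comp continuous_star)
  | h a => rw [← map_smul, ← of_star, ← of_star, ← map_smul, star_smul]

instance : NonUnitalNormedRing (CTensor A B) where
  __ := (inferInstance : NormedAddCommGroup (CTensor A B))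
  left_distrib := left_distrib_aux
  right_distrib := right_distrib_aux
  zero_mul := zero_mul_aux
  mul_zero := mul_zero_aux
  mul_assoc := mul_assoc_aux
  norm_mul_le := norm_mul_le_aux

instance : StarRing (CTensor A B) where
  star_involutive := star_star_aux
  star_mul := star_mul_aux
  star_add := star_add_aux

instance : NonUnitalCStarAlgebra (CTensor A B) where
  norm_mul_self_le := norm_sq_aux
  smul_assoc := smul_mul_aux
  smul_comm c a b := (mul_smul_aux c a b).symm
  star_smul := star_smul_aux

/-- The elementary tensor `a ⊗ b` in `A ⊗ B`. -/
def tmul (a : A) (b : B) : CTensor A B := of (AlgTensor.tmul a b)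

theorem tmul_mul_tmul (a a' : A) (b b' : B) :
    tmul a b * tmul a' b' = tmul (a * a') (b * b') := by
  rw [tmul, tmul, tmul, ← of_mul, AlgTensor.tmul_mul_tmul]

theorem star_tmul (a : A) (b : B) : star (tmul a b) = tmul (star a) (star b) := by
  rw [tmul, tmul, ← of_star, AlgTensor.star_tmul]

end CTensor

end Tensor

/-! ### Functoriality in the second variable -/

section Map

variable {A : Type u} {B : Type v} {B' : Type w} [NonUnitalCStarAlgebra A]
  [NonUnitalCStarAlgebra B] [NonUnitalCStarAlgebra B']

/-- `id ⊗ g : A ⊙ B → A ⊙ B'`. -/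
def AlgTensor.mapRight (g : B →⋆ₙₐ[ℂ] B') : AlgTensor A B →ₗ[ℂ] AlgTensor A B' :=
  (TensorProduct.map LinearMap.id (LinearMapClass.linearMap g : B →ₗ[ℂ] B') :
    A ⊗[ℂ] B →ₗ[ℂ] A ⊗[ℂ] B')

theorem AlgTensor.mapRight_tmul (g : B →⋆ₙₐ[ℂ] B') (a : A) (b : B) :
    AlgTensor.mapRight g (AlgTensor.tmul a b) = AlgTensor.tmul a (g b) := rfl

theorem AlgTensor.mapRight_mul (g : B →⋆ₙₐ[ℂ] B') (x y : AlgTensor A B) :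
    AlgTensor.mapRight g (x * y) = AlgTensor.mapRight g x * AlgTensor.mapRight g y := by
  induction x using AlgTensor.induction with
  | h0 => simp
  | ha x x' hx hx' => simp [add_mul, hx, hx']
  | ht a b =>
    induction y using AlgTensor.induction with
    | h0 => simp
    | ha x x' hx hx' => simp [mul_add, hx, hx']
    | ht a' b' => simp [AlgTensor.tmul_mul_tmul, AlgTensor.mapRight_tmul]

theorem AlgTensor.mapRight_star (g : B →⋆ₙₐ[ℂ] B') (x : AlgTensor A B) :
    AlgTensor.mapRight g (star x) = star (AlgTensor.mapRight g x) := by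
  induction x using AlgTensor.induction with
  | h0 => simp
  | ha x x' hx hx' => simp [hx, hx']
  | ht a b => simp [AlgTensor.star_tmul, AlgTensor.mapRight_tmul, map_star]

theorem AlgTensor.norm_mapRight_le (g : B →⋆ₙₐ[ℂ] B') (x : AlgTensor A B) :
    ‖AlgTensor.mapRight g x‖ ≤ ‖x‖ := by
  refine maxNorm_le fun p => ?_
  let q : SubcrossSeminorm A B := ⟨p.1.comp (AlgTensor.mapRight g), ⟨fun x y => by
      simpa [AlgTensor.mapRight_mul] using p.2.1.mul_le _ _, fun x => by
      simpa [AlgTensor.mapRight_mul, AlgTensor.mapRight_star] using p.2.1.star_mul_self _⟩,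
    fun a b => (p.2.2 a (g b)).trans
      (mul_le_mul_of_nonneg_left (NonUnitalStarAlgHom.norm_apply_le g b) (norm_nonneg a))⟩
  exact le_maxNorm q x

/-- The composite `A ⊙ B → A ⊙ B' → A ⊗ B'` as a bounded linear map. -/
def AlgTensor.mapRightL (g : B →⋆ₙₐ[ℂ] B') : AlgTensor A B →L[ℂ] CTensor A B' :=
  (CTensor.of.toLinearMap ∘ₗ AlgTensor.mapRight g).mkContinuous 1 fun x => by
    rw [one_mul]
    exact (CTensor.of.norm_map _).trans_le (AlgTensor.norm_mapRight_le g x)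

/-- `id ⊗ g : A ⊗ B → A ⊗ B'`, the continuous extension of `AlgTensor.mapRight g`, as a bounded
linear map. -/
def CTensor.mapRightL (g : B →⋆ₙₐ[ℂ] B') : CTensor A B →L[ℂ] CTensor A B' :=
  (AlgTensor.mapRightL g).extend (CTensor.of (A := A) (B := B)).toContinuousLinearMap

theorem CTensor.mapRightL_of (g : B →⋆ₙₐ[ℂ] B') (x : AlgTensor A B) :
    CTensor.mapRightL g (CTensor.of x) = CTensor.of (AlgTensor.mapRight g x) := by
  have h := ContinuousLinearMap.extend_eq (AlgTensor.mapRightL g)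
    (e := (CTensor.of (A := A) (B := B)).toContinuousLinearMap) CTensor.denseRange_of
    CTensor.of.isometry.isUniformInducing x
  exact h

/-- `id ⊗ g : A ⊗ B → A ⊗ B'` as a *-homomorphism. -/
def CTensor.mapRight (g : B →⋆ₙₐ[ℂ] B') : CTensor A B →⋆ₙₐ[ℂ] CTensor A B' where
  toFun := CTensor.mapRightL g
  map_smul' c x := map_smul _ c x
  map_zero' := map_zero _
  map_add' := map_add _
  map_mul' x y := by
    induction x using CTensor.induction with
    | hP => exact isClosed_eq (by fun_prop) (by fun_prop)
    | h x =>
    induction y using CTensor.induction with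
    | hP => exact isClosed_eq (by fun_prop) (by fun_prop)
    | h y =>
      rw [← CTensor.of_mul, CTensor.mapRightL_of, CTensor.mapRightL_of, CTensor.mapRightL_of,
        ← CTensor.of_mul, AlgTensor.mapRight_mul]
  map_star' x := by
    induction x using CTensor.induction with
    | hP => exact isClosed_eq (by fun_prop) (by fun_prop)
    | h x =>
      rw [← CTensor.of_star, CTensor.mapRightL_of, CTensor.mapRightL_of, ← CTensor.of_star,
        AlgTensor.mapRight_star]

theorem CTensor.mapRight_of (g : B →⋆ₙₐ[ℂ] B') (x : AlgTensor A B) :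
    CTensor.mapRight g (CTensor.of x) = CTensor.of (AlgTensor.mapRight g x) :=
  CTensor.mapRightL_of g x

theorem CTensor.continuous_mapRight (g : B →⋆ₙₐ[ℂ] B') :
    Continuous (CTensor.mapRight g : CTensor A B → CTensor A B') :=
  (CTensor.mapRightL (A := A) g).continuous

theorem CTensor.mapRight_mul_mapRight_eq_zero {g h : B →⋆ₙₐ[ℂ] B'} (hgh : ∀ b c, g b * h c = 0)
    (x y : CTensor A B) : CTensor.mapRight g x * CTensor.mapRight h y = 0 := by
  have hg := CTensor.continuous_mapRight (A := A) g
  have hh := CTensor.continuous_mapRight (A := A) h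
  induction x using CTensor.induction with
  | hP => exact isClosed_eq (hg.mul continuous_const) continuous_const
  | h x =>
  induction y using CTensor.induction with
  | hP => exact isClosed_eq (continuous_const.mul hh) continuous_const
  | h y =>
    rw [CTensor.mapRight_of, CTensor.mapRight_of, ← CTensor.of_mul]
    convert map_zero CTensor.of
    induction x using AlgTensor.induction with
    | h0 => simp
    | ha x x' hx hx' => simp [add_mul, hx, hx']
    | ht a b =>
      induction y using AlgTensor.induction with
      | h0 => simp
      | ha x x' hx hx' => simp [mul_add, hx, hx']
      | ht a' b' =>
        rw [AlgTensor.mapRight_tmul, AlgTensor.mapRight_tmul, AlgTensor.tmul_mul_tmul, hgh]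
        exact TensorProduct.tmul_zero _ _

end Map

/-! ### The compact operators on `ℓ²(ℕ)` -/

/-- The Hilbert space `ℓ²(ℕ)`. -/
abbrev Ell2 : Type := lp (fun _ : ℕ => ℂ) 2

theorem norm_adjoint_apply_sq_le (T : Ell2 →L[ℂ] Ell2) (x : Ell2) :
    ‖(star T : Ell2 →L[ℂ] Ell2) x‖ ^ 2 ≤ ‖(T * star T) x‖ * ‖x‖ := by
  have h : inner ℂ ((T * star T) x) x =
      inner ℂ ((star T : Ell2 →L[ℂ] Ell2) x) ((star T : Ell2 →L[ℂ] Ell2) x) := by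
    rw [ContinuousLinearMap.star_eq_adjoint, ContinuousLinearMap.adjoint_inner_right]
    rfl
  have h2 := norm_inner_le_norm (𝕜 := ℂ) ((T * star T) x) x
  rw [h, inner_self_eq_norm_sq_to_K] at h2
  simpa using h2

theorem isCompactOperator_adjoint {T : Ell2 →L[ℂ] Ell2} (hT : IsCompactOperator T) :
    IsCompactOperator (star T : Ell2 →L[ℂ] Ell2) := by
  have hc : IsCompactOperator (T * star T) := hT.comp_clm (star T)
  have hc' := (isCompactOperator_iff_isCompact_closure_image_ball (𝕜₁ := ℂ)
    (T * star T).toLinearMap one_pos).1 hc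
  refine (isCompactOperator_iff_isCompact_closure_image_ball (𝕜₁ := ℂ)
    (star T : Ell2 →L[ℂ] Ell2).toLinearMap one_pos).2 ?_
  have htb := hc'.totallyBounded.subset subset_closure
  refine TotallyBounded.isCompact_of_isClosed (TotallyBounded.closure ?_) isClosed_closure
  rw [Metric.totallyBounded_iff]
  intro ε hε
  obtain ⟨t, hts, htf, hcov⟩ := Metric.finite_approx_of_totallyBounded htb (ε ^ 2 / 2) (by positivity)
  choose g hg hgt using hts
  have : Finite t := htf
  let s : Set Ell2 := Set.range fun y : t => g y.2
  have hs : s ⊆ Metric.ball 0 1 := by rintro _ ⟨y, rfl⟩; exact hg y.2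
  have hsf : s.Finite := Set.finite_range _
  refine ⟨(star T : Ell2 →L[ℂ] Ell2) '' s, hsf.image _, ?_⟩
  rintro _ ⟨x, hx, rfl⟩
  have h1 := hcov ⟨x, hx, rfl⟩
  simp only [Set.mem_iUnion, Set.mem_image, exists_prop] at h1 ⊢
  obtain ⟨z, hz, hxy⟩ := h1
  obtain ⟨y, hy, rfl⟩ : ∃ y ∈ s, (T * star T).toLinearMap y = z := ⟨g hz, ⟨⟨z, hz⟩, rfl⟩, hgt hz⟩
  refine ⟨_, ⟨y, hy, rfl⟩, ?_⟩
  rw [Metric.mem_ball, dist_eq_norm] at hxy ⊢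
  change ‖(T * star T) x - (T * star T) y‖ < _ at hxy
  change ‖(star T : Ell2 →L[ℂ] Ell2) x - (star T : Ell2 →L[ℂ] Ell2) y‖ < ε
  rw [← map_sub] at hxy ⊢
  have h2 := norm_adjoint_apply_sq_le T (x - y)
  have h3 : ‖x - y‖ ≤ 2 := by
    have := norm_sub_le x y
    have hx' := mem_ball_zero_iff.1 hx
    have hy' := mem_ball_zero_iff.1 (hs hy)
    linarith
  have h4 : ‖(star T : Ell2 →L[ℂ] Ell2) (x - y)‖ ^ 2 < ε ^ 2 := by
    have := norm_nonneg ((T * star T) (x - y))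
    nlinarith
  exact lt_of_pow_lt_pow_left₀ 2 hε.le h4

/-- The C*-algebra `𝒦` of compact operators on `ℓ²(ℕ)`. -/
def compactOps : NonUnitalStarSubalgebra ℂ (Ell2 →L[ℂ] Ell2) where
  carrier := {T | IsCompactOperator T}
  add_mem' := fun hS hT => IsCompactOperator.add hS hT
  zero_mem' := isCompactOperator_zero
  mul_mem' := fun {_ T} hS _ => IsCompactOperator.comp_clm hS T
  smul_mem' := fun c _ hT => IsCompactOperator.smul hT c
  star_mem' := fun hT => isCompactOperator_adjoint hT

abbrev K : Type := compactOps

instance : IsClosed (compactOps : Set (Ell2 →L[ℂ] Ell2)) :=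
  isClosed_setOfPred_isCompactOperator

/-- The standard unit vectors of `ℓ²(ℕ)`. -/
def ket (n : ℕ) : Ell2 := lp.single 2 n (1 : ℂ)

theorem orthonormal_ket_comp {f : ℕ → ℕ} (hf : Function.Injective f) :
    Orthonormal ℂ fun n => ket (f n) := by
  classical
  rw [orthonormal_iff_ite]
  intro i j
  simp only [ket, lp.inner_single_left, lp.single_apply]
  by_cases h : i = j
  · subst h; simp
  · have h' : f i ≠ f j := fun e => h (hf e)
    simp [h, h']

/-- The isometry of `ℓ²(ℕ)` with `ket n ↦ ket (2 * n + i)`, for `i = 0, 1`. The two have orthogonal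
ranges, whose sum is `ℓ²(ℕ)`. -/
def isom (i : Fin 2) : Ell2 →ₗᵢ[ℂ] Ell2 :=
  (orthonormal_ket_comp (f := fun n => 2 * n + i)
    (fun m n h => by simpa using h)).orthogonalFamily.linearIsometry

theorem isom_ket (i : Fin 2) (n : ℕ) : isom i (ket n) = ket (2 * n + i) := by
  simp [isom, ket, OrthogonalFamily.linearIsometry_apply_single]

/-- `isom i` as an element of `B(ℓ²(ℕ))`. -/
def isomL (i : Fin 2) : Ell2 →L[ℂ] Ell2 := (isom i).toContinuousLinearMap

theorem star_isomL_mul_self (i : Fin 2) : star (isomL i) * isomL i = 1 := by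
  ext1 x
  refine ext_inner_left ℂ fun y => ?_
  rw [ContinuousLinearMap.star_eq_adjoint, mul_apply_eq_comp,
    ContinuousLinearMap.adjoint_inner_right]
  exact (isom i).inner_map_map y x

theorem hasSum_isom (i : Fin 2) (x : Ell2) : HasSum (fun n => x n • ket (2 * n + i)) (isom i x) :=
  (orthonormal_ket_comp (f := fun n => 2 * n + i)
    (fun m n h => by simpa using h)).orthogonalFamily.hasSum_linearIsometry x

theorem inner_isom_zero_isom_one (x y : Ell2) : inner ℂ (isom 0 x) (isom 1 y) = 0 := by
  have hk : ∀ m n : ℕ, inner ℂ (ket (2 * m + 1)) (ket (2 * n + 0)) = 0 := fun m n => by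
    have h := (orthonormal_ket_comp (f := id) Function.injective_id).2
      (show 2 * m + 1 ≠ 2 * n + 0 by omega)
    exact h
  have h1 : ∀ m : ℕ, inner ℂ (isom 0 x) (ket (2 * m + 1)) = 0 := fun m => by
    rw [inner_eq_zero_symm]
    have h := (hasSum_isom 0 x).mapL (innerSL ℂ (ket (2 * m + 1)))
    refine h.unique ?_
    convert hasSum_zero with n
    rw [map_smul]
    exact (congrArg _ (hk m n)).trans (smul_zero _)
  have h := (hasSum_isom 1 y).mapL (innerSL ℂ (isom 0 x))
  refine h.unique ?_
  convert hasSum_zero with n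
  rw [map_smul]
  exact (congrArg _ (h1 n)).trans (smul_zero _)

theorem star_isomL_zero_mul_one : star (isomL 0) * isomL 1 = 0 := by
  ext1 x
  refine ext_inner_left ℂ fun y => ?_
  rw [ContinuousLinearMap.star_eq_adjoint, mul_apply_eq_comp,
    ContinuousLinearMap.adjoint_inner_right]
  exact (inner_isom_zero_isom_one y x).trans (inner_zero_right y).symm

/-- The *-homomorphism `T ↦ w T w*` of `𝒦`, where `w = isomL i`. -/
def conjIsom (i : Fin 2) : K →⋆ₙₐ[ℂ] K where
  toFun T := ⟨isomL i * T.1 * star (isomL i),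
    (T.2.clm_comp (isomL i)).comp_clm (star (isomL i))⟩
  map_smul' c T := by ext1; simp
  map_zero' := by ext1; simp
  map_add' S T := by ext1; simp [mul_add, add_mul]
  map_mul' S T := by
    ext1
    change isomL i * (S.1 * T.1) * star (isomL i) =
      isomL i * S.1 * star (isomL i) * (isomL i * T.1 * star (isomL i))
    rw [show isomL i * S.1 * star (isomL i) * (isomL i * T.1 * star (isomL i)) =
      isomL i * S.1 * (star (isomL i) * isomL i) * T.1 * star (isomL i) by noncomm_ring,
      star_isomL_mul_self]
    noncomm_ring
  map_star' T := by
    ext1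
    change isomL i * star T.1 * star (isomL i) = star (isomL i * T.1 * star (isomL i))
    simp [mul_assoc]

theorem conjIsom_zero_mul_one (S T : K) : conjIsom 0 S * conjIsom 1 T = 0 := by
  ext1
  change isomL 0 * S.1 * star (isomL 0) * (isomL 1 * T.1 * star (isomL 1)) = 0
  rw [show isomL 0 * S.1 * star (isomL 0) * (isomL 1 * T.1 * star (isomL 1)) =
      isomL 0 * S.1 * (star (isomL 0) * isomL 1) * T.1 * star (isomL 1) by noncomm_ring,
      star_isomL_zero_mul_one]
  simp

/-- The rank-one projection `e₀₀` of `𝒦` onto `ℂ · ket 0`. -/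
def e00 : K := ⟨InnerProductSpace.rankOne ℂ (ket 0) (ket 0), by
  rw [InnerProductSpace.rankOne_def']
  exact (isCompactOperator_of_locallyCompactSpace_dom (innerSL ℂ (ket 0))).clm_comp
    (ContinuousLinearMap.toSpanSingleton ℂ (ket 0))⟩

/-! ### Stable and nuclear C*-algebras -/

/-- `A` is stable: `A ≅ A ⊗ 𝒦`. -/
def IsStable (A : Type u) [NonUnitalCStarAlgebra A] : Prop :=
  Nonempty (A ≃⋆ₐ[ℂ] CTensor A K)

/-- `A` is nuclear: for every C*-algebra `D` there is only one C*-norm on `A ⊙ D`. (Separable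
test algebras `D` suffice, so that the universe of `D` is immaterial.) -/
def IsNuclear (A : Type u) [NonUnitalCStarAlgebra A] : Prop :=
  ∀ (D : Type u) [NonUnitalCStarAlgebra D] (p q : Seminorm ℂ (AlgTensor A D)),
    IsCStarNorm p → IsCStarNorm q → p = q

/-! ### Cuntz comparison -/

section Cuntz

/-- `a` is Cuntz subequivalent to `b`: there is a sequence `(xₙ)` with `xₙ b xₙ* → a`. -/
def CuntzLE {D : Type u} [NonUnitalCStarAlgebra D] (a b : D) : Prop :=
  ∃ x : ℕ → D, Tendsto (fun n => x n * b * star (x n)) atTop (𝓝 a)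

/-- The positive cone `D₊` of a C*-algebra. -/
def PosCone (D : Type u) [NonUnitalCStarAlgebra D] : Type u := {a : D // ∃ c : D, a = star c * c}

variable {D : Type u} [NonUnitalCStarAlgebra D]

theorem CuntzLE.of_approx {a b : D} (h : ∀ ε > 0, ∃ x : D, ‖x * b * star x - a‖ < ε) :
    CuntzLE a b := by
  choose x hx using fun n : ℕ => h (1 / ((n : ℝ) + 1)) (by positivity)
  refine ⟨x, tendsto_iff_norm_sub_tendsto_zero.2 ?_⟩
  exact squeeze_zero (fun _ => norm_nonneg _) (fun n => (hx n).le)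
    tendsto_one_div_add_atTop_nhds_zero_nat

theorem CuntzLE.approx {a b : D} (h : CuntzLE a b) {ε : ℝ} (hε : 0 < ε) :
    ∃ x : D, ‖x * b * star x - a‖ < ε := by
  obtain ⟨x, hx⟩ := h
  obtain ⟨n, hn⟩ := ((tendsto_iff_norm_sub_tendsto_zero.1 hx).eventually_lt_const hε).exists
  exact ⟨x n, hn⟩

theorem CuntzLE.refl (a : D) : CuntzLE a a := by
  let _ := CStarAlgebra.spectralOrder D
  have _ := CStarAlgebra.spectralOrderedRing D
  have hu := CStarAlgebra.increasingApproximateUnit D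
  refine .of_approx fun ε hε => ?_
  have h1 := (tendsto_iff_norm_sub_tendsto_zero.1 (hu.tendsto_mul_right a)).eventually_lt_const
    (half_pos hε)
  have h2 := (tendsto_iff_norm_sub_tendsto_zero.1 (hu.tendsto_mul_left a)).eventually_lt_const
    (half_pos hε)
  obtain ⟨x, hx1, hx2, hx3, hx4⟩ :=
    (h1.and (h2.and (hu.eventually_star_eq.and hu.eventually_norm))).exists
  refine ⟨x, ?_⟩
  have h3 : x * a * star x - a = (x * a - a) * x + (a * x - a) := by
    rw [hx3]; noncomm_ring
  have h4 : ‖(x * a - a) * x‖ ≤ ‖x * a - a‖ :=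
    (norm_mul_le _ _).trans (mul_le_of_le_one_right (norm_nonneg _) hx4)
  rw [h3]
  linarith [norm_add_le ((x * a - a) * x) (a * x - a)]

theorem CuntzLE.trans {a b c : D} (hab : CuntzLE a b) (hbc : CuntzLE b c) : CuntzLE a c := by
  refine .of_approx fun ε hε => ?_
  obtain ⟨x, hx⟩ := hab.approx (half_pos hε)
  obtain ⟨y, hy⟩ := hbc.approx (ε := ε / 2 / (‖x‖ * ‖x‖ + 1)) (by positivity)
  refine ⟨x * y, ?_⟩
  have h1 : x * y * c * star (x * y) - a =
      x * (y * c * star y - b) * star x + (x * b * star x - a) := by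
    rw [star_mul]; noncomm_ring
  have h2 : ‖x * (y * c * star y - b) * star x‖ ≤ (‖x‖ * ‖x‖ + 1) * ‖y * c * star y - b‖ := by
    refine (norm_mul_le _ _).trans ?_
    rw [norm_star]
    have h3 := norm_mul_le x (y * c * star y - b)
    have h4 := norm_nonneg x
    have h5 := norm_nonneg (y * c * star y - b)
    nlinarith
  have h6 : (‖x‖ * ‖x‖ + 1) * ‖y * c * star y - b‖ < ε / 2 := by
    rw [lt_div_iff₀ (by positivity)] at hy
    linarith
  rw [h1]
  linarith [norm_add_le (x * (y * c * star y - b) * star x) (x * b * star x - a)]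

/-- `D₊` is preordered by Cuntz subequivalence. -/
instance : Preorder (PosCone D) where
  le a b := CuntzLE a.1 b.1
  le_refl a := .refl a.1
  le_trans _ _ _ := CuntzLE.trans

/-- `0` as a positive element. -/
def PosCone.zero : PosCone D := ⟨0, 0, by simp⟩

/-- The positive elementary tensor `a ⊗ b` of positive elements. -/
def PosCone.tmul {A : Type u} {B : Type v} [NonUnitalCStarAlgebra A] [NonUnitalCStarAlgebra B]
    (a : PosCone A) (b : PosCone B) : PosCone (CTensor A B) :=
  ⟨CTensor.tmul a.1 b.1, by
    obtain ⟨c, hc⟩ := a.2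
    obtain ⟨d, hd⟩ := b.2
    exact ⟨CTensor.tmul c d, by rw [CTensor.star_tmul, CTensor.tmul_mul_tmul, ← hc, ← hd]⟩⟩

/-- `e₀₀` as a positive element of `𝒦`. -/
def e00Pos : PosCone K := ⟨e00, e00, by
  have h1 : star (InnerProductSpace.rankOne ℂ (ket 0) (ket 0)) =
      InnerProductSpace.rankOne ℂ (ket 0) (ket 0) := by
    rw [ContinuousLinearMap.star_eq_adjoint, InnerProductSpace.adjoint_rankOne]
  have h2 : IsIdempotentElem (InnerProductSpace.rankOne ℂ (ket 0) (ket 0)) :=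
    InnerProductSpace.isIdempotentElem_rankOne_self (by simp [ket])
  ext1
  change InnerProductSpace.rankOne ℂ (ket 0) (ket 0) =
    star (InnerProductSpace.rankOne ℂ (ket 0) (ket 0)) *
      InnerProductSpace.rankOne ℂ (ket 0) (ket 0)
  rw [h1, h2.eq]⟩

end Cuntz

/-! ### The Cuntz semigroup -/

section CuntzSemigroup

variable {A : Type u} [NonUnitalCStarAlgebra A]

/-- The *-homomorphism `x ↦ (1 ⊗ w) x (1 ⊗ w)*` of `A ⊗ 𝒦`, where `w = isomL i`. -/
def conjStab (i : Fin 2) : CTensor A K →⋆ₙₐ[ℂ] CTensor A K := CTensor.mapRight (conjIsom i)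

theorem conjStab_zero_mul_one (x y : CTensor A K) : conjStab 0 x * conjStab 1 y = 0 :=
  CTensor.mapRight_mul_mapRight_eq_zero conjIsom_zero_mul_one x y

theorem conjStab_one_mul_zero (x y : CTensor A K) : conjStab 1 x * conjStab 0 y = 0 := by
  have h := congrArg star (conjStab_zero_mul_one (star y) (star x))
  rw [star_mul, ← map_star, ← map_star, star_star, star_star, star_zero] at h
  exact h

/-- `Θ (diag (x, y))`, where `Θ : M₂(A ⊗ 𝒦) → A ⊗ 𝒦` is the inner isomorphism
`(x_{ij}) ↦ ∑ wᵢ x_{ij} wⱼ*` given by the isometries `wᵢ = 1 ⊗ isomL i` of `M(A ⊗ 𝒦)`. -/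
def diagSum (x y : CTensor A K) : CTensor A K := conjStab 0 x + conjStab 1 y

theorem diagSum_mul (x y x' y' : CTensor A K) :
    diagSum x y * diagSum x' y' = diagSum (x * x') (y * y') := by
  simp only [diagSum, add_mul, mul_add, conjStab_zero_mul_one, conjStab_one_mul_zero, map_mul]
  abel

theorem star_diagSum (x y : CTensor A K) : star (diagSum x y) = diagSum (star x) (star y) := by
  simp only [diagSum, star_add, map_star]

theorem CuntzLE.diagSum {x y x' y' : CTensor A K} (hx : CuntzLE x x') (hy : CuntzLE y y') :
    CuntzLE (diagSum x y) (diagSum x' y') := by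
  obtain ⟨r, hr⟩ := hx
  obtain ⟨s, hs⟩ := hy
  refine ⟨fun n => CuTensor.diagSum (r n) (s n), ?_⟩
  simp only [star_diagSum, diagSum_mul]
  exact (((CTensor.continuous_mapRight (conjIsom 0)).tendsto _).comp hr).add
    (((CTensor.continuous_mapRight (conjIsom 1)).tendsto _).comp hs)

/-- `diagSum` on positive elements. -/
def PosCone.diagSum (x y : PosCone (CTensor A K)) : PosCone (CTensor A K) :=
  ⟨CuTensor.diagSum x.1 y.1, by
    obtain ⟨c, hc⟩ := x.2
    obtain ⟨d, hd⟩ := y.2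
    exact ⟨CuTensor.diagSum c d, by rw [star_diagSum, diagSum_mul, ← hc, ← hd]⟩⟩

variable (A)

/-- The Cuntz semigroup `Cu(A) = (A ⊗ 𝒦)₊ / ∼`, where `a ∼ b` means `a ≾ b` and `b ≾ a`. -/
def Cu : Type u := Antisymmetrization (PosCone (CTensor A K)) (· ≤ ·)

/-- The order of `Cu(A)` is induced by Cuntz subequivalence. -/
instance : PartialOrder (Cu A) :=
  inferInstanceAs (PartialOrder (Antisymmetrization (PosCone (CTensor A K)) (· ≤ ·)))

variable {A}

/-- The class in `Cu(A)` of a positive element of `A ⊗ 𝒦`. -/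
def Cu.mk (x : PosCone (CTensor A K)) : Cu A := toAntisymmetrization (· ≤ ·) x

theorem Cu.mk_le_mk {x y : PosCone (CTensor A K)} : Cu.mk x ≤ Cu.mk y ↔ CuntzLE x.1 y.1 := Iff.rfl

/-- `[x] + [y] = [Θ (diag (x, y))]`. -/
instance : Add (Cu A) :=
  ⟨Quotient.map₂ PosCone.diagSum fun _ _ hx _ _ hy =>
    ⟨CuntzLE.diagSum hx.1 hy.1, CuntzLE.diagSum hx.2 hy.2⟩⟩

theorem Cu.mk_add_mk (x y : PosCone (CTensor A K)) :
    Cu.mk x + Cu.mk y = Cu.mk (x.diagSum y) := rfl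

instance : Zero (Cu A) := ⟨Cu.mk PosCone.zero⟩

/-- The class `[a] ∈ Cu(A)` of a positive element `a` of `A` itself, where `A` is regarded as a
subalgebra of `A ⊗ 𝒦` via `a ↦ a ⊗ e₀₀`. -/
def Cu.ofPos (a : PosCone A) : Cu A := Cu.mk (a.tmul e00Pos)

end CuntzSemigroup

/-! ### The category `Cu` and `≪`-bimorphisms -/

section Category

/-- Compact containment `s ≪ t`. -/
def WayBelow {S : Type u} [PartialOrder S] (s t : S) : Prop :=
  ∀ z : ℕ → S, Monotone z → ∀ u, IsLUB (Set.range z) u → t ≤ u → ∃ m, s ≤ z m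

/-- `S` is an object of the category `Cu`: a positively ordered commutative monoid in which
increasing sequences have suprema, every element is the supremum of a rapidly increasing sequence,
and suprema of increasing sequences and `≪` are compatible with addition. -/
structure IsCuSemigroup (S : Type u) [Add S] [Zero S] [PartialOrder S] : Prop where
  add_assoc : ∀ a b c : S, a + b + c = a + (b + c)
  add_comm : ∀ a b : S, a + b = b + a
  zero_add : ∀ a : S, 0 + a = a
  zero_le : ∀ a : S, 0 ≤ a
  add_le_add : ∀ a a' b b' : S, a ≤ a' → b ≤ b' → a + b ≤ a' + b'
  exists_sup : ∀ z : ℕ → S, Monotone z → ∃ u, IsLUB (Set.range z) u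
  exists_rapid : ∀ s : S, ∃ z : ℕ → S, (∀ n, WayBelow (z n) (z (n + 1))) ∧ IsLUB (Set.range z) s
  sup_add : ∀ (y z : ℕ → S) (s t : S), Monotone y → Monotone z → IsLUB (Set.range y) s →
    IsLUB (Set.range z) t → IsLUB (Set.range fun n => y n + z n) (s + t)
  wayBelow_add : ∀ s' s t' t : S, WayBelow s' s → WayBelow t' t → WayBelow (s' + t') (s + t)

/-- A map between ordered semigroups that preserves order, addition and suprema of increasing
sequences. -/
structure PreservesCu {S : Type u} {T : Type v} [Add S] [PartialOrder S] [Add T] [PartialOrder T]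
    (f : S → T) : Prop where
  monotone : Monotone f
  map_add : ∀ a b, f (a + b) = f a + f b
  map_sup : ∀ (z : ℕ → S) (s : S), Monotone z → IsLUB (Set.range z) s →
    IsLUB (Set.range fun n => f (z n)) (f s)

/-- A `≪`-bimorphism `S × T → R` of semigroups in `Cu`. -/
structure IsBimorphism {S : Type u} {T : Type v} {R : Type w} [Add S] [Zero S] [PartialOrder S]
    [Add T] [Zero T] [PartialOrder T] [Add R] [Zero R] [PartialOrder R] (φ : S → T → R) : Prop where
  left_mem : IsCuSemigroup S
  right_mem : IsCuSemigroup T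
  target_mem : IsCuSemigroup R
  left : ∀ t, PreservesCu fun s => φ s t
  right : ∀ s, PreservesCu (φ s)
  wayBelow : ∀ s' s t' t, WayBelow s' s → WayBelow t' t → WayBelow (φ s' t') (φ s t)

end Category

end CuTensor

end

/-!
Since `A` is stable, every class in `Cu(A)` is the class of some `a ∈ A₊`, and `[a] ≤ [a']` holds in
`Cu(A)` exactly if `a ≾ a'` in `A`; the same is true for `B`. As `≾` is compatible with elementary
tensors, `([a], [b]) ↦ [a ⊗ b]` is a well-defined map on `Cu(A) × Cu(B)`, and the only one with these
values.

*Surjectivity* (`Cu.ofPos_surjective`). An isomorphism `A ≅ A ⊗ 𝒦` supplies isometries `v i` with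
orthogonal ranges in the multiplier algebra of `A`. The strict sum of the multipliers `v i ⊗ e₀ᵢ` is an
isometry from `A ⊗ 𝒦` into the corner at `1 ⊗ e₀₀`; for `x = d*d` it yields `g` with `g*g = x` and
`gg*` in this corner, and `g*g ∼ gg*`.

*Order embedding* (`CuntzLE.of_cornerHom`). Compressing by `1 ⊗ e₀₀` pulls a comparison of `a ⊗ e₀₀`
and `a' ⊗ e₀₀` back to `A`, because the corner at `1 ⊗ e₀₀` is `A ⊗ e₀₀` and `a ↦ a ⊗ e₀₀` is
isometric. For the latter it suffices that `a ⊗ e₀₀ ≠ 0` for `a ≠ 0`, which is seen in the tensor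
product of a GNS representation of `A` with the representation of `𝒦` on `ℓ²`.

*The category `Cu`* (`isCuSemigroup`). The Cuntz semigroup of any C*-algebra is an object of `Cu`. The
main point is the existence of suprema (`exists_cuntz_sup`). Because of the room in `A ⊗ 𝒦`, any
`x ≾ z` is a norm limit of elements equivalent to `z` (`exists_near_of_cuntzLE`). For an increasing
sequence `(z n)`, let `F` be the closure of the set of the positive `x` with `x ≾ z m` for some `m`;
then `{w ∈ F | z n ≾ w}` is a dense `Gδ` in `F` for each `n`, and by Baire's theorem some `w ∈ F`
dominates all `z n`. Being a limit of elements below members of the sequence, `w` is the supremum.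
This also shows that `[a] ≪ [b]` as soon as some `k` with `k a = a` satisfies `k ≾ b`
(`Cu.wayBelow_of_unit`), in particular `[(b - ε)₊] ≪ [b]`, from which the remaining axioms follow.

*The bimorphism properties* (`isBimorphism_tensorCu`). In a stable algebra two positive elements can be
made orthogonal within their classes, and sums of orthogonal elements represent sums of classes, so
that `[a] ↦ [a ⊗ b]` is additive. Suprema are preserved since `(a - ε)₊ ⊗ b` tends to `a ⊗ b`, and `≪`
is preserved since `(a - ε)₊ ⊗ (b - δ)₊` has a unit of the form `k ⊗ l` with `k ≾ a` and `l ≾ b`.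
-/


noncomputable section

open scoped TensorProduct
open Filter Topology UniformSpace

universe u v w

namespace CuTensor

/-! ### Positive elements and the multiplier algebra -/

section

attribute [local instance] CStarAlgebra.spectralOrder CStarAlgebra.spectralOrderedRing

section Multiplier

variable {D : Type u} [NonUnitalCStarAlgebra D]

theorem PosCone.nonneg (a : PosCone D) : 0 ≤ a.1 := CStarAlgebra.nonneg_iff_eq_star_mul_self.2 a.2

/-- A nonnegative element, regarded as an element of the positive cone. -/
def PosCone.ofNonneg (a : D) (h : 0 ≤ a) : PosCone D :=
  ⟨a, CStarAlgebra.nonneg_iff_eq_star_mul_self.1 h⟩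

variable (D) in
/-- The multiplier algebra of `D`, as the unital C*-algebra of double centralizers. -/
abbrev Mult : Type u := DoubleCentralizer ℂ D

variable (D) in
/-- The inclusion of `D` into its multiplier algebra. -/
def toMult : D →⋆ₙₐ[ℂ] Mult D := DoubleCentralizer.coeHom

theorem mult_ext {m n : Mult D} (h : ∀ x, m.fst x = n.fst x) : m = n := by
  have h1 : (m - n).fst = 0 := by
    rw [DoubleCentralizer.sub_fst]; ext x; simp [h x]
  rw [← sub_eq_zero, ← norm_eq_zero, ← DoubleCentralizer.norm_fst, h1, norm_zero]

theorem toMult_fst (d x : D) : (toMult D d).fst x = d * x := rfl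

theorem mul_toMult (m : Mult D) (d : D) : m * toMult D d = toMult D (m.fst d) := by
  refine mult_ext fun x => ?_
  rw [DoubleCentralizer.mul_fst, mul_apply_eq_comp, toMult_fst, toMult_fst]
  -- left multipliers are right module maps, by centrality and faithfulness
  have h : ∀ z, z * m.fst (d * x) = z * (m.fst d * x) := fun z => by
    rw [← m.central, ← mul_assoc, ← mul_assoc, ← m.central]
  rw [← sub_eq_zero, ← CStarRing.star_mul_self_eq_zero_iff, mul_sub, h, sub_self]

theorem toMult_injective : Function.Injective (toMult D) := fun a b h => by
  rw [← sub_eq_zero, ← CStarRing.mul_star_self_eq_zero_iff]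
  have h1 : toMult D (a - b) = 0 := by rw [map_sub, h, sub_self]
  have h2 := toMult_fst (a - b) (star (a - b))
  rw [h1] at h2
  exact h2.symm

theorem norm_toMult (d : D) : ‖toMult D d‖ = ‖d‖ :=
  NonUnitalStarAlgHom.norm_map _ toMult_injective d

theorem continuous_toMult : Continuous (toMult D) :=
  (NonUnitalStarAlgHom.isometry _ toMult_injective).continuous

theorem toMult_mul (m : Mult D) (d : D) :
    toMult D d * m = toMult D (star ((star m).fst (star d))) := by
  rw [map_star, ← mul_toMult, map_star, star_mul, star_star, star_star]

theorem toMult_mono {a b : D} (h : a ≤ b) : toMult D a ≤ toMult D b :=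
  OrderHomClass.mono (toMult D) h

end Multiplier

/-! ### Cuntz comparison in a C*-algebra and its multiplier algebra -/

section Comparison

/-- `ee* ≤ y` implies `e*e ≾ y`: the element `r = e* (y + δ)^(-1/2)` satisfies
`‖r y r* - e*e‖ ≤ δ`. -/
theorem CuntzLE.of_mul_star_le_unital {M : Type u} [CStarAlgebra M] {e y : M}
    (h : e * star e ≤ y) : CuntzLE (star e * e) y := by
  have hy : 0 ≤ y := (mul_star_self_nonneg e).trans h
  refine .of_approx fun ε hε => ?_
  set δ := ε / 2 with hδ
  have hδ0 : 0 < δ := half_pos hε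
  have hpos : IsStrictlyPositive (y + algebraMap ℝ M δ) :=
    IsStrictlyPositive.nonneg_add hy (by
      rw [Algebra.algebraMap_eq_smul_one]
      exact IsStrictlyPositive.smul hδ0 isStrictlyPositive_one)
  set g := (y + algebraMap ℝ M δ) ^ (-(1 / 2) : ℝ) with hg
  have hgs : star g = g := (IsSelfAdjoint.of_nonneg CFC.rpow_nonneg).star_eq
  have hconj : g * (y + algebraMap ℝ M δ) * g = 1 := CFC.conjugate_rpow_neg_one_half _ hpos
  have h1 : g * y * g = 1 - δ • (g * g) := by
    rw [eq_sub_iff_add_eq, ← hconj, Algebra.algebraMap_eq_smul_one]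
    simp [mul_add, add_mul]
  have h2 : g * y * g ≤ 1 := by
    rw [h1, sub_le_self_iff]
    refine smul_nonneg hδ0.le ?_
    nth_rw 1 [← hgs]
    exact star_mul_self_nonneg g
  have h3 : g * (e * star e) * g ≤ 1 := by
    refine le_trans ?_ h2
    have := star_right_conjugate_le_conjugate h g
    rwa [hgs] at this
  have h4 : ‖g * e‖ * ‖g * e‖ ≤ 1 := by
    rw [← CStarRing.norm_self_mul_star, star_mul, hgs]
    rw [show g * e * (star e * g) = g * (e * star e) * g by simp only [mul_assoc]]
    refine (CStarAlgebra.norm_le_one_iff_of_nonneg _ ?_).2 h3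
    have := mul_star_self_nonneg (g * e)
    rw [star_mul, hgs] at this
    simpa only [mul_assoc] using this
  refine ⟨star e * g, ?_⟩
  have h5 : star e * g * y * star (star e * g) - star e * e = -(δ • (star (g * e) * (g * e))) := by
    rw [star_mul, star_star, hgs, show star e * g * y * (g * e) = star e * (g * y * g) * e by
      simp only [mul_assoc], h1, star_mul, hgs]
    simp only [mul_sub, sub_mul, mul_one, mul_smul_comm, smul_mul_assoc, mul_assoc]
    abel
  rw [h5, norm_neg, norm_smul, CStarRing.norm_star_mul_self, Real.norm_of_nonneg hδ0.le]
  calc δ * (‖g * e‖ * ‖g * e‖) ≤ δ * 1 := by gcongr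
    _ < ε := by rw [hδ]; linarith

variable {D : Type u} [NonUnitalCStarAlgebra D]

/-- Cuntz comparison may be tested with multipliers: if `x b x*` is near `a` for a multiplier `x`,
then so is `(x y) b (x y)*`, where `y ∈ D` is an approximate unit for `b`. -/
theorem CuntzLE.of_toMult {a b : D} (h : CuntzLE (toMult D a) (toMult D b)) : CuntzLE a b := by
  refine .of_approx fun ε hε => ?_
  obtain ⟨x, hx⟩ := h.approx (half_pos hε)
  obtain ⟨y, hy⟩ := (CuntzLE.refl b).approx (ε := ε / 2 / (‖x‖ * ‖x‖ + 1)) (by positivity)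
  refine ⟨x.fst y, ?_⟩
  rw [← norm_toMult]
  simp only [map_sub, map_mul, map_star, ← mul_toMult]
  set y' := toMult D y
  set b' := toMult D b
  have hy' : ‖y' * b' * star y' - b'‖ < ε / 2 / (‖x‖ * ‖x‖ + 1) := by
    rwa [← norm_toMult, map_sub, map_mul, map_mul, map_star] at hy
  have h1 : x * y' * b' * star (x * y') - toMult D a =
      x * (y' * b' * star y' - b') * star x + (x * b' * star x - toMult D a) := by
    rw [star_mul]; noncomm_ring
  have h2 : ‖x * (y' * b' * star y' - b') * star x‖ ≤
      (‖x‖ * ‖x‖ + 1) * ‖y' * b' * star y' - b'‖ := by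
    refine (norm_mul_le _ _).trans ?_
    rw [norm_star]
    have h3 := norm_mul_le x (y' * b' * star y' - b')
    have h4 := norm_nonneg x
    have h5 := norm_nonneg (y' * b' * star y' - b')
    nlinarith
  have h6 : (‖x‖ * ‖x‖ + 1) * ‖y' * b' * star y' - b'‖ < ε / 2 := by
    rw [lt_div_iff₀ (by positivity)] at hy'
    linarith
  rw [h1]
  linarith [norm_add_le (x * (y' * b' * star y' - b') * star x) (x * b' * star x - toMult D a)]

/-- If `a = m b m*` for a multiplier `m`, then `a ≾ b`. -/
theorem CuntzLE.of_mult {a b : D} (m : Mult D)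
    (h : toMult D a = m * toMult D b * star m) : CuntzLE a b :=
  .of_toMult ⟨fun _ => m, by rw [h]; exact tendsto_const_nhds⟩

theorem CuntzLE.of_mul_star_le {e y : D} (h : e * star e ≤ y) : CuntzLE (star e * e) y := by
  refine .of_toMult ?_
  rw [map_mul, map_star]
  refine .of_mul_star_le_unital ?_
  rw [← map_star, ← map_mul]
  exact toMult_mono h

theorem CuntzLE.star_mul_self (e : D) : CuntzLE (star e * e) (e * star e) := .of_mul_star_le le_rfl

theorem CuntzLE.mul_star_self (e : D) : CuntzLE (e * star e) (star e * e) := by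
  simpa using CuntzLE.star_mul_self (star e)

theorem CuntzLE.of_le {x y : D} (hx : 0 ≤ x) (h : x ≤ y) : CuntzLE x y := by
  obtain ⟨c, rfl⟩ := CStarAlgebra.nonneg_iff_eq_mul_star_self.1 hx
  exact (CuntzLE.mul_star_self c).trans (.of_mul_star_le h)

theorem CuntzLE.smul_left {c : ℝ} (hc : 0 ≤ c) (x : D) : CuntzLE (c • x) x := by
  refine .of_mult (((√c : ℝ) : ℂ) • (1 : Mult D)) ?_
  rw [star_smul, star_one, smul_mul_assoc, one_mul, mul_smul_comm, mul_one, smul_smul,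
    ← Complex.coe_smul, map_smul, Complex.star_def, Complex.conj_ofReal, ← Complex.ofReal_mul,
    Real.mul_self_sqrt hc]

theorem CuntzLE.of_le_smul {x y : D} {c : ℝ} (hc : 0 ≤ c) (hx : 0 ≤ x) (h : x ≤ c • y) :
    CuntzLE x y := (CuntzLE.of_le hx h).trans (.smul_left hc y)

theorem CuntzLE.of_tendsto {x : ℕ → D} {a b : D} (h : Tendsto x atTop (𝓝 a))
    (hx : ∀ n, CuntzLE (x n) b) : CuntzLE a b := by
  refine .of_approx fun ε hε => ?_
  obtain ⟨n, hn⟩ := ((tendsto_iff_norm_sub_tendsto_zero.1 h).eventually_lt_const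
    (half_pos hε)).exists
  obtain ⟨r, hr⟩ := (hx n).approx (half_pos hε)
  refine ⟨r, ?_⟩
  rw [show r * b * star r - a = (r * b * star r - x n) + (x n - a) by abel]
  linarith [norm_add_le (r * b * star r - x n) (x n - a)]

end Comparison

end

/-! ### Orthogonal sums and units -/

section

attribute [local instance] CStarAlgebra.spectralOrder CStarAlgebra.spectralOrderedRing

section Orthogonality

variable {D : Type u} [NonUnitalCStarAlgebra D]

theorem CuntzLE.conj (r z : D) : CuntzLE (r * z * star r) z := ⟨fun _ => r, tendsto_const_nhds⟩

/-- Orthogonality of positive elements passes to their square roots. -/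
theorem mul_eq_zero_of_sq_mul_sq {p q : D} (hp : IsSelfAdjoint p) (hq : IsSelfAdjoint q)
    (h : p * p * (q * q) = 0) : p * q = 0 := by
  have h1 : p * (q * q) = 0 := by
    rw [← CStarRing.star_mul_self_eq_zero_iff, star_mul, star_mul, hp.star_eq, hq.star_eq,
      show q * q * p * (p * (q * q)) = q * q * (p * p * (q * q)) by simp only [mul_assoc], h,
      mul_zero]
  rw [← CStarRing.mul_star_self_eq_zero_iff, star_mul, hp.star_eq, hq.star_eq,
    show p * q * (q * p) = p * (q * q) * p by simp only [mul_assoc], h1, zero_mul]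

/-- Cuntz comparison is additive when the larger elements are orthogonal. -/
theorem CuntzLE.add_of_mul_eq_zero {x y x' y' : D} (hx' : 0 ≤ x') (hy' : 0 ≤ y')
    (hx : CuntzLE x x') (hy : CuntzLE y y') (h : x' * y' = 0) : CuntzLE (x + y) (x' + y') := by
  obtain ⟨p, hp, rfl⟩ := CStarAlgebra.nonneg_iff_exists_isSelfAdjoint_and_eq_mul_self.1 hx'
  obtain ⟨q, hq, rfl⟩ := CStarAlgebra.nonneg_iff_exists_isSelfAdjoint_and_eq_mul_self.1 hy'
  have hpq : p * q = 0 := mul_eq_zero_of_sq_mul_sq hp hq h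
  have hqp : q * p = 0 := by
    simpa [hp.star_eq, hq.star_eq] using congrArg star hpq
  obtain ⟨r, hr⟩ := hx
  obtain ⟨s, hs⟩ := hy
  refine .of_tendsto (hr.add hs) fun n => ?_
  -- `e* = r p + s q` satisfies `e*e = r p² r* + s q² s*` and `ee* ≤ C (p² + q²)`
  set α := r n * p
  set β := s n * q
  have hαβ : α * star β = 0 := by
    simp only [α, β, star_mul, hq.star_eq]
    rw [show r n * p * (q * star (s n)) = r n * (p * q) * star (s n) by simp only [mul_assoc], hpq]
    simp
  have hβα : β * star α = 0 := by simpa using congrArg star hαβ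
  have h1 : r n * (p * p) * star (r n) + s n * (q * q) * star (s n) =
      star (star (α + β)) * star (α + β) := by
    rw [star_star, star_add, mul_add, add_mul, add_mul, hαβ, hβα]
    simp only [α, β, star_mul, hp.star_eq, hq.star_eq, mul_assoc, zero_add, add_zero]
  have h2 : star α * α ≤ ‖star (r n) * r n‖ • (p * p) := by
    have := CStarAlgebra.star_left_conjugate_le_norm_smul (a := p)
      (hb := IsSelfAdjoint.star_mul_self (r n))
    simpa only [α, star_mul, hp.star_eq, mul_assoc] using this
  have h3 : star β * β ≤ ‖star (s n) * s n‖ • (q * q) := by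
    have := CStarAlgebra.star_left_conjugate_le_norm_smul (a := q)
      (hb := IsSelfAdjoint.star_mul_self (s n))
    simpa only [β, star_mul, hq.star_eq, mul_assoc] using this
  set c := ‖star (r n) * r n‖
  set d := ‖star (s n) * s n‖
  have hpp : 0 ≤ p * p := hx'
  have hqq : 0 ≤ q * q := hy'
  have hc : 0 ≤ c := norm_nonneg _
  have hd : 0 ≤ d := norm_nonneg _
  have h4 : star (α + β) * star (star (α + β)) ≤ (2 * (c + d)) • (p * p + q * q) := by
    have h5 : 0 ≤ star (α - β) * (α - β) := star_mul_self_nonneg _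
    have h6 : star (α + β) * (α + β) + star (α - β) * (α - β) =
        (2 : ℝ) • (star α * α + star β * β) := by
      rw [two_smul]; simp only [star_add, star_sub]; noncomm_ring
    rw [star_star]
    calc star (α + β) * (α + β) ≤ star (α + β) * (α + β) + star (α - β) * (α - β) :=
          le_add_of_nonneg_right h5
      _ = (2 : ℝ) • (star α * α + star β * β) := h6
      _ ≤ (2 : ℝ) • (c • (p * p) + d • (q * q)) := by gcongr
      _ ≤ (2 : ℝ) • ((c + d) • (p * p) + (c + d) • (q * q)) := by
          gcongr <;> linarith
      _ = _ := by rw [← smul_add, smul_smul]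
  rw [h1]
  exact (CuntzLE.of_mul_star_le h4).trans (.smul_left (by positivity) _)

/-- If `h` is a unit for `a = s²` and `h` is within distance `1` of some `c = r z r*`, then `a ≾ z`,
since `s c s ≥ (1 - ‖h - c‖) a`. -/
theorem CuntzLE.of_unit {a h r z : D} (ha : 0 ≤ a) (hh : IsSelfAdjoint h) (hz : 0 ≤ z)
    (hha : h * a = a) (hr : ‖r * z * star r - h‖ < 1) : CuntzLE a z := by
  obtain ⟨s, hs, rfl⟩ := CStarAlgebra.nonneg_iff_exists_isSelfAdjoint_and_eq_mul_self.1 ha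
  have hhs : h * s = s := by
    rw [← sub_eq_zero, ← CStarRing.mul_star_self_eq_zero_iff, star_sub, star_mul, hs.star_eq,
      hh.star_eq, show (h * s - s) * (s * h - s) = (h * (s * s) - s * s) * h -
        (h * (s * s) - s * s) by noncomm_ring, hha]
    simp
  set c := r * z * star r with hc
  have hcs : IsSelfAdjoint c := by
    rw [IsSelfAdjoint, hc, star_mul, star_mul, star_star, (IsSelfAdjoint.of_nonneg hz).star_eq,
      mul_assoc]
  have h0 : ‖h - c‖ < 1 := by rwa [norm_sub_rev]
  have h1 : s * (h - c) * s ≤ ‖h - c‖ • (s * s) := by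
    have := CStarAlgebra.star_left_conjugate_le_norm_smul (a := s) (hb := hh.sub hcs)
    rwa [hs.star_eq] at this
  have h2 : s * (h - c) * s = s * s - s * c * s := by
    rw [mul_sub, sub_mul, mul_assoc s h s, hhs]
  have h3 : (1 - ‖h - c‖) • (s * s) ≤ s * c * s := by
    rw [sub_smul, one_smul, sub_le_comm, ← h2]; exact h1
  have h4 : s * s ≤ (1 - ‖h - c‖)⁻¹ • (s * c * s) := by
    have hp : 0 < 1 - ‖h - c‖ := by linarith
    calc s * s = (1 - ‖h - c‖)⁻¹ • (1 - ‖h - c‖) • (s * s) := by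
          rw [smul_smul, inv_mul_cancel₀ hp.ne', one_smul]
      _ ≤ _ := by gcongr
  refine (CuntzLE.of_le_smul (by simpa using h0.le) ha h4).trans ?_
  have h5 : s * c * s = s * r * z * star (s * r) := by
    rw [hc, star_mul, hs.star_eq]; simp only [mul_assoc]
  rw [h5]
  exact .conj _ _

end Orthogonality

/-! ### Cut-downs of positive elements -/

section CutDown

variable {D : Type u} [NonUnitalCStarAlgebra D]

/-- The cut-down `(x - ε)₊` of a positive element. -/
def cut (ε : ℝ) (x : D) : D := cfcₙ (fun t : ℝ => max (t - ε) 0) x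

theorem cut_nonneg (ε : ℝ) (x : D) : 0 ≤ cut ε x := cfcₙ_nonneg fun _ _ => le_max_right _ _

theorem quasispectrum_nonneg' {x : D} (hx : 0 ≤ x) {t : ℝ} (ht : t ∈ quasispectrum ℝ x) : 0 ≤ t :=
  quasispectrum_nonneg_of_nonneg x hx t ht

theorem norm_cut_sub_le {ε : ℝ} (hε : 0 ≤ ε) {x : D} (hx : 0 ≤ x) : ‖cut ε x - x‖ ≤ ε := by
  have hxs : IsSelfAdjoint x := .of_nonneg hx
  have h : cut ε x - x = cfcₙ (fun t : ℝ => max (t - ε) 0 - t) x := by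
    rw [cfcₙ_sub _ _ x (by fun_prop) (by simp [hε]) (by fun_prop) rfl, cfcₙ_id' ℝ x, cut]
  rw [h]
  refine norm_cfcₙ_le fun t ht => ?_
  have ht0 := quasispectrum_nonneg' hx ht
  rw [Real.norm_eq_abs, abs_le]
  rcases max_cases (t - ε) 0 with h | h <;> constructor <;> linarith

theorem cut_mono {ε ε' : ℝ} (hε : 0 ≤ ε') (h : ε' ≤ ε) {x : D} (hx : 0 ≤ x) :
    cut ε x ≤ cut ε' x := by
  have hxs : IsSelfAdjoint x := .of_nonneg hx
  refine cfcₙ_mono (fun t _ => ?_) (by fun_prop) (by fun_prop) (by simp; linarith) (by simp [hε])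
  exact max_le_max (by linarith) le_rfl

theorem cut_zero {x : D} (hx : 0 ≤ x) : cut 0 x = x := by
  have hxs : IsSelfAdjoint x := .of_nonneg hx
  conv_rhs => rw [← cfcₙ_id' ℝ x]
  refine cfcₙ_congr fun t ht => ?_
  have ht0 := quasispectrum_nonneg' hx ht
  simp [ht0]

/-- For `ε' < ε` there is a unit `k` of `(x - ε)₊` with `k ≾ (x - ε')₊`: a function of `x` that is `1`
on `[ε, ∞)` and `0` on `[0, ε']`. -/
theorem exists_unit_cut {ε ε' : ℝ} (hε' : 0 ≤ ε') (h : ε' < ε) {x : D} (hx : 0 ≤ x) :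
    ∃ k : D, 0 ≤ k ∧ k * cut ε x = cut ε x ∧ CuntzLE k (cut ε' x) := by
  have hxs : IsSelfAdjoint x := .of_nonneg hx
  have hd : 0 < ε - ε' := by linarith
  -- `f` is `0` up to `ε'`, `1` from `ε` on, and linear in between
  let f : ℝ → ℝ := fun t => min 1 ((ε - ε')⁻¹ * max (t - ε') 0)
  have hf : Continuous f := by fun_prop
  have hf0 : f 0 = 0 := by simp [f, hε']
  have hfn : ∀ t, 0 ≤ f t := fun t => by positivity
  have hk : 0 ≤ cfcₙ f x := cfcₙ_nonneg fun t _ => hfn t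
  refine ⟨cfcₙ f x, hk, ?_, ?_⟩
  · rw [cut, ← cfcₙ_mul f _ x hf.continuousOn hf0 (by fun_prop) (by simp; linarith)]
    refine cfcₙ_congr fun t _ => ?_
    rcases le_total t ε with ht | ht
    · simp [ht]
    · have : f t = 1 := by
        refine min_eq_left ?_
        rw [max_eq_left (by linarith), ← div_eq_inv_mul, one_le_div hd]
        linarith
      simp [this]
  · refine CuntzLE.of_le_smul (c := (ε - ε')⁻¹) (by positivity) hk ?_
    rw [cut, ← cfcₙ_smul _ _ x (by fun_prop) (by simp [hε'])]
    refine cfcₙ_mono (fun t _ => min_le_right _ _) hf.continuousOn (by fun_prop) hf0 (by simp [hε'])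

end CutDown

end

/-! ### Perturbation of Cuntz subequivalent elements -/

section

attribute [local instance] CStarAlgebra.spectralOrder CStarAlgebra.spectralOrderedRing

section Rotation

theorem norm_mul_of_isometry {M : Type u} [CStarAlgebra M] {V : M} (hV : star V * V = 1) (x : M) :
    ‖V * x‖ = ‖x‖ := by
  rw [← mul_self_inj_of_nonneg (norm_nonneg _) (norm_nonneg _), ← CStarRing.norm_star_mul_self,
    ← CStarRing.norm_star_mul_self, star_mul, mul_assoc, ← mul_assoc (star V), hV, one_mul]

/-- If `s` is an isometry whose range is orthogonal to that of `y`, then some isometry `V` carries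
a cut-down of `y*y` to an element near `yy*`: with `c = y k(y*y)`, a truncated polar part of `y`,
one takes `V = c + s (1 - c*c)^(1/2)`. -/
theorem exists_isometry_conj {M : Type u} [CStarAlgebra M] {y s : M} (hs : star s * s = 1)
    (hsy : star s * y = 0) {δ : ℝ} (hδ : 0 < δ) :
    ∃ V G : M, star V * V = 1 ∧ IsSelfAdjoint G ∧ G * (star y * y) * G ≤ star y * y ∧
      ‖V * (G * (star y * y) * G) * star V - y * star y‖ ≤ δ := by
  set q := star y * y with hq
  have hq0 : 0 ≤ q := star_mul_self_nonneg y
  have hqs : IsSelfAdjoint q := .of_nonneg hq0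
  have hspec : ∀ t ∈ spectrum ℝ q, 0 ≤ t := fun t ht => spectrum_nonneg_of_nonneg hq0 ht
  have hmax : ∀ t : ℝ, 0 < max t δ := fun t => lt_max_of_lt_right hδ
  have hmc : Continuous fun t : ℝ => (max t δ)⁻¹ :=
    (continuous_id.max continuous_const).inv₀ fun t => (hmax t).ne'
  -- With `q = y*y`, `K = k q`, `R = ρ q`, `G = l q`, the isometry is `V = y K + s R`. The functions
  -- satisfy `t k² + ρ² = 1`, so that `V*V = 1`; `ρ l = 0`, so that `V G = y K G`; and
  -- `t k² l² = 1 - n²` with `t n² ≤ δ`, so that `V (G q G) V* = y (1 - N²) y*` is `δ`-near `yy*`.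
  let k : ℝ → ℝ := fun t => √(max t δ)⁻¹
  let ρ : ℝ → ℝ := fun t => √(1 - t * (max t δ)⁻¹)
  let l : ℝ → ℝ := fun t => √(max (t - δ) 0 * (max t δ)⁻¹)
  let n : ℝ → ℝ := fun t => √(1 - t * max (t - δ) 0 * (max t δ)⁻¹ * (max t δ)⁻¹)
  have hk : Continuous k := hmc.sqrt
  have hρ : Continuous ρ := (continuous_const.sub (continuous_id.mul hmc)).sqrt
  have hl : Continuous l := (Continuous.mul (by fun_prop) hmc).sqrt
  have hn : Continuous n :=
    (continuous_const.sub ((Continuous.mul (by fun_prop) hmc).mul hmc)).sqrt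
  have hk2 : ∀ t, k t * k t = (max t δ)⁻¹ := fun t =>
    Real.mul_self_sqrt (inv_nonneg.2 (hmax t).le)
  have hl2 : ∀ t, l t * l t = max (t - δ) 0 * (max t δ)⁻¹ := fun t =>
    Real.mul_self_sqrt (mul_nonneg (le_max_right _ _) (inv_nonneg.2 (hmax t).le))
  have hρ2 : ∀ t, 0 ≤ t → ρ t * ρ t = 1 - t * (max t δ)⁻¹ := fun t _ =>
    Real.mul_self_sqrt (by
      rw [sub_nonneg, ← div_eq_mul_inv, div_le_one (hmax t)]; exact le_max_left _ _)
  have hn2 : ∀ t, 0 ≤ t → n t * n t = 1 - t * max (t - δ) 0 * (max t δ)⁻¹ * (max t δ)⁻¹ :=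
    fun t ht => Real.mul_self_sqrt (by
      rw [sub_nonneg, ← div_eq_mul_inv, ← div_eq_mul_inv, div_div, div_le_one (by positivity)]
      have h1 : t ≤ max t δ := le_max_left _ _
      have h2 : max (t - δ) 0 ≤ max t δ := max_le (by linarith) (hmax t).le
      exact mul_le_mul h1 h2 (le_max_right _ _) (hmax t).le)
  set K := cfc k q
  set R := cfc ρ q
  set G := cfc l q
  set N := cfc n q
  have hK : star K = K := (IsSelfAdjoint.cfc (f := k) (a := q)).star_eq
  have hR : star R = R := (IsSelfAdjoint.cfc (f := ρ) (a := q)).star_eq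
  have hG : star G = G := (IsSelfAdjoint.cfc (f := l) (a := q)).star_eq
  have hN : star N = N := (IsSelfAdjoint.cfc (f := n) (a := q)).star_eq
  have hconj : ∀ f : ℝ → ℝ, Continuous f → cfc f q * q * cfc f q = cfc (fun t => f t * t * f t) q :=
    fun f hf => by
      conv_lhs => rw [← cfc_id' ℝ q]
      rw [cfc_id' ℝ q]
      nth_rw 2 [← cfc_id' ℝ q]
      rw [← cfc_mul f _ q (by fun_prop) (by fun_prop),
        ← cfc_mul _ f q (by fun_prop) (by fun_prop)]
  have hRG : R * G = 0 := by
    rw [← cfc_mul ρ l q (by fun_prop) (by fun_prop), ← cfc_zero (R := ℝ) (a := q)]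
    refine cfc_congr fun t ht => ?_
    rcases le_total t δ with h | h
    · have : l t = 0 := by simp [l, h]
      simp [this]
    · have : ρ t = 0 := by
        simp [ρ, max_eq_left h, mul_inv_cancel₀ (hδ.trans_le h).ne']
      simp [this]
  have hKR : K * q * K + R * R = 1 := by
    rw [hconj k hk, ← cfc_mul ρ ρ q (by fun_prop) (by fun_prop),
      ← cfc_add q _ _ (by fun_prop) (by fun_prop), ← cfc_one (R := ℝ) (a := q)]
    refine cfc_congr fun t ht => ?_
    simp only [Pi.one_apply]
    rw [hρ2 t (hspec t ht), show k t * t * k t = t * (k t * k t) by ring, hk2]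
    ring
  have hys : star y * s = 0 := by simpa using congrArg star hsy
  refine ⟨y * K + s * R, G, ?_, hG, ?_, ?_⟩
  · rw [star_add, star_mul, star_mul, hK, hR, ← hKR]
    rw [show (K * star y + R * star s) * (y * K + s * R) = K * (star y * y) * K +
      K * (star y * s) * R + R * (star s * y) * K + R * (star s * s) * R by noncomm_ring,
      hsy, hys, hs]
    simp [hq]
  · rw [hconj l hl]
    conv_rhs => rw [← cfc_id' ℝ q]
    refine cfc_mono (fun t ht => ?_) (by fun_prop) (by fun_prop)
    rw [show l t * t * l t = t * (l t * l t) by ring, hl2]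
    refine mul_le_of_le_one_right (hspec t ht) ?_
    rw [← div_eq_mul_inv, div_le_one (hmax t)]
    exact max_le (by linarith [le_max_left t δ]) (hmax t).le
  · have hVG : (y * K + s * R) * G = y * (K * G) := by
      rw [add_mul, mul_assoc s, hRG]; simp [mul_assoc]
    have hKGN : (K * G) * q * (G * K) = 1 - N * N := by
      have h1 : K * G = cfc (fun t => k t * l t) q := (cfc_mul k l q (by fun_prop) (by fun_prop)).symm
      have h2 : G * K = cfc (fun t => k t * l t) q := by
        rw [← cfc_mul l k q (by fun_prop) (by fun_prop)]
        exact cfc_congr fun t _ => mul_comm _ _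
      rw [h1, h2, hconj _ (by fun_prop), ← cfc_mul n n q (by fun_prop) (by fun_prop),
        ← cfc_one (R := ℝ) (a := q), ← cfc_sub _ _ q (by fun_prop) (by fun_prop)]
      refine cfc_congr fun t ht => ?_
      simp only [Pi.one_apply]
      rw [hn2 t (hspec t ht), show k t * l t * t * (k t * l t) = t * (l t * l t) * (k t * k t) by ring,
        hk2, hl2]
      ring
    have h3 : (y * K + s * R) * (G * q * G) * star (y * K + s * R) - y * star y =
        -((y * N) * star (y * N)) := by
      have h4 : G * star (y * K + s * R) = G * K * star y := by
        have := congrArg star hVG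
        rwa [star_mul, hG, star_mul, star_mul, hG, hK] at this
      rw [show (y * K + s * R) * (G * q * G) * star (y * K + s * R) =
        (y * K + s * R) * G * q * (G * star (y * K + s * R)) by simp only [mul_assoc], hVG, h4,
        show y * (K * G) * q * (G * K * star y) = y * ((K * G) * q * (G * K)) * star y by
          simp only [mul_assoc], hKGN, star_mul, hN]
      noncomm_ring
    rw [h3, norm_neg, CStarRing.norm_self_mul_star, ← CStarRing.norm_star_mul_self, star_mul, hN,
      show N * star y * (y * N) = N * q * N by simp only [hq, mul_assoc], hconj n hn]
    refine norm_cfc_le hδ.le fun t ht => ?_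
    have ht0 := hspec t ht
    rw [show n t * t * n t = t * (n t * n t) by ring, hn2 t ht0, Real.norm_eq_abs]
    rcases le_total t δ with h | h
    · rw [max_eq_right (a := t - δ) (by linarith)]
      simp [abs_of_nonneg ht0, h]
    · have : t ≠ 0 := (hδ.trans_le h).ne'
      rw [max_eq_left h, max_eq_left (by linarith),
        show t * (1 - t * (t - δ) * t⁻¹ * t⁻¹) = δ by field_simp; ring, abs_of_pos hδ]

variable {D : Type u} [NonUnitalCStarAlgebra D]

/-- If there is an isometry `W` such that `(W*)^k → 0` strictly, as in a stable algebra, then every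
`a ≾ b` is a limit of elements that are Cuntz equivalent to `b`. Indeed `a` is near `yy*` with
`y = r b^(1/2)`, an isometry `V` carries a positive element `b₁ ≤ y*y ≤ C b` to one near `yy*`, and
`w = V (b₁ + η b) V*` is equivalent to `b₁ + η b`, hence to `b`. -/
theorem exists_near_of_cuntzLE {W : Mult D} (hW : star W * W = 1)
    (hlim : ∀ x : D, Tendsto (fun k => star (W ^ k) * toMult D x) atTop (𝓝 0)) {a b : D}
    (hb : 0 ≤ b) (hab : CuntzLE a b) {ε : ℝ} (hε : 0 < ε) :
    ∃ w : D, 0 ≤ w ∧ CuntzLE w b ∧ CuntzLE b w ∧ ‖w - a‖ < ε := by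
  obtain ⟨β, hβ, rfl⟩ := CStarAlgebra.nonneg_iff_exists_isSelfAdjoint_and_eq_mul_self.1 hb
  obtain ⟨r₀, hr₀⟩ := hab.approx (ε := ε / 2) (by positivity)
  have hWk : ∀ k, star (W ^ k) * W ^ k = 1 := fun k => by
    induction k with
    | zero => simp
    | succ k ih =>
      rw [pow_succ, star_mul, show star W * star (W ^ k) * (W ^ k * W) =
        star W * (star (W ^ k) * W ^ k) * W by simp only [mul_assoc], ih, mul_one, hW]
  -- `r = (1 - s s*) r₀` with `s = W ^ k` is near `r₀` for large `k`, and its range leaves room for `s`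
  obtain ⟨s, r, hs, hsr, hr⟩ : ∃ (s : Mult D) (r : D), star s * s = 1 ∧ star s * toMult D r = 0 ∧
      ‖r * (β * β) * star r - a‖ < ε / 2 := by
    let ρ : ℕ → D := fun k => r₀ - (W ^ k * star (W ^ k)).fst r₀
    have hρ' : ∀ k, toMult D (ρ k) = toMult D r₀ - W ^ k * (star (W ^ k) * toMult D r₀) := fun k => by
      rw [map_sub, ← mul_toMult, mul_assoc]
    have hρ : Tendsto ρ atTop (𝓝 r₀) := by
      rw [tendsto_iff_norm_sub_tendsto_zero]
      refine (tendsto_zero_iff_norm_tendsto_zero.1 (hlim r₀)).congr fun k => ?_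
      rw [← norm_toMult (ρ k - r₀), map_sub, hρ', sub_sub_cancel_left, norm_neg,
        norm_mul_of_isometry (hWk k)]
    have h1 : Tendsto (fun k => ‖ρ k * (β * β) * star (ρ k) - a‖) atTop
        (𝓝 ‖r₀ * (β * β) * star r₀ - a‖) :=
      (((hρ.mul_const (β * β)).mul hρ.star).sub_const a).norm
    obtain ⟨k, hk⟩ := (h1.eventually_lt_const hr₀).exists
    refine ⟨W ^ k, ρ k, hWk k, ?_, hk⟩
    rw [hρ', mul_sub, ← mul_assoc, hWk, one_mul, sub_self]
  set y := toMult D (r * β) with hy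
  have hsy : star s * y = 0 := by rw [hy, map_mul, ← mul_assoc, hsr, zero_mul]
  obtain ⟨V, G, hV, hG, hGy, hVG⟩ := exists_isometry_conj hs hsy (δ := ε / 4) (by positivity)
  set b := β * β with hbdef
  set η := ε / 4 / (‖b‖ + 1) with hη
  have hη0 : 0 < η := by positivity
  let x₁ := G.fst (star (r * β))
  have hx₁ : toMult D x₁ = G * star y := by rw [← mul_toMult, hy, map_star]
  let u₁ := V.fst x₁
  have hu₁ : toMult D u₁ = V * (G * star y) := by rw [← mul_toMult, hx₁]
  let u₂ := V.fst β
  have hu₂ : toMult D u₂ = V * toMult D β := by rw [← mul_toMult]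
  set w := u₁ * star u₁ + η • (u₂ * star u₂) with hw
  set b' := x₁ * star x₁ + η • b with hb'
  have hηM : ∀ (c : ℝ) (d : D), toMult D (c • d) = c • toMult D d := fun c d => by
    rw [← Complex.coe_smul, ← Complex.coe_smul, map_smul]
  have hwb : toMult D w = V * toMult D b' * star V := by
    rw [hw, hb', map_add, map_add, hηM, hηM, map_mul, map_mul, map_mul, map_star, map_star,
      map_star, hu₁, hu₂, hx₁, hbdef, map_mul]
    have : star (toMult D β) = toMult D β := by rw [← map_star, hβ.star_eq]
    simp only [star_mul, star_star, mul_add, add_mul, mul_smul_comm, smul_mul_assoc, mul_assoc, this]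
  have hx₁0 : 0 ≤ x₁ * star x₁ := mul_star_self_nonneg _
  have hb'0 : 0 ≤ b' := add_nonneg hx₁0 (smul_nonneg hη0.le hb)
  have hx₁b : toMult D (x₁ * star x₁) ≤ ‖star r * r‖ • toMult D b := by
    have h1 : star (r * β) * (r * β) ≤ ‖star r * r‖ • b := by
      have := CStarAlgebra.star_left_conjugate_le_norm_smul (a := β)
        (hb := IsSelfAdjoint.star_mul_self r)
      simpa only [star_mul, hβ.star_eq, mul_assoc] using this
    rw [← hηM]
    refine le_trans ?_ (toMult_mono h1)
    rw [map_mul, map_star, hx₁, map_mul, map_star, ← hy, star_mul, star_star, hG.star_eq]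
    simpa only [mul_assoc] using hGy
  refine ⟨w, ?_, ?_, ?_, ?_⟩
  · exact add_nonneg (mul_star_self_nonneg _) (smul_nonneg hη0.le (mul_star_self_nonneg _))
  · refine (CuntzLE.of_mult V hwb).trans (.of_toMult
      (.of_le_smul (c := ‖star r * r‖ + η) (by positivity) (map_nonneg (toMult D) hb'0) ?_))
    rw [add_smul, hb', map_add, hηM]
    exact add_le_add_left hx₁b _
  · have h1 : CuntzLE b' w := by
      refine CuntzLE.of_mult (star V) ?_
      rw [hwb, star_star, show star V * (V * toMult D b' * star V) * V =
        (star V * V) * toMult D b' * (star V * V) by simp only [mul_assoc], hV, one_mul, mul_one]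
    refine (CuntzLE.of_le_smul (c := η⁻¹) (by positivity) hb ?_).trans h1
    calc b = η⁻¹ • η • b := by rw [smul_smul, inv_mul_cancel₀ hη0.ne', one_smul]
      _ ≤ η⁻¹ • b' := by gcongr; exact le_add_of_nonneg_left hx₁0
  · have h1 : ‖u₁ * star u₁ - r * b * star r‖ ≤ ε / 4 := by
      rw [← norm_toMult]
      convert hVG using 2
      rw [map_sub, map_mul, map_star, hu₁, star_mul, star_mul, star_star, hG.star_eq, hy]
      congr 1
      · simp only [hbdef, map_mul, map_star, star_mul, ← mul_assoc]
        rw [← map_star _ β, hβ.star_eq]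
    have h2 : ‖η • (u₂ * star u₂)‖ < ε / 4 := by
      have h3 : ‖u₂ * star u₂‖ = ‖b‖ := by
        rw [CStarRing.norm_self_mul_star, ← norm_toMult, hu₂, norm_mul_of_isometry hV, norm_toMult,
          ← CStarRing.norm_star_mul_self, hβ.star_eq]
      rw [norm_smul, h3, Real.norm_of_nonneg hη0.le, hη, div_mul_eq_mul_div, div_lt_iff₀ (by positivity)]
      nlinarith [norm_nonneg b]
    rw [show w - a = (u₁ * star u₁ - r * b * star r) + η • (u₂ * star u₂) + (r * b * star r - a) by
      rw [hw]; abel]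
    linarith [norm_add_le ((u₁ * star u₁ - r * b * star r) + η • (u₂ * star u₂)) (r * b * star r - a),
      norm_add_le (u₁ * star u₁ - r * b * star r) (η • (u₂ * star u₂))]

end Rotation

end

/-! ### Suprema of increasing sequences -/

section

attribute [local instance] CStarAlgebra.spectralOrder CStarAlgebra.spectralOrderedRing

section Suprema

variable {D : Type u} [NonUnitalCStarAlgebra D]

theorem CuntzLE.zero_left (b : D) : CuntzLE 0 b := ⟨fun _ => 0, by simp⟩

theorem CuntzLE.of_monotone {z : ℕ → D} (h : ∀ n, CuntzLE (z n) (z (n + 1))) {m n : ℕ}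
    (hmn : m ≤ n) : CuntzLE (z m) (z n) := by
  induction hmn with
  | refl => exact .refl _
  | step _ ih => exact ih.trans (h _)

/-- If there is an isometry `W` such that `(W*)^k → 0` strictly, every `≾`-increasing sequence `z` of
positive elements has an upper bound which is a norm limit of elements `≾`-below members of `z`, and hence is a supremum. In the closed
set of all such limits, the condition `z j ≾ w` defines a dense `Gδ`: density holds since each
`x ≾ z m` is a limit of elements equivalent to `z (max m j)`. Baire's theorem gives the bound. -/
theorem exists_cuntz_sup {W : Mult D} (hW : star W * W = 1)
    (hlim : ∀ x : D, Tendsto (fun k => star (W ^ k) * toMult D x) atTop (𝓝 0)) {z : ℕ → D}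
    (hz : ∀ n, 0 ≤ z n) (hmono : ∀ n, CuntzLE (z n) (z (n + 1))) :
    ∃ w : D, 0 ≤ w ∧ (∀ n, CuntzLE (z n) w) ∧ w ∈ closure {x | ∃ m, CuntzLE x (z m)} := by
  let S : Set D := {x | 0 ≤ x ∧ ∃ m, CuntzLE x (z m)}
  have : CompleteSpace (closure S) := isClosed_closure.completeSpace_coe
  have : Nonempty (closure S) := ⟨⟨0, subset_closure ⟨le_rfl, 0, .zero_left _⟩⟩⟩
  let U : ℕ × ℕ → Set (closure S) := fun p =>
    ⋃ r : D, {w | ‖r * w.1 * star r - z p.1‖ < 1 / ((p.2 : ℝ) + 1)}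
  have hU : ∀ p, IsOpen (U p) := fun p => isOpen_iUnion fun r => by
    refine isOpen_lt ?_ continuous_const
    exact ((((continuous_const.mul continuous_subtype_val).mul continuous_const)).sub
      continuous_const).norm
  have hd : ∀ p, Dense (U p) := fun p => by
    rw [Metric.dense_iff]
    intro w ε hε
    obtain ⟨x, ⟨hx0, m, hxm⟩, hwx⟩ := Metric.mem_closure_iff.1 w.2 (ε / 2) (half_pos hε)
    have hx : CuntzLE x (z (max m p.1)) :=
      hxm.trans (.of_monotone hmono (le_max_left _ _))
    obtain ⟨y, hy0, hy1, hy2, hy3⟩ := exists_near_of_cuntzLE hW hlim (hz _) hx (half_pos hε)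
    refine ⟨⟨y, subset_closure ⟨hy0, _, hy1⟩⟩, ?_, ?_⟩
    · rw [Metric.mem_ball, Subtype.dist_eq]
      have h1 : dist y x < ε / 2 := by rwa [dist_eq_norm]
      rw [dist_comm] at hwx
      linarith [dist_triangle y x w.1]
    · have h2 : CuntzLE (z p.1) y := (CuntzLE.of_monotone hmono (le_max_right m p.1)).trans hy2
      obtain ⟨r, hr⟩ := h2.approx (ε := 1 / ((p.2 : ℝ) + 1)) (by positivity)
      exact Set.mem_iUnion.2 ⟨r, hr⟩
  obtain ⟨w, hw⟩ := (dense_iInter_of_isOpen hU hd).nonempty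
  rw [Set.mem_iInter] at hw
  refine ⟨w.1, ?_, fun n => .of_approx fun ε hε => ?_, ?_⟩
  · have h1 : closure S ⊆ {x | 0 ≤ x} := closure_minimal (fun x hx => hx.1)
      CStarAlgebra.isClosed_nonneg
    exact h1 w.2
  · obtain ⟨k, hk⟩ := exists_nat_one_div_lt hε
    obtain ⟨r, hr⟩ := Set.mem_iUnion.1 (hw (n, k))
    exact ⟨r, lt_trans hr hk⟩
  · exact closure_mono (fun x hx => hx.2) w.2

theorem CuntzLE.of_mem_closure {w b : D} {S : Set D} (hw : w ∈ closure S)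
    (hS : ∀ x ∈ S, CuntzLE x b) : CuntzLE w b := by
  obtain ⟨x, hx, hxw⟩ := mem_closure_iff_seq_limit.1 hw
  exact .of_tendsto hxw fun n => hS _ (hx n)

/-- If `k ≾ w` is a unit of `a` and `w` is a limit of elements `≾`-below members of `z`, then `a`
is `≾`-below a member of `z`. -/
theorem CuntzLE.exists_of_unit {z : ℕ → D} (hz : ∀ n, 0 ≤ z n) {a k w : D} (ha : 0 ≤ a)
    (hk : IsSelfAdjoint k) (hka : k * a = a) (hkw : CuntzLE k w)
    (hw : w ∈ closure {x | ∃ m, CuntzLE x (z m)}) : ∃ m, CuntzLE a (z m) := by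
  obtain ⟨r, hr⟩ := hkw.approx (ε := 1) one_pos
  obtain ⟨x, hx, hxw⟩ := mem_closure_iff_seq_limit.1 hw
  have h1 : Tendsto (fun n => ‖r * x n * star r - k‖) atTop (𝓝 ‖r * w * star r - k‖) :=
    (((hxw.const_mul r).mul_const (star r)).sub_const k).norm
  obtain ⟨n, hn⟩ := (h1.eventually_lt_const hr).exists
  obtain ⟨m, s, hs⟩ := hx n
  have h2 : Tendsto (fun i => ‖r * (s i * z m * star (s i)) * star r - k‖) atTop
      (𝓝 ‖r * x n * star r - k‖) :=
    (((hs.const_mul r).mul_const (star r)).sub_const k).norm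
  obtain ⟨i, hi⟩ := (h2.eventually_lt_const hn).exists
  refine ⟨m, .of_unit (r := r * s i) ha hk (hz m) hka ?_⟩
  simpa only [star_mul, mul_assoc] using hi

end Suprema

end

/-! ### Tensor products of multipliers -/

section

attribute [local instance] CStarAlgebra.spectralOrder CStarAlgebra.spectralOrderedRing

section TensorMultiplier

variable {A : Type u} {B : Type v} [NonUnitalCStarAlgebra A] [NonUnitalCStarAlgebra B]

/-- The left action of `star m` is the adjoint of that of `m`. -/
theorem star_fst_mul (m : Mult A) (a a' : A) : star (m.fst a) * a' = star a * (star m).fst a' := by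
  rw [DoubleCentralizer.star_fst, ← star_mul, m.central, star_mul, star_star]

/-- The action of `m ⊗ n` on `A ⊙ B`, for multipliers `m` of `A` and `n` of `B`. -/
def AlgTensor.mulMap (m : Mult A) (n : Mult B) : AlgTensor A B →ₗ[ℂ] AlgTensor A B :=
  (TensorProduct.map (m.fst : A →ₗ[ℂ] A) (n.fst : B →ₗ[ℂ] B) : A ⊗[ℂ] B →ₗ[ℂ] A ⊗[ℂ] B)

theorem AlgTensor.mulMap_tmul (m : Mult A) (n : Mult B) (a : A) (b : B) :
    AlgTensor.mulMap m n (AlgTensor.tmul a b) = AlgTensor.tmul (m.fst a) (n.fst b) := rfl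

theorem AlgTensor.tmul_add (a : A) (b b' : B) :
    AlgTensor.tmul a (b + b') = AlgTensor.tmul a b + AlgTensor.tmul a b' :=
  TensorProduct.tmul_add a b b'

theorem AlgTensor.add_tmul (a a' : A) (b : B) :
    AlgTensor.tmul (a + a') b = AlgTensor.tmul a b + AlgTensor.tmul a' b :=
  TensorProduct.add_tmul a a' b

theorem AlgTensor.smul_tmul (c : ℂ) (a : A) (b : B) :
    AlgTensor.tmul (c • a) b = c • AlgTensor.tmul a b :=
  TensorProduct.smul_tmul' c a b

theorem AlgTensor.tmul_smul (c : ℂ) (a : A) (b : B) :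
    AlgTensor.tmul a (c • b) = c • AlgTensor.tmul a b :=
  TensorProduct.tmul_smul c a b

theorem AlgTensor.linearMap_ext {E : Type*} [AddCommGroup E] [Module ℂ E]
    {f g : AlgTensor A B →ₗ[ℂ] E}
    (h : ∀ a b, f (AlgTensor.tmul a b) = g (AlgTensor.tmul a b)) : f = g := by
  ext x
  induction x using AlgTensor.induction with
  | h0 => simp
  | ht a b => exact h a b
  | ha x y hx hy => rw [map_add, map_add, hx, hy]

theorem AlgTensor.mulMap_mul (m m' : Mult A) (n n' : Mult B) (x : AlgTensor A B) :
    AlgTensor.mulMap (m * m') (n * n') x = AlgTensor.mulMap m n (AlgTensor.mulMap m' n' x) :=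
  congrArg (fun f : AlgTensor A B →ₗ[ℂ] AlgTensor A B => f x) (AlgTensor.linearMap_ext
    (f := AlgTensor.mulMap (m * m') (n * n'))
    (g := (AlgTensor.mulMap m n).comp (AlgTensor.mulMap m' n')) fun _ _ => rfl)

theorem AlgTensor.star_mulMap_mul (m : Mult A) (n : Mult B) (x y : AlgTensor A B) :
    star (AlgTensor.mulMap m n x) * y = star x * AlgTensor.mulMap (star m) (star n) y := by
  induction x using AlgTensor.induction with
  | h0 => simp
  | ha x x' hx hx' => simp [add_mul, hx, hx']
  | ht a b =>
    induction y using AlgTensor.induction with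
    | h0 => simp
    | ha x x' hx hx' => simp [mul_add, hx, hx']
    | ht a' b' =>
      simp only [AlgTensor.mulMap_tmul, AlgTensor.star_tmul, AlgTensor.tmul_mul_tmul, star_fst_mul]

/-- The element `r = (‖m‖² - m*m)^(1/2)` satisfies `m*m + r*r = ‖m‖²`. -/
theorem exists_star_mul_add_star_mul {M : Type u} [CStarAlgebra M] (m : M) :
    ∃ r : M, star m * m + star r * r = ((‖m‖ ^ 2 : ℝ) : ℂ) • 1 := by
  obtain ⟨r, hr⟩ := CStarAlgebra.nonneg_iff_eq_star_mul_self.1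
    (sub_nonneg.2 (CStarAlgebra.star_mul_le_algebraMap_norm_sq (a := m)))
  refine ⟨r, ?_⟩
  rw [← hr, add_sub_cancel, Algebra.algebraMap_eq_smul_one, Complex.coe_smul]

theorem norm_le_of_star_mul_add {D : Type u} [NonUnitalCStarAlgebra D] {x y z : D} {c : ℝ}
    (hc : 0 ≤ c) (h : star x * x + star y * y = ((c ^ 2 : ℝ) : ℂ) • (star z * z)) :
    ‖x‖ ≤ c * ‖z‖ := by
  rw [← sq_le_sq₀ (norm_nonneg _) (by positivity), mul_pow, sq ‖x‖, sq ‖z‖,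
    ← CStarRing.norm_star_mul_self, ← CStarRing.norm_star_mul_self (x := z)]
  have h1 : star x * x ≤ ((c ^ 2 : ℝ) : ℂ) • (star z * z) := by
    rw [← h]; exact le_add_of_nonneg_right (star_mul_self_nonneg y)
  refine (CStarAlgebra.norm_le_norm_of_nonneg_of_le (star_mul_self_nonneg x) h1).trans_eq ?_
  rw [norm_smul, Complex.norm_real, Real.norm_of_nonneg (by positivity)]

/-- The action of `m ⊗ 1` is bounded by `‖m‖`: with `r = (‖m‖² - m*m)^(1/2)`, the element
`(mx)*(mx) + (rx)*(rx)` equals `‖m‖² x*x`, whatever the C*-norm. -/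
theorem AlgTensor.norm_mulMap_left_le (m : Mult A) (x : AlgTensor A B) :
    ‖AlgTensor.mulMap m 1 x‖ ≤ ‖m‖ * ‖x‖ := by
  obtain ⟨r, hr⟩ := exists_star_mul_add_star_mul m
  rw [← CTensor.of.norm_map, ← CTensor.of.norm_map x]
  refine norm_le_of_star_mul_add (y := CTensor.of (AlgTensor.mulMap r 1 x)) (norm_nonneg m) ?_
  simp only [← CTensor.of_star, ← CTensor.of_mul, AlgTensor.star_mulMap_mul]
  rw [← map_add, ← map_smul, ← AlgTensor.mulMap_mul, ← AlgTensor.mulMap_mul, ← mul_add,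
    ← mul_smul_comm]
  congr 2
  have h1 : ∀ c : ℂ, c • x = (c • LinearMap.id : AlgTensor A B →ₗ[ℂ] AlgTensor A B) x := fun _ => rfl
  rw [h1, ← LinearMap.add_apply]
  congr 1
  refine AlgTensor.linearMap_ext fun a b => ?_
  rw [LinearMap.add_apply, AlgTensor.mulMap_tmul, AlgTensor.mulMap_tmul, ← AlgTensor.add_tmul,
    ← add_apply, ← DoubleCentralizer.add_fst, hr, DoubleCentralizer.smul_fst, star_one, one_mul]
  exact AlgTensor.smul_tmul _ _ _

theorem AlgTensor.norm_mulMap_right_le (n : Mult B) (x : AlgTensor A B) :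
    ‖AlgTensor.mulMap 1 n x‖ ≤ ‖n‖ * ‖x‖ := by
  obtain ⟨r, hr⟩ := exists_star_mul_add_star_mul n
  rw [← CTensor.of.norm_map, ← CTensor.of.norm_map x]
  refine norm_le_of_star_mul_add (y := CTensor.of (AlgTensor.mulMap 1 r x)) (norm_nonneg n) ?_
  simp only [← CTensor.of_star, ← CTensor.of_mul, AlgTensor.star_mulMap_mul]
  rw [← map_add, ← map_smul, ← AlgTensor.mulMap_mul, ← AlgTensor.mulMap_mul, ← mul_add,
    ← mul_smul_comm]
  congr 2
  have h1 : ∀ c : ℂ, c • x = (c • LinearMap.id : AlgTensor A B →ₗ[ℂ] AlgTensor A B) x := fun _ => rfl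
  rw [h1, ← LinearMap.add_apply]
  congr 1
  refine AlgTensor.linearMap_ext fun a b => ?_
  rw [LinearMap.add_apply, AlgTensor.mulMap_tmul, AlgTensor.mulMap_tmul, ← AlgTensor.tmul_add,
    ← add_apply, ← DoubleCentralizer.add_fst, hr, DoubleCentralizer.smul_fst, star_one, one_mul]
  exact AlgTensor.tmul_smul _ _ _

theorem AlgTensor.norm_mulMap_le (m : Mult A) (n : Mult B) (x : AlgTensor A B) :
    ‖AlgTensor.mulMap m n x‖ ≤ ‖m‖ * ‖n‖ * ‖x‖ := by
  rw [← mul_one m, ← one_mul n, AlgTensor.mulMap_mul, mul_one, one_mul, mul_assoc]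
  exact (AlgTensor.norm_mulMap_left_le m _).trans
    (mul_le_mul_of_nonneg_left (AlgTensor.norm_mulMap_right_le n x) (norm_nonneg m))

/-- The action of `m ⊗ n` on `A ⊗ B`, for multipliers `m` of `A` and `n` of `B`. -/
def CTensor.mulMapL (m : Mult A) (n : Mult B) : CTensor A B →L[ℂ] CTensor A B :=
  ((CTensor.of.toLinearMap ∘ₗ AlgTensor.mulMap m n).mkContinuous (‖m‖ * ‖n‖) fun x =>
    (CTensor.of.norm_map _).trans_le (AlgTensor.norm_mulMap_le m n x)).extend
    (CTensor.of (A := A) (B := B)).toContinuousLinearMap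

theorem CTensor.mulMapL_of (m : Mult A) (n : Mult B) (x : AlgTensor A B) :
    CTensor.mulMapL m n (CTensor.of x) = CTensor.of (AlgTensor.mulMap m n x) := by
  have h := ContinuousLinearMap.extend_eq
    ((CTensor.of.toLinearMap ∘ₗ AlgTensor.mulMap m n).mkContinuous (‖m‖ * ‖n‖) fun x =>
      (CTensor.of.norm_map _).trans_le (AlgTensor.norm_mulMap_le m n x))
    (e := (CTensor.of (A := A) (B := B)).toContinuousLinearMap) CTensor.denseRange_of
    CTensor.of.isometry.isUniformInducing x
  exact h

theorem CTensor.star_mulMapL_mul (m : Mult A) (n : Mult B) (x y : CTensor A B) :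
    star (CTensor.mulMapL m n x) * y = star x * CTensor.mulMapL (star m) (star n) y := by
  induction x using CTensor.induction with
  | hP => exact isClosed_eq (by fun_prop) (by fun_prop)
  | h x =>
  induction y using CTensor.induction with
  | hP => exact isClosed_eq (by fun_prop) (by fun_prop)
  | h y =>
    rw [CTensor.mulMapL_of, CTensor.mulMapL_of, ← CTensor.of_star, ← CTensor.of_star,
      ← CTensor.of_mul, ← CTensor.of_mul, AlgTensor.star_mulMap_mul]

/-- The multiplier `m ⊗ n` of `A ⊗ B`. -/
def multTmul (m : Mult A) (n : Mult B) : Mult (CTensor A B) where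
  fst := CTensor.mulMapL m n
  snd := (((starₗᵢ ℂ : CTensor A B ≃ₗᵢ⋆[ℂ] CTensor A B) : CTensor A B →L⋆[ℂ] CTensor A B).comp
    (CTensor.mulMapL (star m) (star n))).comp
    ((starₗᵢ ℂ : CTensor A B ≃ₗᵢ⋆[ℂ] CTensor A B) : CTensor A B →L⋆[ℂ] CTensor A B)
  central x y := by
    have h := CTensor.star_mulMapL_mul (star m) (star n) (star x) y
    rwa [star_star, star_star, star_star] at h

theorem multTmul_fst_tmul (m : Mult A) (n : Mult B) (a : A) (b : B) :
    (multTmul m n).fst (CTensor.tmul a b) = CTensor.tmul (m.fst a) (n.fst b) :=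
  CTensor.mulMapL_of m n _

theorem multTmul_fst_of (m : Mult A) (n : Mult B) (x : AlgTensor A B) :
    (multTmul m n).fst (CTensor.of x) = CTensor.of (AlgTensor.mulMap m n x) :=
  CTensor.mulMapL_of m n _

theorem CTensor.clm_ext {E : Type*} [NormedAddCommGroup E] [NormedSpace ℂ E]
    {f g : CTensor A B →L[ℂ] E} (h : ∀ a b, f (CTensor.tmul a b) = g (CTensor.tmul a b)) :
    f = g := by
  ext x
  induction x using CTensor.induction with
  | hP => exact isClosed_eq (by fun_prop) (by fun_prop)
  | h x =>
    exact congrArg (fun k : AlgTensor A B →ₗ[ℂ] E => k x) (AlgTensor.linearMap_ext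
      (f := f.toLinearMap ∘ₗ CTensor.of.toLinearMap) (g := g.toLinearMap ∘ₗ CTensor.of.toLinearMap)
      h)

theorem mult_tensor_ext {m n : Mult (CTensor A B)}
    (h : ∀ a b, m.fst (CTensor.tmul a b) = n.fst (CTensor.tmul a b)) : m = n :=
  mult_ext fun x => congrArg (fun f : CTensor A B →L[ℂ] CTensor A B => f x) (CTensor.clm_ext h)

theorem multTmul_mul (m m' : Mult A) (n n' : Mult B) :
    multTmul m n * multTmul m' n' = multTmul (m * m') (n * n') :=
  mult_tensor_ext fun a b => by
    rw [DoubleCentralizer.mul_fst, mul_apply_eq_comp, multTmul_fst_tmul, multTmul_fst_tmul,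
      multTmul_fst_tmul]
    rfl

theorem multTmul_one : multTmul (1 : Mult A) (1 : Mult B) = 1 :=
  mult_tensor_ext fun _ _ => multTmul_fst_tmul _ _ _ _

theorem star_multTmul (m : Mult A) (n : Mult B) :
    star (multTmul m n) = multTmul (star m) (star n) :=
  mult_ext fun x => by
    rw [DoubleCentralizer.star_fst]
    change star (star (CTensor.mulMapL (star m) (star n) (star (star x)))) = _
    rw [star_star, star_star]
    rfl

theorem norm_multTmul_le (m : Mult A) (n : Mult B) : ‖multTmul m n‖ ≤ ‖m‖ * ‖n‖ := by
  rw [← DoubleCentralizer.norm_fst]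
  refine ContinuousLinearMap.opNorm_le_bound _ (by positivity) fun x => ?_
  induction x using CTensor.induction with
  | hP => exact isClosed_le (by fun_prop) (by fun_prop)
  | h x =>
    rw [multTmul_fst_of, CTensor.of.norm_map, CTensor.of.norm_map]
    exact AlgTensor.norm_mulMap_le m n x

theorem CTensor.tmul_add (a : A) (b b' : B) :
    CTensor.tmul a (b + b') = CTensor.tmul a b + CTensor.tmul a b' := by
  simp only [CTensor.tmul, AlgTensor.tmul_add, map_add]

theorem CTensor.add_tmul (a a' : A) (b : B) :
    CTensor.tmul (a + a') b = CTensor.tmul a b + CTensor.tmul a' b := by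
  simp only [CTensor.tmul, AlgTensor.add_tmul, map_add]

theorem CTensor.smul_tmul (c : ℂ) (a : A) (b : B) :
    CTensor.tmul (c • a) b = c • CTensor.tmul a b := by
  simp only [CTensor.tmul, AlgTensor.smul_tmul, map_smul]

theorem CTensor.tmul_smul (c : ℂ) (a : A) (b : B) :
    CTensor.tmul a (c • b) = c • CTensor.tmul a b := by
  simp only [CTensor.tmul, AlgTensor.tmul_smul, map_smul]

theorem multTmul_add (m : Mult A) (n n' : Mult B) :
    multTmul m (n + n') = multTmul m n + multTmul m n' :=
  mult_tensor_ext fun a b => by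
    rw [DoubleCentralizer.add_fst, add_apply, multTmul_fst_tmul,
      multTmul_fst_tmul, multTmul_fst_tmul, ← CTensor.tmul_add]
    rfl

theorem multTmul_zero_left (n : Mult B) : multTmul (0 : Mult A) n = 0 := by
  rw [← norm_le_zero_iff]
  simpa using norm_multTmul_le (0 : Mult A) n

theorem multTmul_zero_right (m : Mult A) : multTmul m (0 : Mult B) = 0 := by
  rw [← norm_le_zero_iff]
  simpa using norm_multTmul_le m (0 : Mult B)

theorem CTensor.norm_tmul_le (a : A) (b : B) : ‖CTensor.tmul a b‖ ≤ ‖a‖ * ‖b‖ := by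
  rw [CTensor.tmul, CTensor.of.norm_map]
  exact maxNorm_tmul_le a b

end TensorMultiplier

end

/-! ### The action of `B(ℓ²)` on `A ⊗ 𝒦` -/

section

attribute [local instance] CStarAlgebra.spectralOrder CStarAlgebra.spectralOrderedRing

section StrongConvergence

variable {E F : Type*} [NormedAddCommGroup E] [NormedSpace ℂ E] [NormedAddCommGroup F]
  [NormedSpace ℂ F]

theorem tendsto_zero_of_dense {T : ℕ → E →L[ℂ] F} {C : ℝ} (hC : ∀ n, ‖T n‖ ≤ C) {S : Set E}
    (hS : Dense S) (h : ∀ x ∈ S, Tendsto (fun n => T n x) atTop (𝓝 0)) (x : E) :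
    Tendsto (fun n => T n x) atTop (𝓝 0) := by
  have hC0 : 0 ≤ C := (norm_nonneg _).trans (hC 0)
  rw [NormedAddGroup.tendsto_nhds_zero]
  intro ε hε
  obtain ⟨y, hy, hxy⟩ := Metric.dense_iff.1 hS x (ε / 2 / (C + 1)) (by positivity)
  filter_upwards [NormedAddGroup.tendsto_nhds_zero.1 (h y hxy) (ε / 2) (half_pos hε)] with n hn
  rw [Metric.mem_ball, dist_comm, dist_eq_norm, lt_div_iff₀ (by positivity)] at hy
  have h1 : ‖T n (x - y)‖ ≤ C * ‖x - y‖ := (T n).le_of_opNorm_le (hC n) _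
  have h2 := norm_add_le (T n (x - y)) (T n y)
  rw [← map_add, sub_add_cancel] at h2
  nlinarith [norm_nonneg (x - y)]

/-- A bounded, strongly null sequence is uniformly null on compact sets. -/
theorem eventually_forall_norm_lt_of_isCompact {T : ℕ → E →L[ℂ] F} {C : ℝ} (hC : ∀ n, ‖T n‖ ≤ C)
    (h : ∀ x, Tendsto (fun n => T n x) atTop (𝓝 0)) {Q : Set E} (hQ : IsCompact Q) {ε : ℝ}
    (hε : 0 < ε) : ∀ᶠ n in atTop, ∀ x ∈ Q, ‖T n x‖ < ε := by
  have hC0 : 0 ≤ C := (norm_nonneg _).trans (hC 0)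
  obtain ⟨t, -, htf, ht⟩ := Metric.finite_approx_of_totallyBounded hQ.totallyBounded
    (ε / 2 / (C + 1)) (by positivity)
  filter_upwards [htf.eventually_all.2 fun y _ =>
    NormedAddGroup.tendsto_nhds_zero.1 (h y) (ε / 2) (half_pos hε)] with n hn x hx
  obtain ⟨y, hy, hxy⟩ := Set.mem_iUnion₂.1 (ht hx)
  rw [Metric.mem_ball, dist_eq_norm, lt_div_iff₀ (by positivity)] at hxy
  have h1 : ‖T n (x - y)‖ ≤ C * ‖x - y‖ := (T n).le_of_opNorm_le (hC n) _
  have h2 := norm_add_le (T n (x - y)) (T n y)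
  rw [← map_add, sub_add_cancel] at h2
  nlinarith [norm_nonneg (x - y), hn y hy]

theorem tendsto_norm_comp_compact {T : ℕ → Ell2 →L[ℂ] Ell2} {C : ℝ} (hC : ∀ n, ‖T n‖ ≤ C)
    (h : ∀ x, Tendsto (fun n => T n x) atTop (𝓝 0)) (k : K) :
    Tendsto (fun n => ‖T n * k.1‖) atTop (𝓝 0) := by
  have hk : IsCompact (closure (k.1 '' Metric.closedBall 0 1)) :=
    IsCompactOperator.isCompact_closure_image_closedBall (f := k.1.toLinearMap) k.2 1
  rw [Metric.tendsto_atTop']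
  intro ε hε
  obtain ⟨N, hN⟩ := eventually_atTop.1
    (eventually_forall_norm_lt_of_isCompact hC h hk (half_pos hε))
  refine ⟨N, fun n hn => ?_⟩
  rw [Real.dist_0_eq_abs, abs_norm]
  refine lt_of_le_of_lt (ContinuousLinearMap.opNorm_le_of_unit_norm (half_pos hε).le
    fun x hx => ?_) (half_lt_self hε)
  exact (hN n hn.le (k.1 x) (subset_closure ⟨x, by simp [hx], rfl⟩)).le

end StrongConvergence

section CompactMultiplier

/-- A bounded operator, as a multiplier of `𝒦`. -/
def opMult (T : Ell2 →L[ℂ] Ell2) : Mult K where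
  fst := LinearMap.mkContinuous
    { toFun := fun k => (⟨T * k.1, k.2.clm_comp T⟩ : K)
      map_add' := fun k l => Subtype.ext (mul_add T k.1 l.1)
      map_smul' := fun c k => Subtype.ext (mul_smul_comm c T k.1) } ‖T‖
    fun k => norm_mul_le T k.1
  snd := LinearMap.mkContinuous
    { toFun := fun k => (⟨k.1 * T, k.2.comp_clm T⟩ : K)
      map_add' := fun k l => Subtype.ext (add_mul k.1 l.1 T)
      map_smul' := fun c k => Subtype.ext (smul_mul_assoc c k.1 T) } ‖T‖
    fun k => (norm_mul_le k.1 T).trans_eq (mul_comm _ _)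
  central k l := Subtype.ext (mul_assoc k.1 T l.1)

theorem opMult_mul (S T : Ell2 →L[ℂ] Ell2) : opMult S * opMult T = opMult (S * T) :=
  mult_ext fun k => Subtype.ext (mul_assoc S T k.1).symm

theorem opMult_one : opMult 1 = 1 := mult_ext fun k => Subtype.ext (one_mul k.1)

theorem opMult_zero : opMult 0 = 0 := mult_ext fun k => Subtype.ext (zero_mul k.1)

theorem opMult_add (S T : Ell2 →L[ℂ] Ell2) : opMult (S + T) = opMult S + opMult T :=
  mult_ext fun k => Subtype.ext (add_mul S T k.1)

theorem star_opMult (T : Ell2 →L[ℂ] Ell2) : star (opMult T) = opMult (star T) :=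
  mult_ext fun k => Subtype.ext (by
    rw [DoubleCentralizer.star_fst]
    change star (star k.1 * T) = star T * k.1
    rw [star_mul, star_star])

theorem norm_opMult_le (T : Ell2 →L[ℂ] Ell2) : ‖opMult T‖ ≤ ‖T‖ := by
  rw [← DoubleCentralizer.norm_fst]
  exact ContinuousLinearMap.opNorm_le_bound _ (norm_nonneg _) fun k => norm_mul_le T k.1

variable {A : Type u} [NonUnitalCStarAlgebra A]

variable (A) in
/-- The multiplier `1 ⊗ T` of `A ⊗ 𝒦`. -/
def opTensor (T : Ell2 →L[ℂ] Ell2) : Mult (CTensor A K) := multTmul 1 (opMult T)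

theorem opTensor_mul (S T : Ell2 →L[ℂ] Ell2) :
    opTensor A S * opTensor A T = opTensor A (S * T) := by
  rw [opTensor, opTensor, multTmul_mul, opMult_mul, one_mul, opTensor]

theorem opTensor_one : opTensor A 1 = 1 := by rw [opTensor, opMult_one, multTmul_one]

theorem opTensor_zero : opTensor A 0 = 0 := by rw [opTensor, opMult_zero, multTmul_zero_right]

theorem opTensor_add (S T : Ell2 →L[ℂ] Ell2) :
    opTensor A (S + T) = opTensor A S + opTensor A T := by
  rw [opTensor, opMult_add, multTmul_add]; rfl

theorem star_opTensor (T : Ell2 →L[ℂ] Ell2) : star (opTensor A T) = opTensor A (star T) := by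
  rw [opTensor, star_multTmul, star_one, star_opMult, opTensor]

theorem opTensor_pow (T : Ell2 →L[ℂ] Ell2) (n : ℕ) :
    opTensor A T ^ n = opTensor A (T ^ n) := by
  induction n with
  | zero => rw [pow_zero, pow_zero, opTensor_one]
  | succ n ih => rw [pow_succ, pow_succ, ih, opTensor_mul]

theorem norm_opTensor_le (T : Ell2 →L[ℂ] Ell2) : ‖opTensor A T‖ ≤ ‖T‖ := by
  refine (norm_multTmul_le _ _).trans ?_
  have h1 : ‖(1 : Mult A)‖ ≤ 1 := by
    rw [← DoubleCentralizer.norm_fst]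
    exact ContinuousLinearMap.norm_id_le
  calc ‖(1 : Mult A)‖ * ‖opMult T‖ ≤ 1 * ‖T‖ :=
        mul_le_mul h1 (norm_opMult_le T) (norm_nonneg _) zero_le_one
    _ = ‖T‖ := one_mul _

theorem opTensor_fst_tmul (T : Ell2 →L[ℂ] Ell2) (a : A) (k : K) :
    (opTensor A T).fst (CTensor.tmul a k) = CTensor.tmul a ((opMult T).fst k) :=
  multTmul_fst_tmul _ _ _ _

/-- If `T n` is bounded and strongly null, then `1 ⊗ T n` is strictly null on `A ⊗ 𝒦`, since
`‖T n k‖ → 0` for compact `k`. -/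
theorem tendsto_opTensor_fst {T : ℕ → Ell2 →L[ℂ] Ell2} {C : ℝ} (hC : ∀ n, ‖T n‖ ≤ C)
    (h : ∀ x, Tendsto (fun n => T n x) atTop (𝓝 0)) (x : CTensor A K) :
    Tendsto (fun n => (opTensor A (T n)).fst x) atTop (𝓝 0) := by
  refine tendsto_zero_of_dense (C := C) (fun n => ?_) CTensor.denseRange_of ?_ x
  · rw [DoubleCentralizer.norm_fst]
    exact (norm_opTensor_le _).trans (hC n)
  · rintro _ ⟨y, rfl⟩
    induction y using AlgTensor.induction with
    | h0 => simp
    | ha y z hy hz => simpa using hy.add hz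
    | ht a k =>
      rw [tendsto_zero_iff_norm_tendsto_zero]
      refine squeeze_zero (fun _ => norm_nonneg _) (fun n => ?_)
        (by simpa using (tendsto_norm_comp_compact hC h k).const_mul ‖a‖)
      change ‖(opTensor A (T n)).fst (CTensor.tmul a k)‖ ≤ _
      rw [opTensor_fst_tmul]
      exact CTensor.norm_tmul_le _ _

theorem tendsto_opTensor_mul {T : ℕ → Ell2 →L[ℂ] Ell2} {C : ℝ} (hC : ∀ n, ‖T n‖ ≤ C)
    (h : ∀ x, Tendsto (fun n => T n x) atTop (𝓝 0)) (x : CTensor A K) :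
    Tendsto (fun n => opTensor A (T n) * toMult _ x) atTop (𝓝 0) := by
  have h2 := (continuous_toMult (D := CTensor A K)).tendsto 0 |>.comp (tendsto_opTensor_fst hC h x)
  rw [map_zero] at h2
  refine h2.congr fun n => ?_
  rw [mul_toMult]
  rfl

end CompactMultiplier

section Frame

/-- Two isometries `W 0`, `W 1` with orthogonal ranges in the multiplier algebra of `D` such that
`(W 1 *)^k → 0` strictly. For `D = A ⊗ 𝒦` these conditions are all that is needed to form sums and
suprema of Cuntz classes. -/
structure IsFrame {D : Type u} [NonUnitalCStarAlgebra D] (W : Fin 2 → Mult D) : Prop where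
  star_mul_self : ∀ i, star (W i) * W i = 1
  star_zero_mul_one : star (W 0) * W 1 = 0
  tendsto_zero : ∀ x : D, Tendsto (fun k => star (W 1 ^ k) * toMult D x) atTop (𝓝 0)

theorem dense_of_ket_mem {S : Submodule ℂ Ell2} (hS : ∀ n, ket n ∈ S) :
    Dense (S : Set Ell2) := fun x => by
  have h := lp.hasSum_single (p := 2) (by simp) x
  refine mem_closure_of_tendsto h (.of_forall fun s => ?_)
  refine S.sum_mem fun i _ => ?_
  have : lp.single 2 i (x i) = x i • ket i := by
    rw [ket, ← lp.single_smul, smul_eq_mul, mul_one]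
  rw [this]
  exact S.smul_mem _ (hS i)

theorem tendsto_zero_of_ket {T : ℕ → Ell2 →L[ℂ] Ell2} {C : ℝ} (hC : ∀ n, ‖T n‖ ≤ C)
    (h : ∀ i, Tendsto (fun n => T n (ket i)) atTop (𝓝 0)) (x : Ell2) :
    Tendsto (fun n => T n x) atTop (𝓝 0) := by
  let S : Submodule ℂ Ell2 :=
    { carrier := {x | Tendsto (fun n => T n x) atTop (𝓝 0)}
      add_mem' := fun hx hy => by simpa using hx.add hy
      zero_mem' := by simp
      smul_mem' := fun c x hx => by simpa using hx.const_smul c }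
  exact tendsto_zero_of_dense hC (dense_of_ket_mem (S := S) h) (fun y hy => hy) x

theorem ket_ext {x y : Ell2} (h : ∀ n, inner ℂ (ket n) x = inner ℂ (ket n) y) : x = y := by
  refine lp.ext (funext fun n => ?_)
  simpa [ket, lp.inner_single_left] using h n

theorem inner_ket_ket (m n : ℕ) : inner ℂ (ket m) (ket n) = if m = n then (1 : ℂ) else 0 := by
  have h := orthonormal_iff_ite.1 (orthonormal_ket_comp (f := id) Function.injective_id) m n
  exact h

theorem inner_ket_star_isomL_one (i : ℕ) (x : Ell2) :
    inner ℂ (ket i) ((star (isomL 1) : Ell2 →L[ℂ] Ell2) x) = inner ℂ (ket (2 * i + 1)) x := by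
  rw [ContinuousLinearMap.star_eq_adjoint, ContinuousLinearMap.adjoint_inner_right]
  congr 1
  exact isom_ket 1 i

/-- The powers of the adjoint shift coordinates: the `i`-th coordinate of `(isomL 1 ^ k)* x` is the
`j`-th coordinate of `x` for some `j ≥ k + i`. -/
theorem inner_ket_star_isomL_one_pow (k i : ℕ) (x : Ell2) :
    ∃ j ≥ k + i,
      inner ℂ (ket i) ((star (isomL 1 ^ k) : Ell2 →L[ℂ] Ell2) x) = inner ℂ (ket j) x := by
  induction k generalizing i with
  | zero => exact ⟨i, by omega, by simp⟩
  | succ k ih =>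
    obtain ⟨j, hj, h⟩ := ih (2 * i + 1)
    refine ⟨j, by omega, ?_⟩
    rw [← h, ← inner_ket_star_isomL_one, pow_succ, star_mul, mul_apply_eq_comp]

theorem norm_isomL_pow_apply (i : Fin 2) (k : ℕ) (x : Ell2) : ‖(isomL i ^ k) x‖ = ‖x‖ := by
  induction k generalizing x with
  | zero => simp
  | succ k ih =>
    rw [pow_succ, mul_apply_eq_comp, ih]
    exact (isom i).norm_map x

theorem norm_star_isomL_pow_le (i : Fin 2) (k : ℕ) :
    ‖(star (isomL i ^ k) : Ell2 →L[ℂ] Ell2)‖ ≤ 1 :=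
  (norm_star (isomL i ^ k)).trans_le <| ContinuousLinearMap.opNorm_le_bound _ zero_le_one
    fun x => by rw [norm_isomL_pow_apply, one_mul]

theorem tendsto_star_isomL_one_pow (x : Ell2) :
    Tendsto (fun k => (star (isomL 1 ^ k) : Ell2 →L[ℂ] Ell2) x) atTop (𝓝 0) := by
  refine tendsto_zero_of_ket (norm_star_isomL_pow_le 1) (fun j => ?_) x
  refine tendsto_const_nhds.congr' ?_
  filter_upwards [eventually_gt_atTop j] with k hk
  refine ket_ext fun i => ?_
  obtain ⟨l, hl, h⟩ := inner_ket_star_isomL_one_pow k i (ket j)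
  rw [h, inner_ket_ket, if_neg (by omega), inner_zero_right]

theorem isFrame_opTensor (A : Type u) [NonUnitalCStarAlgebra A] :
    IsFrame fun i => opTensor A (isomL i) where
  star_mul_self i := by
    rw [star_opTensor, opTensor_mul, star_isomL_mul_self, opTensor_one]
  star_zero_mul_one := by
    rw [star_opTensor, opTensor_mul, star_isomL_zero_mul_one, opTensor_zero]
  tendsto_zero x := by
    simp only [opTensor_pow, star_opTensor]
    exact tendsto_opTensor_mul (norm_star_isomL_pow_le 1) tendsto_star_isomL_one_pow x

end Frame

end

/-! ### The Cuntz semigroup is an object of `Cu` -/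

section

attribute [local instance] CStarAlgebra.spectralOrder CStarAlgebra.spectralOrderedRing

section CutPos

variable {D : Type u} [NonUnitalCStarAlgebra D]

/-- `(x - ε)₊` as an element of the positive cone. -/
def PosCone.cut (ε : ℝ) (x : PosCone D) : PosCone D :=
  .ofNonneg (CuTensor.cut ε x.1) (cut_nonneg _ _)

theorem CuntzLE.cut_self {ε : ℝ} (hε : 0 ≤ ε) (x : PosCone D) :
    CuntzLE (x.cut ε).1 x.1 := by
  refine .of_le (cut_nonneg _ _) ?_
  calc CuTensor.cut ε x.1 ≤ CuTensor.cut 0 x.1 := cut_mono le_rfl hε x.nonneg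
    _ = x.1 := cut_zero x.nonneg

theorem PosCone.cut_mono {ε ε' : ℝ} (hε : 0 ≤ ε') (h : ε' ≤ ε) (x : PosCone D) :
    CuntzLE (x.cut ε).1 (x.cut ε').1 :=
  .of_le (cut_nonneg _ _) (CuTensor.cut_mono hε h x.nonneg)

theorem PosCone.tendsto_cut (x : PosCone D) :
    Tendsto (fun n : ℕ => (x.cut (1 / ((n : ℝ) + 1))).1) atTop (𝓝 x.1) := by
  refine tendsto_iff_norm_sub_tendsto_zero.2 ?_
  exact squeeze_zero (fun _ => norm_nonneg _) (fun n => norm_cut_sub_le (by positivity) x.nonneg)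
    tendsto_one_div_add_atTop_nhds_zero_nat

theorem PosCone.exists_unit_cut {ε ε' : ℝ} (hε' : 0 ≤ ε') (h : ε' < ε) (x : PosCone D) :
    ∃ k : PosCone D, k.1 * (x.cut ε).1 = (x.cut ε).1 ∧ CuntzLE k.1 (x.cut ε').1 := by
  obtain ⟨k, hk0, hk, hkx⟩ := CuTensor.exists_unit_cut hε' h x.nonneg
  exact ⟨.ofNonneg k hk0, hk, hkx⟩

theorem PosCone.exists_unit_cut_self {ε : ℝ} (hε : 0 < ε) (x : PosCone D) :
    ∃ k : PosCone D, k.1 * (x.cut ε).1 = (x.cut ε).1 ∧ CuntzLE k.1 x.1 := by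
  obtain ⟨k, hk, hkx⟩ := x.exists_unit_cut le_rfl hε
  exact ⟨k, hk, hkx.trans (.cut_self le_rfl x)⟩

end CutPos

section CuSemigroup

variable {A : Type u} [NonUnitalCStarAlgebra A]

theorem Cu.exists_rep (s : Cu A) : ∃ x, Cu.mk x = s := Quotient.exists_rep s

theorem conjStab_tmul (i : Fin 2) (a : A) (k : K) :
    conjStab i (CTensor.tmul a k) = CTensor.tmul a (conjIsom i k) := by
  rw [conjStab, CTensor.tmul, CTensor.mapRight_of, AlgTensor.mapRight_tmul, CTensor.tmul]

theorem conjStab_eq (i : Fin 2) (x : CTensor A K) :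
    conjStab i x =
      (opTensor A (isomL i)).fst (star ((opTensor A (isomL i)).fst (star x))) := by
  have hc : Continuous fun x : CTensor A K => conjStab i x :=
    CTensor.continuous_mapRight (A := A) (conjIsom i)
  induction x using CTensor.induction with
  | hP =>
    exact isClosed_eq hc ((ContinuousLinearMap.continuous _).comp
      ((ContinuousLinearMap.continuous _).comp continuous_star).star)
  | h x =>
    induction x using AlgTensor.induction with
    | h0 => simp only [map_zero, star_zero]
    | ha x y hx hy => simp only [map_add, star_add, hx, hy]
    | ht a k =>
      rw [show CTensor.of (AlgTensor.tmul a k) = CTensor.tmul a k from rfl, conjStab_tmul,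
        CTensor.star_tmul, opTensor_fst_tmul, CTensor.star_tmul, star_star, opTensor_fst_tmul]
      refine congrArg (CTensor.tmul a) (Subtype.ext ?_)
      change isomL i * k.1 * star (isomL i) = isomL i * star (isomL i * star k.1)
      rw [star_mul, star_star, mul_assoc]

theorem toMult_conjStab (i : Fin 2) (x : CTensor A K) :
    toMult _ (conjStab i x) =
      opTensor A (isomL i) * toMult _ x * star (opTensor A (isomL i)) := by
  rw [mul_assoc, toMult_mul, star_star, mul_toMult, conjStab_eq]

theorem CuntzLE.conjStab (i : Fin 2) (x : CTensor A K) : CuntzLE (conjStab i x) x :=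
  .of_mult _ (toMult_conjStab i x)

/-- An isometry `V` of the multiplier algebra gives `a ≾ V a V*`. -/
theorem CuntzLE.of_isometry {D : Type u} [NonUnitalCStarAlgebra D] {a b : D} {V : Mult D}
    (hV : star V * V = 1) (h : toMult D b = V * toMult D a * star V) : CuntzLE a b := by
  refine .of_mult (star V) ?_
  rw [h, star_star, show star V * (V * toMult D a * star V) * V =
    (star V * V) * toMult D a * (star V * V) by simp only [mul_assoc], hV, one_mul, mul_one]

theorem CuntzLE.conjStab' (i : Fin 2) (x : CTensor A K) : CuntzLE x (CuTensor.conjStab i x) :=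
  .of_isometry ((isFrame_opTensor A).star_mul_self i) (toMult_conjStab i x)

theorem conjStab_nonneg (i : Fin 2) {x : CTensor A K} (hx : 0 ≤ x) : 0 ≤ conjStab i x :=
  map_nonneg (conjStab i) hx

/-- `x ≾ x'` and `y ≾ y'` imply `diag (x, y) ≾ x' + y'` for orthogonal `x'`, `y'`. -/
theorem CuntzLE.diagSum_add {x y x' y' : CTensor A K} (hx' : 0 ≤ x') (hy' : 0 ≤ y')
    (hx : CuntzLE x x') (hy : CuntzLE y y') (h : x' * y' = 0) :
    CuntzLE (CuTensor.diagSum x y) (x' + y') :=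
  .add_of_mul_eq_zero hx' hy' ((CuntzLE.conjStab 0 x).trans hx) ((CuntzLE.conjStab 1 y).trans hy) h

theorem CuntzLE.add_diagSum {x y x' y' : CTensor A K} (hx' : 0 ≤ x') (hy' : 0 ≤ y')
    (hx : CuntzLE x x') (hy : CuntzLE y y') : CuntzLE (x + y) (CuTensor.diagSum x' y') :=
  .add_of_mul_eq_zero (conjStab_nonneg 0 hx') (conjStab_nonneg 1 hy')
    (hx.trans (CuntzLE.conjStab' 0 x')) (hy.trans (CuntzLE.conjStab' 1 y'))
    (conjStab_zero_mul_one _ _)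

/-- The class of a sum of orthogonal positive elements is the sum of their classes. -/
theorem Cu.mk_add_mk_of_mul_eq_zero {x y z : PosCone (CTensor A K)} (h : x.1 * y.1 = 0)
    (hz : z.1 = x.1 + y.1) : Cu.mk x + Cu.mk y = Cu.mk z := by
  refine le_antisymm (Cu.mk_le_mk.2 ?_) (Cu.mk_le_mk.2 ?_)
  · rw [hz]
    exact .diagSum_add x.nonneg y.nonneg (.refl _) (.refl _) h
  · rw [hz]
    exact .add_diagSum x.nonneg y.nonneg (.refl _) (.refl _)

theorem Cu.add_comm' (s t : Cu A) : s + t = t + s := by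
  obtain ⟨x, rfl⟩ := s.exists_rep
  obtain ⟨y, rfl⟩ := t.exists_rep
  have h : ∀ x y : PosCone (CTensor A K), Cu.mk x + Cu.mk y ≤ Cu.mk y + Cu.mk x := fun x y => by
    refine Cu.mk_le_mk.2 ?_
    change CuntzLE (CuTensor.diagSum x.1 y.1) (conjStab 0 y.1 + conjStab 1 x.1)
    rw [add_comm]
    exact .diagSum_add (conjStab_nonneg 1 x.nonneg) (conjStab_nonneg 0 y.nonneg)
      (.conjStab' 1 _) (.conjStab' 0 _) (conjStab_one_mul_zero _ _)
  exact le_antisymm (h x y) (h y x)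

theorem Cu.add_le_add' {s s' t t' : Cu A} (hs : s ≤ s') (ht : t ≤ t') : s + t ≤ s' + t' := by
  obtain ⟨x, rfl⟩ := s.exists_rep
  obtain ⟨y, rfl⟩ := t.exists_rep
  obtain ⟨x', rfl⟩ := s'.exists_rep
  obtain ⟨y', rfl⟩ := t'.exists_rep
  exact Cu.mk_le_mk.2 (CuntzLE.diagSum (Cu.mk_le_mk.1 hs) (Cu.mk_le_mk.1 ht))

theorem Cu.add_assoc' (r s t : Cu A) : r + s + t = r + (s + t) := by
  have h : ∀ r s t : Cu A, r + s + t ≤ r + (s + t) := fun r s t => by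
    obtain ⟨x, rfl⟩ := r.exists_rep
    obtain ⟨y, rfl⟩ := s.exists_rep
    obtain ⟨z, rfl⟩ := t.exists_rep
    refine Cu.mk_le_mk.2 ?_
    change CuntzLE (CuTensor.diagSum (CuTensor.diagSum x.1 y.1) z.1)
      (conjStab 0 x.1 + conjStab 1 (conjStab 0 y.1 + conjStab 1 z.1))
    rw [map_add, ← add_assoc]
    have hx := conjStab_nonneg 0 x.nonneg
    have hy := conjStab_nonneg 1 (conjStab_nonneg 0 y.nonneg)
    have hz := conjStab_nonneg 1 (conjStab_nonneg 1 z.nonneg)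
    refine .diagSum_add (add_nonneg hx hy) hz
      (.diagSum_add hx hy (.conjStab' 0 _) ((CuntzLE.conjStab' 0 _).trans (.conjStab' 1 _))
        (conjStab_zero_mul_one _ _))
      ((CuntzLE.conjStab' 1 _).trans (.conjStab' 1 _)) ?_
    rw [add_mul, conjStab_zero_mul_one, ← map_mul, conjStab_zero_mul_one, map_zero, add_zero]
  refine le_antisymm (h r s t) ?_
  calc r + (s + t) = t + s + r := by rw [Cu.add_comm' r, Cu.add_comm' s]
    _ ≤ t + (s + r) := h t s r
    _ = r + s + t := by rw [Cu.add_comm' t, Cu.add_comm' s]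

theorem Cu.zero_le' (s : Cu A) : 0 ≤ s := by
  obtain ⟨x, rfl⟩ := s.exists_rep
  exact Cu.mk_le_mk.2 (.zero_left _)

theorem Cu.zero_add' (s : Cu A) : 0 + s = s := by
  obtain ⟨x, rfl⟩ := s.exists_rep
  exact Cu.mk_add_mk_of_mul_eq_zero (zero_mul _) (zero_add _).symm

/-- An increasing sequence in `Cu A` has a supremum, which is represented by a limit of elements
`≾`-below members of the sequence. -/
theorem Cu.exists_sup' (z : ℕ → PosCone (CTensor A K)) (hz : Monotone fun n => Cu.mk (z n)) :
    ∃ w : PosCone (CTensor A K), IsLUB (Set.range fun n => Cu.mk (z n)) (Cu.mk w) ∧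
      w.1 ∈ closure {x | ∃ m, CuntzLE x (z m).1} := by
  have hf := isFrame_opTensor A
  obtain ⟨w, hw0, hzw, hw⟩ := exists_cuntz_sup (hf.star_mul_self 1) hf.tendsto_zero
    (fun n => (z n).nonneg) (fun n => Cu.mk_le_mk.1 (hz (Nat.le_succ n)))
  refine ⟨.ofNonneg w hw0, ⟨?_, fun u hu => ?_⟩, hw⟩
  · rintro _ ⟨n, rfl⟩
    exact Cu.mk_le_mk.2 (hzw n)
  · obtain ⟨u, rfl⟩ := u.exists_rep
    refine Cu.mk_le_mk.2 (.of_mem_closure hw ?_)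
    rintro x ⟨m, hm⟩
    exact hm.trans (Cu.mk_le_mk.1 (hu ⟨m, rfl⟩))

/-- If `a` has a unit `k ≾ b`, then `[a] ≪ [b]`: the supremum of a sequence that dominates `[b]` is
a limit of elements `≾`-below its members, and `k ≾ w` for such a limit `w` gives `a ≾ z m`. -/
theorem Cu.wayBelow_of_unit {a b k : PosCone (CTensor A K)} (hka : k.1 * a.1 = a.1)
    (hkb : CuntzLE k.1 b.1) : WayBelow (Cu.mk a) (Cu.mk b) := by
  intro z hz u hu hbu
  choose ζ hζ using fun n => (z n).exists_rep
  obtain rfl : (fun n => Cu.mk (ζ n)) = z := funext hζ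
  obtain ⟨w, hw, hwc⟩ := Cu.exists_sup' ζ hz
  have h1 : CuntzLE k.1 w.1 := hkb.trans (Cu.mk_le_mk.1 (hbu.trans (hu.2 hw.1)))
  obtain ⟨m, hm⟩ := CuntzLE.exists_of_unit (fun n => (ζ n).nonneg) a.nonneg
    (IsSelfAdjoint.of_nonneg k.nonneg) hka h1 hwc
  exact ⟨m, Cu.mk_le_mk.2 hm⟩

/-- `[(x - ε)₊] ≪ [x]` for `ε > 0`. -/
theorem Cu.wayBelow_cut {ε : ℝ} (hε : 0 < ε) (x : PosCone (CTensor A K)) :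
    WayBelow (Cu.mk (x.cut ε)) (Cu.mk x) := by
  obtain ⟨k, hk, hkx⟩ := x.exists_unit_cut_self hε
  exact Cu.wayBelow_of_unit hk hkx

theorem Cu.isLUB_cut (x : PosCone (CTensor A K)) :
    IsLUB (Set.range fun n : ℕ => Cu.mk (x.cut (1 / ((n : ℝ) + 1)))) (Cu.mk x) := by
  refine ⟨?_, fun u hu => ?_⟩
  · rintro _ ⟨n, rfl⟩
    exact Cu.mk_le_mk.2 (.cut_self (by positivity) x)
  · obtain ⟨u, rfl⟩ := u.exists_rep
    exact Cu.mk_le_mk.2 (.of_tendsto x.tendsto_cut fun n => Cu.mk_le_mk.1 (hu ⟨n, rfl⟩))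

theorem Cu.monotone_cut (x : PosCone (CTensor A K)) :
    Monotone fun n : ℕ => Cu.mk (x.cut (1 / ((n : ℝ) + 1))) := fun m n h =>
  Cu.mk_le_mk.2 (x.cut_mono (by positivity) (one_div_le_one_div_of_le (by positivity)
    (by exact_mod_cast Nat.succ_le_succ h)))

theorem Cu.exists_le_cut {s : Cu A} {x : PosCone (CTensor A K)} (h : WayBelow s (Cu.mk x)) :
    ∃ n : ℕ, s ≤ Cu.mk (x.cut (1 / ((n : ℝ) + 1))) :=
  h _ (Cu.monotone_cut x) _ (Cu.isLUB_cut x) le_rfl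

variable (A) in
/-- The Cuntz semigroup of any C*-algebra is an object of the category `Cu`. -/
theorem isCuSemigroup : IsCuSemigroup (Cu A) where
  add_assoc := Cu.add_assoc'
  add_comm := Cu.add_comm'
  zero_add := Cu.zero_add'
  zero_le := Cu.zero_le'
  add_le_add _ _ _ _ := Cu.add_le_add'
  exists_sup z hz := by
    choose ζ hζ using fun n => (z n).exists_rep
    obtain rfl : (fun n => Cu.mk (ζ n)) = z := funext hζ
    obtain ⟨w, hw, -⟩ := Cu.exists_sup' ζ hz
    exact ⟨_, hw⟩
  exists_rapid s := by
    obtain ⟨x, rfl⟩ := s.exists_rep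
    refine ⟨fun n : ℕ => Cu.mk (x.cut (1 / ((n : ℝ) + 1))), fun n => ?_, Cu.isLUB_cut x⟩
    obtain ⟨k, hk, hkx⟩ := x.exists_unit_cut (ε := 1 / ((n : ℝ) + 1))
      (ε' := 1 / (((n + 1 : ℕ) : ℝ) + 1)) (by positivity)
      (one_div_lt_one_div_of_lt (by positivity) (by push_cast; linarith))
    exact Cu.wayBelow_of_unit hk hkx
  sup_add y z s t hy hz hs ht := by
    refine ⟨?_, fun u hu => ?_⟩
    · rintro _ ⟨n, rfl⟩
      exact Cu.add_le_add' (hs.1 ⟨n, rfl⟩) (ht.1 ⟨n, rfl⟩)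
    · obtain ⟨a, rfl⟩ := s.exists_rep
      obtain ⟨b, rfl⟩ := t.exists_rep
      obtain ⟨u, rfl⟩ := u.exists_rep
      have h1 : Tendsto (fun n : ℕ => diagSum (a.cut (1 / ((n : ℝ) + 1))).1
          (b.cut (1 / ((n : ℝ) + 1))).1) atTop (𝓝 (diagSum a.1 b.1)) :=
        (((CTensor.continuous_mapRight (conjIsom 0)).tendsto _).comp a.tendsto_cut).add
          (((CTensor.continuous_mapRight (conjIsom 1)).tendsto _).comp b.tendsto_cut)
      refine Cu.mk_le_mk.2 (.of_tendsto h1 fun n => ?_)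
      obtain ⟨i, hi⟩ := Cu.wayBelow_cut (ε := 1 / ((n : ℝ) + 1)) (by positivity) a y hy _ hs le_rfl
      obtain ⟨j, hj⟩ := Cu.wayBelow_cut (ε := 1 / ((n : ℝ) + 1)) (by positivity) b z hz _ ht le_rfl
      exact Cu.mk_le_mk.1 ((Cu.add_le_add' (hi.trans (hy (le_max_left i j)))
        (hj.trans (hz (le_max_right i j)))).trans (hu ⟨max i j, rfl⟩))
  wayBelow_add s' s t' t hs ht := by
    obtain ⟨a, rfl⟩ := s.exists_rep
    obtain ⟨b, rfl⟩ := t.exists_rep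
    obtain ⟨m, hm⟩ := Cu.exists_le_cut hs
    obtain ⟨n, hn⟩ := Cu.exists_le_cut ht
    obtain ⟨k, hk, hka⟩ := a.exists_unit_cut_self (ε := 1 / ((m : ℝ) + 1)) (by positivity)
    obtain ⟨l, hl, hlb⟩ := b.exists_unit_cut_self (ε := 1 / ((n : ℝ) + 1)) (by positivity)
    have h : WayBelow (Cu.mk ((a.cut (1 / ((m : ℝ) + 1))).diagSum (b.cut (1 / ((n : ℝ) + 1)))))
        (Cu.mk (a.diagSum b)) := by
      refine Cu.wayBelow_of_unit (k := k.diagSum l) ?_ (CuntzLE.diagSum hka hlb)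
      change diagSum k.1 l.1 * diagSum _ _ = diagSum _ _
      rw [diagSum_mul, hk, hl]
    intro z hz u hu htu
    obtain ⟨i, hi⟩ := h z hz u hu htu
    exact ⟨i, (Cu.add_le_add' hm hn).trans hi⟩

end CuSemigroup

end

/-! ### Positive functionals and representations -/

section PositiveFunctional

open scoped ComplexOrder ComplexStarModule

variable {A : Type u} [NonUnitalCStarAlgebra A] [PartialOrder A] [StarOrderedRing A]

/-- Positive functionals separate a nonzero positive element from `0`. -/
theorem exists_positive_functional {h : A} (h0 : 0 ≤ h) (hne : h ≠ 0) :
    ∃ f : A →ₚ[ℂ] ℂ, f h ≠ 0 := by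
  have hmem : -h ∉ ProperCone.positive ℝ A := fun hn => by
    rw [ProperCone.mem_positive, Left.nonneg_neg_iff] at hn
    exact hne (le_antisymm hn h0)
  obtain ⟨g, hg, hgh⟩ := ProperCone.hyperplane_separation_point _ hmem
  rw [map_neg, neg_lt_zero] at hgh
  -- `g` is only real linear: its values on self-adjoint elements are extended complex linearly
  let r : Module.Dual ℝ A := g.toLinearMap ∘ₗ (selfAdjoint.submodule ℝ A).subtype ∘ₗ realPart
  have hr : ∀ x : A, IsSelfAdjoint x → r.extendRCLike (𝕜 := ℂ) x = (g x : ℂ) := fun x hx => by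
    have h1 : r x = g x := congrArg g hx.coe_realPart
    have h2 : r (Complex.I • x) = 0 := by
      have : realPart (Complex.I • x) = 0 := by
        rw [realPart_I_smul, hx.imaginaryPart, neg_zero]
      change g (realPart (Complex.I • x) : A) = 0
      rw [this]; exact map_zero g
    rw [Module.Dual.extendRCLike_apply, h1]
    simp [h2]
  refine ⟨PositiveLinearMap.mk₀ (r.extendRCLike (𝕜 := ℂ)) fun x hx => ?_, ?_⟩
  · rw [hr x (.of_nonneg hx)]
    exact_mod_cast hg x hx
  · change r.extendRCLike (𝕜 := ℂ) h ≠ 0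
    rw [hr h (.of_nonneg h0)]
    exact_mod_cast hgh.ne'

/-- A nonzero element acts nontrivially in some representation given by a positive functional. -/
theorem exists_gns_ne_zero {a : A} (ha : a ≠ 0) :
    ∃ f : A →ₚ[ℂ] ℂ, f.gnsNonUnitalStarAlgHom a ≠ 0 := by
  have h1 : star (a * star a) * (a * star a) ≠ 0 := fun h => ha <| by
    rwa [CStarRing.star_mul_self_eq_zero_iff, CStarRing.mul_star_self_eq_zero_iff] at h
  obtain ⟨f, hf⟩ := exists_positive_functional (star_mul_self_nonneg (a * star a)) h1
  refine ⟨f, fun h => hf ?_⟩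
  have h2 := congrArg (fun T : f.GNS →L[ℂ] f.GNS => T (f.toPreGNS (star a))) h
  simp only [PositiveLinearMap.gnsNonUnitalStarAlgHom_apply_coe, zero_apply] at h2
  have h3 : ‖f.leftMulMapPreGNS a (f.toPreGNS (star a))‖ = 0 := by
    rw [← Completion.norm_coe, h2, norm_zero]
  have h4 := f.preGNS_norm_sq (f.leftMulMapPreGNS a (f.toPreGNS (star a)))
  rw [h3] at h4
  simpa using h4.symm

end PositiveFunctional

/-! ### The corner embedding of `A` in `A ⊗ 𝒦` -/

section SpatialSeminorm

variable {A : Type u} {B : Type v} [NonUnitalCStarAlgebra A] [NonUnitalCStarAlgebra B]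
  {H : Type*} [NormedAddCommGroup H] [InnerProductSpace ℂ H] [CompleteSpace H]
  {L : Type*} [NormedAddCommGroup L] [InnerProductSpace ℂ L] [CompleteSpace L]

/-- The representation `π ⊗ ρ` of `A ⊙ B` by bounded operators on the algebraic tensor product
`H ⊗ L`, which need not be complete. -/
def tensorRep (π : A →⋆ₙₐ[ℂ] (H →L[ℂ] H)) (ρ : B →⋆ₙₐ[ℂ] (L →L[ℂ] L)) :
    AlgTensor A B →ₗ[ℂ] (H ⊗[ℂ] L →L[ℂ] H ⊗[ℂ] L) :=
  (TensorProduct.lift (LinearMap.mk₂ ℂ (fun a b => TensorProduct.mapL (π a) (ρ b))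
    (fun a a' b => by rw [map_add, TensorProduct.mapL_add_left])
    (fun c a b => by rw [map_smul, TensorProduct.mapL_smul_left])
    (fun a b b' => by rw [map_add, TensorProduct.mapL_add_right])
    (fun c a b => by rw [map_smul, TensorProduct.mapL_smul_right])) :
      A ⊗[ℂ] B →ₗ[ℂ] (H ⊗[ℂ] L →L[ℂ] H ⊗[ℂ] L))

variable (π : A →⋆ₙₐ[ℂ] (H →L[ℂ] H)) (ρ : B →⋆ₙₐ[ℂ] (L →L[ℂ] L))

theorem tensorRep_tmul (a : A) (b : B) :
    tensorRep π ρ (AlgTensor.tmul a b) = TensorProduct.mapL (π a) (ρ b) := rfl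

theorem tensorRep_mul (x y : AlgTensor A B) :
    tensorRep π ρ (x * y) = tensorRep π ρ x * tensorRep π ρ y := by
  induction x using AlgTensor.induction with
  | h0 => simp
  | ha x x' hx hx' => simp [add_mul, hx, hx']
  | ht a b =>
    induction y using AlgTensor.induction with
    | h0 => simp
    | ha x x' hx hx' => simp [mul_add, hx, hx']
    | ht a' b' =>
      rw [AlgTensor.tmul_mul_tmul, tensorRep_tmul, tensorRep_tmul, tensorRep_tmul, map_mul, map_mul,
        TensorProduct.mapL_mul]

theorem inner_tensorRep (x : AlgTensor A B) (u v : H ⊗[ℂ] L) :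
    inner ℂ (tensorRep π ρ x u) v = inner ℂ u (tensorRep π ρ (star x) v) := by
  induction x using AlgTensor.induction with
  | h0 => simp
  | ha x x' hx hx' => simp [inner_add_left, inner_add_right, hx, hx']
  | ht a b =>
    rw [AlgTensor.star_tmul, tensorRep_tmul, tensorRep_tmul, map_star, map_star]
    induction u using TensorProduct.induction_on with
    | zero => simp
    | add u u' hu hu' => simp only [map_add, inner_add_left, hu, hu']
    | tmul h l =>
      induction v using TensorProduct.induction_on with
      | zero => simp
      | add v v' hv hv' => simp only [map_add, inner_add_right, hv, hv']
      | tmul h' l' =>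
        rw [TensorProduct.mapL_tmul, TensorProduct.mapL_tmul, TensorProduct.inner_tmul,
          TensorProduct.inner_tmul, ContinuousLinearMap.star_eq_adjoint,
          ContinuousLinearMap.star_eq_adjoint, ContinuousLinearMap.adjoint_inner_right,
          ContinuousLinearMap.adjoint_inner_right]

/-- The C*-inequality holds for `π ⊗ ρ` although `H ⊗ L` need not be complete: the adjoint of
`(π ⊗ ρ) x` is `(π ⊗ ρ) (x*)`. -/
theorem norm_tensorRep_sq_le (x : AlgTensor A B) :
    ‖tensorRep π ρ x‖ ^ 2 ≤ ‖tensorRep π ρ (star x * x)‖ := by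
  refine (Real.le_sqrt (ContinuousLinearMap.opNorm_nonneg _)
    (ContinuousLinearMap.opNorm_nonneg _)).1
    (ContinuousLinearMap.opNorm_le_bound _ (Real.sqrt_nonneg _) fun u => ?_)
  rw [← sq_le_sq₀ (norm_nonneg _) (by positivity), mul_pow, Real.sq_sqrt (norm_nonneg _)]
  have h1 : ‖tensorRep π ρ x u‖ ^ 2 = RCLike.re (inner ℂ u (tensorRep π ρ (star x * x) u)) := by
    rw [tensorRep_mul, ← inner_self_eq_norm_sq (𝕜 := ℂ), inner_tensorRep]
    rfl
  rw [h1]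
  refine (RCLike.re_le_norm _).trans ((norm_inner_le_norm (𝕜 := ℂ) u _).trans ?_)
  have := (tensorRep π ρ (star x * x)).le_opNorm u
  nlinarith [norm_nonneg u]

theorem norm_tensorRep_star_le (x : AlgTensor A B) :
    ‖tensorRep π ρ (star x)‖ ≤ ‖tensorRep π ρ x‖ := by
  by_contra! h
  have h1 := norm_tensorRep_sq_le π ρ (star x)
  rw [star_star, tensorRep_mul] at h1
  have h2 := norm_mul_le (tensorRep π ρ x) (tensorRep π ρ (star x))
  nlinarith [norm_nonneg (tensorRep π ρ x)]

/-- The C*-seminorm `x ↦ ‖(π ⊗ ρ) x‖`. -/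
def tensorRepSeminorm : SubcrossSeminorm A B :=
  ⟨(normSeminorm ℂ (H ⊗[ℂ] L →L[ℂ] H ⊗[ℂ] L)).comp (tensorRep π ρ), ⟨fun x y => by
      simpa [tensorRep_mul] using norm_mul_le (tensorRep π ρ x) (tensorRep π ρ y), fun x => by
      refine le_antisymm ?_ (norm_tensorRep_sq_le π ρ x)
      change ‖tensorRep π ρ (star x * x)‖ ≤ ‖tensorRep π ρ x‖ ^ 2
      rw [tensorRep_mul, sq]
      have h1 := norm_mul_le (tensorRep π ρ (star x)) (tensorRep π ρ x)
      nlinarith [norm_tensorRep_star_le π ρ x, norm_nonneg (tensorRep π ρ x)]⟩,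
    fun a b => (TensorProduct.norm_mapL_le (π a) (ρ b)).trans (mul_le_mul
      (NonUnitalStarAlgHom.norm_apply_le π a) (NonUnitalStarAlgHom.norm_apply_le ρ b)
      (norm_nonneg _) (norm_nonneg _))⟩

/-- `a ⊗ b ≠ 0` in the completion if `a` and `b` act nontrivially in some representations. -/
theorem CTensor.tmul_ne_zero {a : A} {b : B} (ha : π a ≠ 0) (hb : ρ b ≠ 0) :
    CTensor.tmul a b ≠ 0 := fun h => by
  obtain ⟨x, hx⟩ : ∃ x, π a x ≠ 0 := by
    by_contra! h; exact ha (ContinuousLinearMap.ext h)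
  obtain ⟨y, hy⟩ : ∃ y, ρ b y ≠ 0 := by
    by_contra! h; exact hb (ContinuousLinearMap.ext h)
  have h1 : ‖AlgTensor.tmul a b‖ = 0 := by
    rw [← CTensor.of.norm_map]
    exact norm_eq_zero.2 h
  have h2 : ‖tensorRep π ρ (AlgTensor.tmul a b)‖ ≤ 0 :=
    (le_maxNorm (tensorRepSeminorm π ρ) _).trans_eq h1
  have h3 : tensorRep π ρ (AlgTensor.tmul a b) (x ⊗ₜ y) = 0 := by
    rw [← norm_le_zero_iff]
    exact ((tensorRep π ρ _).le_of_opNorm_le h2 _).trans_eq (zero_mul _)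
  rw [tensorRep_tmul, TensorProduct.mapL_tmul, ← norm_eq_zero, TensorProduct.norm_tmul,
    mul_eq_zero, norm_eq_zero, norm_eq_zero] at h3
  exact h3.elim hx hy

end SpatialSeminorm

section Corner

variable {A : Type u} [NonUnitalCStarAlgebra A]

-- direct access to the algebraic structure of `𝒦`, whose general search is slow
instance : Mul K := inferInstance
instance : Star K := inferInstance
instance : NonUnitalRing K := inferInstance
instance : Module ℂ K := inferInstance

theorem ket_zero_inner : inner ℂ (ket 0) (ket 0) = (1 : ℂ) := by rw [inner_ket_ket, if_pos rfl]

theorem e00_mul_mul (T : Ell2 →L[ℂ] Ell2) :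
    e00.1 * T * e00.1 = inner ℂ (ket 0) (T (ket 0)) • e00.1 := by
  ext1 x
  simp [e00, InnerProductSpace.rankOne_apply, mul_apply_eq_comp, smul_smul, mul_comm]

theorem e00_mul_mul' (k : K) : e00 * k * e00 = inner ℂ (ket 0) (k.1 (ket 0)) • e00 :=
  Subtype.ext (e00_mul_mul k.1)

theorem e00_mul_self : e00 * e00 = e00 := Subtype.ext <| by
  have h := e00_mul_mul 1
  rwa [mul_one, one_apply_eq_self, ket_zero_inner, one_smul] at h

theorem star_e00 : star e00 = e00 := Subtype.ext <| by
  change star (InnerProductSpace.rankOne ℂ (ket 0) (ket 0)) = _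
  rw [ContinuousLinearMap.star_eq_adjoint, InnerProductSpace.adjoint_rankOne]
  rfl

theorem e00_ne_zero : e00.1 ≠ 0 := fun h => by
  have h1 := congrArg (fun T : Ell2 →L[ℂ] Ell2 => inner ℂ (ket 0) (T (ket 0))) h
  simp only [e00, InnerProductSpace.rankOne_apply, ket_zero_inner, inner_smul_right, mul_one,
    zero_apply, inner_zero_right] at h1
  exact one_ne_zero h1

variable (A) in
/-- The embedding `a ↦ a ⊗ e₀₀` of `A` as a corner of `A ⊗ 𝒦`. -/
def cornerHom : A →⋆ₙₐ[ℂ] CTensor A K where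
  toFun a := CTensor.tmul a e00
  map_smul' c a := CTensor.smul_tmul c a e00
  map_zero' := by simpa using CTensor.smul_tmul 0 (0 : A) e00
  map_add' a b := CTensor.add_tmul a b e00
  map_mul' a b := by rw [CTensor.tmul_mul_tmul, e00_mul_self]
  map_star' a := by rw [CTensor.star_tmul, star_e00]

theorem cornerHom_injective : Function.Injective (cornerHom A) := by
  rw [injective_iff_map_eq_zero]
  intro a ha
  by_contra hne
  let _ := CStarAlgebra.spectralOrder A
  have _ := CStarAlgebra.spectralOrderedRing A
  obtain ⟨f, hf⟩ := exists_gns_ne_zero hne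
  exact CTensor.tmul_ne_zero f.gnsNonUnitalStarAlgHom
    (NonUnitalStarSubalgebraClass.subtype compactOps) (b := e00) hf e00_ne_zero ha

theorem norm_cornerHom (a : A) : ‖cornerHom A a‖ = ‖a‖ :=
  NonUnitalStarAlgHom.norm_map _ cornerHom_injective a

theorem isClosed_range_cornerHom : IsClosed (Set.range (cornerHom A)) :=
  (AddMonoidHomClass.isometry_of_norm (cornerHom A) norm_cornerHom).isClosedEmbedding.isClosed_range

variable (A) in
/-- The projection `1 ⊗ e₀₀` in the multiplier algebra of `A ⊗ 𝒦`. -/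
def cornerProj : Mult (CTensor A K) := opTensor A e00.1

theorem star_cornerProj : star (cornerProj A) = cornerProj A := by
  rw [cornerProj, star_opTensor]
  exact congrArg (opTensor A) (congrArg Subtype.val star_e00)

theorem norm_cornerProj_le : ‖cornerProj A‖ ≤ 1 := by
  refine (norm_opTensor_le _).trans ?_
  rw [e00, InnerProductSpace.norm_rankOne]
  simp [ket]

theorem opTensor_mul_tmul {T : Ell2 →L[ℂ] Ell2} (a : A) {k l : K} (h : T * k.1 = l.1) :
    opTensor A T * toMult _ (CTensor.tmul a k) = toMult _ (CTensor.tmul a l) := by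
  rw [mul_toMult, opTensor_fst_tmul]
  exact congrArg (fun k => toMult _ (CTensor.tmul a k)) (Subtype.ext h)

theorem tmul_mul_opTensor {T : Ell2 →L[ℂ] Ell2} (a : A) {k l : K} (h : k.1 * T = l.1) :
    toMult _ (CTensor.tmul a k) * opTensor A T = toMult _ (CTensor.tmul a l) := by
  have h1 : (opMult (star T)).fst (star k) = star l := Subtype.ext <| by
    change star T * star k.1 = star l.1
    rw [← star_mul, h]
  have h2 : star (CTensor.tmul (star a) (star l)) = CTensor.tmul a l := by
    rw [CTensor.star_tmul, star_star a, star_star l]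
  have h3 : (star (opTensor A T)).fst (star (CTensor.tmul a k)) =
      CTensor.tmul (star a) (star l) := by
    rw [star_opTensor, CTensor.star_tmul, opTensor_fst_tmul, h1]
  rw [toMult_mul, h3, h2]

theorem cornerProj_mul_tmul (a : A) (k : K) :
    cornerProj A * toMult _ (CTensor.tmul a k) = toMult _ (CTensor.tmul a (e00 * k)) :=
  opTensor_mul_tmul a rfl

theorem tmul_mul_cornerProj (a : A) (k : K) :
    toMult _ (CTensor.tmul a k) * cornerProj A = toMult _ (CTensor.tmul a (k * e00)) :=
  tmul_mul_opTensor a rfl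

theorem cornerProj_mul_cornerHom (a : A) :
    cornerProj A * toMult _ (cornerHom A a) = toMult _ (cornerHom A a) := by
  refine (cornerProj_mul_tmul a e00).trans ?_
  exact congrArg (fun k => toMult _ (CTensor.tmul a k)) e00_mul_self

theorem toMult_fst_snd {D : Type u} [NonUnitalCStarAlgebra D] (m : Mult D) (x : D) :
    toMult D (m.fst (m.snd x)) = m * toMult D x * m := by
  rw [mul_assoc, toMult_mul, mul_toMult, DoubleCentralizer.star_fst, star_star, star_star]

/-- Compression by `p` turns an approximation of `a` by `x b x*` into one by `c b c*`, `c = p x p`. -/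
theorem compress_conj_sub {M : Type*} [Ring M] [StarRing M] {p x a b c : M} (hp : star p = p)
    (hpa : p * a = a) (hap : a * p = a) (hpb : p * b = b) (hbp : b * p = b) (hc : c = p * x * p) :
    c * b * star c - a = p * (x * b * star x - a) * p := by
  subst hc
  calc _ = p * x * (p * b * p) * star x * p - a := by rw [star_mul, star_mul, hp]; noncomm_ring
    _ = p * x * b * star x * p - p * a * p := by rw [hpb, hbp, hpa, hap]
    _ = _ := by noncomm_ring

/-- An isometric embedding onto the corner `p D p` reflects Cuntz subequivalence: the approximating
elements are compressed by `p`. -/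
theorem CuntzLE.of_corner {D : Type u} [NonUnitalCStarAlgebra D] (ι : A →⋆ₙₐ[ℂ] D)
    (hι : ∀ a, ‖ι a‖ = ‖a‖) {p : Mult D} (hp : star p = p) (hp1 : ‖p‖ ≤ 1)
    (hpι : ∀ a, p * toMult D (ι a) = toMult D (ι a))
    (hc : ∀ x, ∃ a, toMult D (ι a) = p * toMult D x * p) {a b : A} (h : CuntzLE (ι a) (ι b)) :
    CuntzLE a b := by
  have hιp : ∀ a, toMult D (ι a) * p = toMult D (ι a) := fun a => by
    have h := congrArg star (hpι (star a))
    rwa [star_mul, hp, ← map_star, ← map_star, star_star] at h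
  refine .of_approx fun ε hε => ?_
  obtain ⟨x, hx⟩ := h.approx hε
  obtain ⟨c, hc⟩ := hc x
  refine ⟨c, ?_⟩
  rw [← hι, ← norm_toMult]
  refine lt_of_le_of_lt ?_ hx
  have h1 : toMult _ (ι (c * b * star c - a)) = p * toMult _ (x * ι b * star x - ι a) * p := by
    simp only [map_sub, map_mul, map_star]
    exact compress_conj_sub hp (hpι a) (hιp a) (hpι b) (hιp b) hc
  rw [h1, ← norm_toMult (x * ι b * star x - ι a)]
  refine (norm_mul_le _ _).trans ?_
  refine (mul_le_mul_of_nonneg_left hp1 (norm_nonneg _)).trans ?_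
  rw [mul_one]
  exact (norm_mul_le _ _).trans (mul_le_of_le_one_left (norm_nonneg _) hp1)

/-- The corner of `A ⊗ 𝒦` at `1 ⊗ e₀₀` is `A ⊗ e₀₀`: this holds for elementary tensors, and the
isometric image of `A` is closed. -/
theorem exists_cornerHom_eq (x : CTensor A K) :
    ∃ a, toMult _ (cornerHom A a) = cornerProj A * toMult _ x * cornerProj A := by
  let Φ := (cornerProj A).fst ∘L (cornerProj A).snd
  have hΦ : ∀ x, toMult _ (Φ x) = cornerProj A * toMult _ x * cornerProj A :=
    toMult_fst_snd (cornerProj A)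
  suffices h : ∀ x, Φ x ∈ Set.range (cornerHom A) by
    obtain ⟨a, ha⟩ := h x
    exact ⟨a, by rw [ha, hΦ]⟩
  clear_value Φ
  intro x
  induction x using CTensor.induction with
  | hP => exact isClosed_range_cornerHom.preimage Φ.continuous
  | h y =>
    induction y using AlgTensor.induction with
    | h0 => exact ⟨0, by rw [map_zero (cornerHom A), map_zero CTensor.of, map_zero Φ]⟩
    | ha y z hy hz =>
      obtain ⟨a, ha⟩ := hy
      obtain ⟨b, hb⟩ := hz
      exact ⟨a + b, by rw [map_add (cornerHom A), map_add CTensor.of, map_add Φ, ha, hb]⟩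
    | ht a k =>
      refine ⟨inner ℂ (ket 0) (k.1 (ket 0)) • a, toMult_injective ?_⟩
      refine Eq.trans ?_ (hΦ (CTensor.tmul a k)).symm
      rw [cornerProj_mul_tmul, tmul_mul_cornerProj]
      have h1 : CTensor.tmul a (e00 * k * e00) =
          CTensor.tmul (inner ℂ (ket 0) (k.1 (ket 0)) • a) e00 := by
        rw [CTensor.smul_tmul, ← CTensor.tmul_smul]
        exact congrArg (CTensor.tmul a) (e00_mul_mul' k)
      exact congrArg (toMult _) h1.symm

/-- The corner embedding reflects Cuntz subequivalence. -/
theorem CuntzLE.of_cornerHom {a b : A} (h : CuntzLE (cornerHom A a) (cornerHom A b)) :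
    CuntzLE a b :=
  .of_corner (cornerHom A) norm_cornerHom star_cornerProj norm_cornerProj_le
    cornerProj_mul_cornerHom exists_cornerHom_eq h

end Corner

/-! ### Stable algebras: classes of `Cu(A)` have representatives in `A` -/

section

attribute [local instance] CStarAlgebra.spectralOrder CStarAlgebra.spectralOrderedRing

section Factorization

variable {D : Type u} [NonUnitalCStarAlgebra D]

theorem star_fst_mul_fst (m : Mult D) (d : D) :
    star (m.fst d) * m.fst d = star d * (star m * m).fst d := by
  rw [star_fst_mul, DoubleCentralizer.mul_fst, mul_apply_eq_comp]

/-- If `(T i)* (T i) = Q i`, the ranges of the `T i` are orthogonal and `∑ Q i d = d`, then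
`g = ∑ T i d` converges and `g*g = d*d`. -/
theorem exists_tendsto_sum_fst {T Q : ℕ → Mult D}
    (hTQ : ∀ i j, star (T i) * T j = if i = j then Q i else 0) (d : D)
    (hQ : Tendsto (fun n => (∑ i ∈ Finset.range n, Q i).fst d) atTop (𝓝 d)) :
    ∃ g, star g * g = star d * d ∧
      Tendsto (fun n => (∑ i ∈ Finset.range n, T i).fst d) atTop (𝓝 g) := by
  have key : ∀ s : Finset ℕ, star (∑ i ∈ s, T i) * ∑ i ∈ s, T i = ∑ i ∈ s, Q i := fun s => by
    rw [star_sum, Finset.sum_mul_sum]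
    refine Finset.sum_congr rfl fun i hi => ?_
    simp [hTQ, hi]
  have hsub : ∀ (R : ℕ → Mult D) {N n : ℕ}, N ≤ n → (∑ i ∈ Finset.range n, R i).fst d -
      (∑ i ∈ Finset.range N, R i).fst d = (∑ i ∈ Finset.Ico N n, R i).fst d := fun R N n h => by
    rw [Finset.sum_Ico_eq_sub _ h, DoubleCentralizer.sub_fst]; rfl
  have hC : CauchySeq fun n => (∑ i ∈ Finset.range n, T i).fst d := by
    rw [Metric.cauchySeq_iff']
    intro ε hε
    obtain ⟨N, hN⟩ := Metric.cauchySeq_iff'.1 hQ.cauchySeq (ε ^ 2 / (‖d‖ + 1)) (by positivity)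
    refine ⟨N, fun n hn => ?_⟩
    have h1 := hN n hn
    rw [dist_eq_norm, hsub _ hn, lt_div_iff₀ (by positivity)] at h1
    rw [dist_eq_norm, hsub _ hn]
    refine lt_of_pow_lt_pow_left₀ 2 hε.le ?_
    rw [sq, ← CStarRing.norm_star_mul_self, star_fst_mul_fst, key]
    refine (norm_mul_le _ _).trans_lt ?_
    rw [norm_star]
    nlinarith [norm_nonneg ((∑ i ∈ Finset.Ico N n, Q i).fst d)]
  obtain ⟨g, hg⟩ := cauchySeq_tendsto_of_complete hC
  refine ⟨g, tendsto_nhds_unique (hg.star.mul hg) ?_, hg⟩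
  simp only [star_fst_mul_fst, key]
  exact hQ.const_mul (star d)

/-- The square root of `g g*` lies in the corner at any projection that fixes `g`. -/
theorem exists_sqrt_corner {p : Mult D} (hp : star p = p) {g : D} (hg : p.fst g = g) :
    ∃ s : D, star s = s ∧ s * s = g * star g ∧ p * toMult D s * p = toMult D s := by
  have hs : star (CFC.sqrt (g * star g)) = CFC.sqrt (g * star g) :=
    (CFC.sqrt_nonneg (g * star g)).isSelfAdjoint
  have hss := CFC.sqrt_mul_sqrt_self (g * star g) (mul_star_self_nonneg g)
  refine ⟨_, hs, hss, ?_⟩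
  set s := CFC.sqrt (g * star g)
  have h1 : (1 - p) * toMult D g = 0 := by
    rw [sub_mul, one_mul, mul_toMult, hg, sub_self]
  have h2 : (1 - p) * toMult D s = 0 := by
    rw [← CStarRing.mul_star_self_eq_zero_iff, star_mul, ← map_star, hs]
    calc (1 - p) * toMult D s * (toMult D s * star (1 - p)) =
        (1 - p) * toMult D (s * s) * star (1 - p) := by rw [map_mul]; simp only [mul_assoc]
      _ = 0 := by rw [hss, map_mul, ← mul_assoc, h1, zero_mul, zero_mul]
  have h3 : p * toMult D s = toMult D s := by
    rw [sub_mul, one_mul, sub_eq_zero] at h2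
    exact h2.symm
  have h4 := congrArg star h3
  rw [star_mul, hp, ← map_star, hs] at h4
  rw [h3, h4]

end Factorization

section MatrixUnits

open InnerProductSpace

theorem rankOne_ket_mul (i j k l : ℕ) :
    (rankOne ℂ (ket i) (ket j) : Ell2 →L[ℂ] Ell2) * rankOne ℂ (ket k) (ket l) =
      if j = k then rankOne ℂ (ket i) (ket l) else 0 := by
  change (rankOne ℂ (ket i) (ket j)) ∘L (rankOne ℂ (ket k) (ket l)) = _
  rw [rankOne_comp_rankOne, inner_ket_ket]
  split_ifs <;> simp

theorem star_rankOne_ket (i j : ℕ) :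
    star (rankOne ℂ (ket i) (ket j) : Ell2 →L[ℂ] Ell2) = rankOne ℂ (ket j) (ket i) := by
  rw [ContinuousLinearMap.star_eq_adjoint, adjoint_rankOne]

/-- The projection onto the span of the first `n` standard unit vectors. -/
def ketProj (n : ℕ) : Ell2 →L[ℂ] Ell2 := ∑ i ∈ Finset.range n, rankOne ℂ (ket i) (ket i)

theorem isStarProjection_ketProj (n : ℕ) : IsStarProjection (ketProj n) where
  isIdempotentElem := by
    rw [IsIdempotentElem, ketProj, Finset.sum_mul_sum]
    refine Finset.sum_congr rfl fun i hi => ?_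
    simp only [rankOne_ket_mul, Finset.sum_ite_eq, hi, if_true]
  isSelfAdjoint := by
    rw [IsSelfAdjoint, ketProj, star_sum]
    exact Finset.sum_congr rfl fun i _ => star_rankOne_ket i i

theorem tendsto_ketProj_sub_one (x : Ell2) :
    Tendsto (fun n => (ketProj n - 1) x) atTop (𝓝 0) := by
  refine tendsto_zero_of_ket (C := 1) (fun n => ?_) (fun i => ?_) x
  · rw [← norm_neg, neg_sub]
    exact (isStarProjection_ketProj n).one_sub.norm_le
  · refine tendsto_const_nhds.congr' ?_
    filter_upwards [eventually_gt_atTop i] with n hn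
    have h1 : ketProj n (ket i) = ket i := by
      rw [ketProj, sum_apply]
      simp only [rankOne_apply, inner_ket_ket, ite_smul, one_smul, zero_smul]
      rw [Finset.sum_ite_eq', if_pos (Finset.mem_range.2 hn)]
    rw [sub_apply, h1, one_apply_eq_self, sub_self]

variable {A : Type u} [NonUnitalCStarAlgebra A]

theorem opTensor_ketProj (n : ℕ) :
    opTensor A (ketProj n) = ∑ i ∈ Finset.range n, opTensor A (rankOne ℂ (ket i) (ket i)) := by
  induction n with
  | zero => simp [ketProj, opTensor_zero]
  | succ n ih =>
    rw [Finset.sum_range_succ, ← ih, ← opTensor_add, ketProj, ketProj, Finset.sum_range_succ]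

theorem tendsto_sum_opTensor_fst (x : CTensor A K) :
    Tendsto (fun n => (∑ i ∈ Finset.range n, opTensor A (rankOne ℂ (ket i) (ket i))).fst x) atTop
      (𝓝 x) := by
  have h1 := tendsto_opTensor_fst (A := A) (C := 1) (fun n => by
    rw [← norm_neg, neg_sub]
    exact (isStarProjection_ketProj n).one_sub.norm_le) tendsto_ketProj_sub_one x
  have h2 := h1.add_const x
  rw [zero_add] at h2
  refine h2.congr fun n => ?_
  have h3 : opTensor A (ketProj n - 1) + 1 = opTensor A (ketProj n) := by
    rw [← opTensor_one, ← opTensor_add, sub_add_cancel]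
  rw [← opTensor_ketProj, ← h3, DoubleCentralizer.add_fst, DoubleCentralizer.one_fst]
  rfl

theorem opTensor_mul_multTmul (S T : Ell2 →L[ℂ] Ell2) (v : Mult A) :
    opTensor A S * multTmul v (opMult T) = multTmul v (opMult (S * T)) := by
  rw [opTensor, multTmul_mul, one_mul, opMult_mul]

/-- If the multiplier algebra of `A` contains isometries `v i` with orthogonal ranges, then the
corner `A ⊗ e₀₀` meets the Cuntz class of every positive element of `A ⊗ 𝒦`: the strict sum of the
`v i ⊗ e₀ᵢ` is an isometry from `A ⊗ 𝒦` to this corner. -/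
theorem exists_cornerHom_equiv {v : ℕ → Mult A}
    (hv : ∀ i j, star (v i) * v j = if i = j then 1 else 0) (d : CTensor A K) :
    ∃ c : A, CuntzLE (cornerHom A (star c * c)) (star d * d) ∧
      CuntzLE (star d * d) (cornerHom A (star c * c)) := by
  let T : ℕ → Mult (CTensor A K) := fun i => multTmul (v i) (opMult (rankOne ℂ (ket 0) (ket i)))
  have hT : ∀ i j, star (T i) * T j =
      if i = j then opTensor A (rankOne ℂ (ket i) (ket i)) else 0 := fun i j => by
    rw [star_multTmul, multTmul_mul, star_opMult, opMult_mul, star_rankOne_ket, rankOne_ket_mul,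
      if_pos rfl, hv]
    split_ifs with h
    · rw [h]; rfl
    · exact multTmul_zero_left _
  obtain ⟨g, hgd, hg⟩ := exists_tendsto_sum_fst hT d (tendsto_sum_opTensor_fst d)
  have hpT : ∀ i, cornerProj A * T i = T i := fun i => by
    refine (opTensor_mul_multTmul _ _ _).trans ?_
    have := rankOne_ket_mul 0 0 0 i
    rw [if_pos rfl] at this
    exact congrArg (fun S => multTmul (v i) (opMult S)) this
  have hpg : (cornerProj A).fst g = g := by
    refine tendsto_nhds_unique (((cornerProj A).fst.continuous.tendsto g).comp hg) (hg.congr ?_)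
    intro n
    have h1 : cornerProj A * ∑ i ∈ Finset.range n, T i = ∑ i ∈ Finset.range n, T i := by
      rw [Finset.mul_sum]
      exact Finset.sum_congr rfl fun i _ => hpT i
    exact (congrArg (fun m : Mult (CTensor A K) => m.fst d) h1).symm
  obtain ⟨s, hs, hss, hps⟩ := exists_sqrt_corner star_cornerProj hpg
  obtain ⟨c, hc⟩ := exists_cornerHom_eq s
  have hcs : cornerHom A c = s := toMult_injective (hc.trans hps)
  have h1 : cornerHom A (star c * c) = g * star g := by
    rw [map_mul, map_star, hcs, hs, hss]
  refine ⟨c, ?_, ?_⟩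
  · rw [h1, ← hgd]; exact .mul_star_self g
  · rw [h1, ← hgd]; exact .star_mul_self g

end MatrixUnits

section Stable

/-- An isomorphism of C*-algebras as a bounded linear map. -/
def starAlgEquivL {D E : Type u} [NonUnitalCStarAlgebra D] [NonUnitalCStarAlgebra E]
    (θ : D ≃⋆ₐ[ℂ] E) : D →L[ℂ] E where
  toFun := θ
  map_add' := map_add θ
  map_smul' := map_smul θ
  cont := (NonUnitalStarAlgHom.isometry θ θ.injective).continuous

/-- The multiplier of `D` that corresponds to a multiplier of `E` under an isomorphism `D ≅ E`. -/
def multTransport {D E : Type u} [NonUnitalCStarAlgebra D] [NonUnitalCStarAlgebra E]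
    (θ : D ≃⋆ₐ[ℂ] E) (m : Mult E) : Mult D where
  fst := starAlgEquivL θ.symm ∘L m.fst ∘L starAlgEquivL θ
  snd := starAlgEquivL θ.symm ∘L m.snd ∘L starAlgEquivL θ
  central x y := θ.injective <| by
    change θ (θ.symm (m.snd (θ x)) * y) = θ (x * θ.symm (m.fst (θ y)))
    rw [map_mul, map_mul, θ.apply_symm_apply, θ.apply_symm_apply, m.central]

section

variable {D E : Type u} [NonUnitalCStarAlgebra D] [NonUnitalCStarAlgebra E] (θ : D ≃⋆ₐ[ℂ] E)

theorem multTransport_fst (m : Mult E) (x : D) :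
    (multTransport θ m).fst x = θ.symm (m.fst (θ x)) := rfl

theorem multTransport_mul (m n : Mult E) :
    multTransport θ m * multTransport θ n = multTransport θ (m * n) := mult_ext fun x => by
  rw [DoubleCentralizer.mul_fst, mul_apply_eq_comp, multTransport_fst, multTransport_fst,
    θ.apply_symm_apply, multTransport_fst, DoubleCentralizer.mul_fst, mul_apply_eq_comp]

theorem multTransport_one : multTransport θ 1 = 1 := mult_ext fun x => θ.symm_apply_apply x

theorem multTransport_zero : multTransport θ 0 = 0 := mult_ext fun _ => map_zero θ.symm

theorem star_multTransport (m : Mult E) : star (multTransport θ m) = multTransport θ (star m) :=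
  mult_ext fun x => by
    rw [multTransport_fst, DoubleCentralizer.star_fst, DoubleCentralizer.star_fst]
    change star (θ.symm (m.snd (θ (star x)))) = _
    rw [map_star θ, ← map_star θ.symm]

theorem exists_isometry_pair_of_equiv (θ : D ≃⋆ₐ[ℂ] E) {W : Fin 2 → Mult E}
    (hW : ∀ i, star (W i) * W i = 1) (hW' : star (W 0) * W 1 = 0) :
    ∃ V : Fin 2 → Mult D, (∀ i, star (V i) * V i = 1) ∧ star (V 0) * V 1 = 0 := by
  refine ⟨fun i => multTransport θ (W i), fun i => ?_, ?_⟩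
  · rw [star_multTransport, multTransport_mul, hW i, multTransport_one]
  · rw [star_multTransport, multTransport_mul, hW', multTransport_zero]

end

/-- Powers of one of two isometries with orthogonal ranges, applied to the other one, give
infinitely many isometries with orthogonal ranges. -/
theorem star_pow_mul_mul_pow_mul {M : Type*} [Ring M] [StarRing M] {w₀ w₁ : M}
    (h0 : star w₀ * w₀ = 1) (h1 : star w₁ * w₁ = 1) (h01 : star w₀ * w₁ = 0) (i j : ℕ) :
    star (w₁ ^ i * w₀) * (w₁ ^ j * w₀) = if i = j then 1 else 0 := by
  have hc : ∀ k, star (w₁ ^ k) * w₁ ^ k = 1 := fun k => by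
    induction k with
    | zero => simp
    | succ k ih =>
      rw [pow_succ', star_mul, mul_assoc, ← mul_assoc (star w₁), h1, one_mul, ih]
  have hlt : ∀ {i j : ℕ}, i < j → star (w₁ ^ i * w₀) * (w₁ ^ j * w₀) = 0 := fun {i j} hij => by
    obtain ⟨k, rfl⟩ := Nat.exists_eq_add_of_lt hij
    rw [add_assoc, pow_add, star_mul]
    calc star w₀ * star (w₁ ^ i) * (w₁ ^ i * w₁ ^ (k + 1) * w₀) =
        star w₀ * (star (w₁ ^ i) * w₁ ^ i) * w₁ ^ (k + 1) * w₀ := by simp only [mul_assoc]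
      _ = 0 := by rw [hc, mul_one, pow_succ', ← mul_assoc, h01, zero_mul, zero_mul]
  rcases lt_trichotomy i j with h | rfl | h
  · rw [hlt h, if_neg h.ne]
  · rw [if_pos rfl, star_mul, mul_assoc, ← mul_assoc (star (w₁ ^ i)), hc, one_mul, h0]
  · have := congrArg star (hlt h)
    rw [star_mul, star_star, star_zero] at this
    rw [this, if_neg h.ne']

/-- The multiplier algebra of a stable C*-algebra contains two isometries with orthogonal ranges. -/
theorem IsStable.exists_isometry_pair {A : Type u} [NonUnitalCStarAlgebra A] (hA : IsStable A) :
    ∃ W : Fin 2 → Mult A, (∀ i, star (W i) * W i = 1) ∧ star (W 0) * W 1 = 0 := by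
  obtain ⟨θ⟩ := hA
  exact exists_isometry_pair_of_equiv θ (isFrame_opTensor A).star_mul_self
    (isFrame_opTensor A).star_zero_mul_one

theorem coe_tmul_e00Pos {A : Type u} [NonUnitalCStarAlgebra A] (a : PosCone A) :
    (a.tmul e00Pos).1 = cornerHom A a.1 := rfl

theorem Cu.ofPos_eq_mk {A : Type u} [NonUnitalCStarAlgebra A] {a : PosCone A}
    {x : PosCone (CTensor A K)} (h1 : CuntzLE (cornerHom A a.1) x.1)
    (h2 : CuntzLE x.1 (cornerHom A a.1)) : Cu.ofPos a = Cu.mk x := by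
  rw [← coe_tmul_e00Pos] at h1 h2
  exact le_antisymm (Cu.mk_le_mk.2 h1) (Cu.mk_le_mk.2 h2)

/-- If `A` is stable, every class in `Cu(A)` is the class of a positive element of `A`. -/
theorem Cu.ofPos_surjective {A : Type u} [NonUnitalCStarAlgebra A] (hA : IsStable A) :
    Function.Surjective (Cu.ofPos (A := A)) := fun s => by
  obtain ⟨W, hW, hW01⟩ := hA.exists_isometry_pair
  have hv := star_pow_mul_mul_pow_mul (hW 0) (hW 1) hW01
  obtain ⟨x, hx⟩ := Cu.exists_rep s
  obtain ⟨d, hd⟩ := x.2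
  have h := exists_cornerHom_equiv (v := fun i => W 1 ^ i * W 0) hv d
  rw [← hd] at h
  obtain ⟨c, hc1, hc2⟩ := h
  have hc : ∀ a : PosCone A, CuntzLE (cornerHom A a.1) x.1 → CuntzLE x.1 (cornerHom A a.1) →
      ∃ a, Cu.ofPos a = s := fun a h1 h2 => ⟨a, (Cu.ofPos_eq_mk h1 h2).trans hx⟩
  exact hc ⟨star c * c, c, rfl⟩ hc1 hc2

end Stable

end

/-! ### The bimorphism -/

section

attribute [local instance] CStarAlgebra.spectralOrder CStarAlgebra.spectralOrderedRing

section ElementaryTensor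

variable {A : Type u} {B : Type v} [NonUnitalCStarAlgebra A] [NonUnitalCStarAlgebra B]

variable (A B) in
/-- The elementary tensor `a ⊗ b` as a bounded bilinear map. -/
def CTensor.tmulL : A →L[ℂ] B →L[ℂ] CTensor A B :=
  (LinearMap.mk₂ ℂ CTensor.tmul CTensor.add_tmul CTensor.smul_tmul CTensor.tmul_add
    fun c a b => CTensor.tmul_smul c a b).mkContinuous₂ 1 fun a b => by
      rw [one_mul]; exact CTensor.norm_tmul_le a b

theorem CTensor.tmulL_apply (a : A) (b : B) : CTensor.tmulL A B a b = CTensor.tmul a b := rfl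

theorem CTensor.continuous_tmul : Continuous fun p : A × B => CTensor.tmul p.1 p.2 :=
  (CTensor.tmulL A B).continuous₂

theorem CuntzLE.tmul {a a' : A} {b b' : B} (ha : CuntzLE a a') (hb : CuntzLE b b') :
    CuntzLE (CTensor.tmul a b) (CTensor.tmul a' b') := by
  obtain ⟨x, hx⟩ := ha
  obtain ⟨y, hy⟩ := hb
  refine ⟨fun n => CTensor.tmul (x n) (y n), ?_⟩
  have h := (CTensor.continuous_tmul.tendsto (a, b)).comp (hx.prodMk_nhds hy)
  refine h.congr fun n => ?_
  rw [CTensor.star_tmul, CTensor.tmul_mul_tmul, CTensor.tmul_mul_tmul]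
  rfl

end ElementaryTensor

section OfPos

variable {A : Type u} [NonUnitalCStarAlgebra A]

/-- `a ↦ [a]` is an order embedding of `A₊ / ∼` into `Cu(A)`. -/
theorem Cu.ofPos_le_ofPos {a b : PosCone A} : Cu.ofPos a ≤ Cu.ofPos b ↔ CuntzLE a.1 b.1 :=
  ⟨fun h => .of_cornerHom (Cu.mk_le_mk.1 h), fun h => Cu.mk_le_mk.2 (h.tmul (.refl e00))⟩

theorem Cu.ofPos_eq_ofPos {a b : PosCone A} :
    Cu.ofPos a = Cu.ofPos b ↔ CuntzLE a.1 b.1 ∧ CuntzLE b.1 a.1 := by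
  rw [le_antisymm_iff, Cu.ofPos_le_ofPos, Cu.ofPos_le_ofPos]

theorem Cu.ofPos_add_ofPos {a b c : PosCone A} (h : a.1 * b.1 = 0) (hc : c.1 = a.1 + b.1) :
    Cu.ofPos a + Cu.ofPos b = Cu.ofPos c := by
  refine Cu.mk_add_mk_of_mul_eq_zero ?_ ?_
  · change cornerHom A a.1 * cornerHom A b.1 = 0
    rw [← map_mul, h, map_zero]
  · change cornerHom A c.1 = cornerHom A a.1 + cornerHom A b.1
    rw [hc, map_add]

theorem Cu.ofPos_wayBelow_of_unit {a b k : PosCone A} (hka : k.1 * a.1 = a.1)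
    (hkb : CuntzLE k.1 b.1) : WayBelow (Cu.ofPos a) (Cu.ofPos b) := by
  refine Cu.wayBelow_of_unit (k := k.tmul e00Pos) ?_ (hkb.tmul (.refl e00))
  change cornerHom A k.1 * cornerHom A a.1 = cornerHom A a.1
  rw [← map_mul, hka]

/-- If `[F (a - ε)₊] ≤ u` for all `ε`, then `[F a] ≤ u`. -/
theorem Cu.ofPos_le_of_cut {B : Type v} [NonUnitalCStarAlgebra B] {P : PosCone A → PosCone B}
    {F : A →L[ℂ] B} (hP : ∀ a, (P a).1 = F a.1) {a : PosCone A} {u : Cu B}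
    (h : ∀ n : ℕ, Cu.ofPos (P (a.cut (1 / ((n : ℝ) + 1)))) ≤ u) : Cu.ofPos (P a) ≤ u := by
  obtain ⟨x, rfl⟩ := u.exists_rep
  refine Cu.mk_le_mk.2 (.of_tendsto (x := fun n : ℕ =>
    ((P (a.cut (1 / ((n : ℝ) + 1)))).tmul e00Pos).1) ?_ fun n => Cu.mk_le_mk.1 (h n))
  simp only [coe_tmul_e00Pos, hP]
  have hc : Continuous (cornerHom B) :=
    (NonUnitalStarAlgHom.isometry (cornerHom B) cornerHom_injective).continuous
  exact ((hc.comp F.continuous).tendsto a.1).comp a.tendsto_cut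

theorem Cu.exists_le_ofPos_cut {s : Cu A} {a : PosCone A} (h : WayBelow s (Cu.ofPos a)) :
    ∃ n : ℕ, s ≤ Cu.ofPos (a.cut (1 / ((n : ℝ) + 1))) := by
  refine h (fun n : ℕ => Cu.ofPos (a.cut (1 / ((n : ℝ) + 1)))) (fun m n h => ?_) (Cu.ofPos a)
    ⟨?_, fun u hu => ?_⟩ le_rfl
  · exact Cu.ofPos_le_ofPos.2 (a.cut_mono (by positivity) (one_div_le_one_div_of_le (by positivity)
      (by exact_mod_cast Nat.succ_le_succ h)))
  · rintro _ ⟨n, rfl⟩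
    exact Cu.ofPos_le_ofPos.2 (.cut_self (by positivity) a)
  · exact Cu.ofPos_le_of_cut (P := id) (F := .id ℂ A) (fun _ => rfl) fun n => hu ⟨n, rfl⟩

/-- `V a V*` is a positive element of `A` that is equivalent to `a`, for a multiplier isometry `V`. -/
theorem exists_conj_isometry {V : Mult A} (hV : star V * V = 1) (a : PosCone A) :
    ∃ b : PosCone A, toMult A b.1 = V * toMult A a.1 * star V ∧ Cu.ofPos b = Cu.ofPos a := by
  obtain ⟨a, c, hc⟩ := a
  have h1 : toMult A (V.fst (star c)) = V * star (toMult A c) := by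
    rw [← mul_toMult, map_star (toMult A)]
  have h : toMult A (star (star (V.fst (star c))) * star (V.fst (star c))) =
      V * toMult A a * star V := by
    rw [star_star (V.fst (star c)), map_mul (toMult A), map_star (toMult A), h1, hc,
      map_mul (toMult A), map_star (toMult A), star_mul, star_star (toMult A c)]
    simp only [mul_assoc]
  exact ⟨⟨_, _, rfl⟩, h, Cu.ofPos_eq_ofPos.2 ⟨.of_mult V h, .of_isometry hV h⟩⟩

/-- In a stable C*-algebra any two positive elements can be made orthogonal within their Cuntz
classes. -/
theorem IsStable.exists_orthogonal (hA : IsStable A) (a b : PosCone A) :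
    ∃ a' b' c : PosCone A, a'.1 * b'.1 = 0 ∧ c.1 = a'.1 + b'.1 ∧ Cu.ofPos a' = Cu.ofPos a ∧
      Cu.ofPos b' = Cu.ofPos b := by
  obtain ⟨W, hW, hW'⟩ := hA.exists_isometry_pair
  obtain ⟨a', ha', haa'⟩ := exists_conj_isometry (hW 0) a
  obtain ⟨b', hb', hbb'⟩ := exists_conj_isometry (hW 1) b
  refine ⟨a', b', .ofNonneg (a'.1 + b'.1) (add_nonneg a'.nonneg b'.nonneg), toMult_injective ?_,
    rfl, haa', hbb'⟩
  rw [map_mul, ha', hb', map_zero]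
  calc _ = W 0 * toMult A a.1 * (star (W 0) * W 1) * (toMult A b.1 * star (W 1)) := by
        simp only [mul_assoc]
    _ = 0 := by rw [hW', mul_zero, zero_mul]

/-- A map of Cuntz semigroups that is induced by a bounded linear map preserving positivity,
orthogonality and Cuntz subequivalence is a morphism. -/
theorem PreservesCu.of_linear {B : Type v} [NonUnitalCStarAlgebra B] (hA : IsStable A)
    {f : Cu A → Cu B} {P : PosCone A → PosCone B} {F : A →L[ℂ] B} (hP : ∀ a, (P a).1 = F a.1)
    (hf : ∀ a, f (Cu.ofPos a) = Cu.ofPos (P a))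
    (hF : ∀ a b, a * b = 0 → F a * F b = 0)
    (hle : ∀ a b : PosCone A, CuntzLE a.1 b.1 → CuntzLE (P a).1 (P b).1) : PreservesCu f := by
  have hmono : Monotone f := fun s t hst => by
    obtain ⟨a, rfl⟩ := Cu.ofPos_surjective hA s
    obtain ⟨b, rfl⟩ := Cu.ofPos_surjective hA t
    rw [hf, hf, Cu.ofPos_le_ofPos]
    exact hle a b (Cu.ofPos_le_ofPos.1 hst)
  refine ⟨hmono, fun s t => ?_, fun z s hz hs => ⟨?_, fun u hu => ?_⟩⟩
  · obtain ⟨a, rfl⟩ := Cu.ofPos_surjective hA s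
    obtain ⟨b, rfl⟩ := Cu.ofPos_surjective hA t
    obtain ⟨a', b', c, hab, hc, ha, hb⟩ := hA.exists_orthogonal a b
    rw [← ha, ← hb, Cu.ofPos_add_ofPos hab hc, hf, hf, hf]
    refine (Cu.ofPos_add_ofPos ?_ ?_).symm
    · rw [hP, hP, hF _ _ hab]
    · rw [hP, hP, hP, hc, _root_.map_add F]
  · rintro _ ⟨n, rfl⟩
    exact hmono (hs.1 ⟨n, rfl⟩)
  · obtain ⟨a, rfl⟩ := Cu.ofPos_surjective hA s
    rw [hf]
    refine Cu.ofPos_le_of_cut hP fun n => ?_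
    obtain ⟨k, hk, hka⟩ := a.exists_unit_cut_self (ε := 1 / ((n : ℝ) + 1)) (by positivity)
    obtain ⟨m, hm⟩ := Cu.ofPos_wayBelow_of_unit hk hka z hz _ hs le_rfl
    rw [← hf]
    exact (hmono hm).trans (hu ⟨m, rfl⟩)

end OfPos

theorem WayBelow.mono_left {S : Type u} [PartialOrder S] {r s t : S} (hrs : r ≤ s)
    (h : WayBelow s t) : WayBelow r t := fun z hz u hu htu => by
  obtain ⟨m, hm⟩ := h z hz u hu htu
  exact ⟨m, hrs.trans hm⟩

section Bimorphism

variable {A : Type u} {B : Type v} [NonUnitalCStarAlgebra A] [NonUnitalCStarAlgebra B]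

/-- The map `([a], [b]) ↦ [a ⊗ b]`, defined by a choice of representatives `a ∈ A₊`, `b ∈ B₊`. -/
def tensorCu (hA : IsStable A) (hB : IsStable B) (s : Cu A) (t : Cu B) : Cu (CTensor A B) :=
  Cu.ofPos ((Function.surjInv (Cu.ofPos_surjective hA) s).tmul
    (Function.surjInv (Cu.ofPos_surjective hB) t))

variable (hA : IsStable A) (hB : IsStable B)

theorem tensorCu_ofPos (a : PosCone A) (b : PosCone B) :
    tensorCu hA hB (Cu.ofPos a) (Cu.ofPos b) = Cu.ofPos (a.tmul b) := by
  obtain ⟨ha1, ha2⟩ := Cu.ofPos_eq_ofPos.1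
    (Function.surjInv_eq (Cu.ofPos_surjective hA) (Cu.ofPos a))
  obtain ⟨hb1, hb2⟩ := Cu.ofPos_eq_ofPos.1
    (Function.surjInv_eq (Cu.ofPos_surjective hB) (Cu.ofPos b))
  exact Cu.ofPos_eq_ofPos.2 ⟨ha1.tmul hb1, ha2.tmul hb2⟩

/-- `≪` is preserved since `(a - ε)₊ ⊗ (b - δ)₊` has a unit `k ⊗ l ≾ a ⊗ b`. -/
theorem isBimorphism_tensorCu : IsBimorphism (tensorCu hA hB) where
  left_mem := isCuSemigroup A
  right_mem := isCuSemigroup B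
  target_mem := isCuSemigroup (CTensor A B)
  left t := by
    obtain ⟨b, rfl⟩ := Cu.ofPos_surjective hB t
    refine .of_linear hA (P := fun a => a.tmul b) (F := (CTensor.tmulL A B).flip b.1) (fun _ => rfl)
      (fun a => tensorCu_ofPos hA hB a b) (fun a a' h => ?_) (fun a a' h => h.tmul (.refl b.1))
    change CTensor.tmul a b.1 * CTensor.tmul a' b.1 = 0
    rw [CTensor.tmul_mul_tmul, h, ← CTensor.tmulL_apply, map_zero]
    rfl
  right s := by
    obtain ⟨a, rfl⟩ := Cu.ofPos_surjective hA s
    refine .of_linear hB (P := fun b => a.tmul b) (F := CTensor.tmulL A B a.1) (fun _ => rfl)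
      (fun b => tensorCu_ofPos hA hB a b) (fun b b' h => ?_)
      (fun b b' h => (CuntzLE.refl a.1).tmul h)
    rw [CTensor.tmulL_apply, CTensor.tmulL_apply, CTensor.tmul_mul_tmul, h, ← CTensor.tmulL_apply,
      map_zero]
  wayBelow s' s t' t hs ht := by
    obtain ⟨a, rfl⟩ := Cu.ofPos_surjective hA s
    obtain ⟨b, rfl⟩ := Cu.ofPos_surjective hB t
    obtain ⟨a', rfl⟩ := Cu.ofPos_surjective hA s'
    obtain ⟨b', rfl⟩ := Cu.ofPos_surjective hB t'
    obtain ⟨m, hm⟩ := Cu.exists_le_ofPos_cut hs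
    obtain ⟨n, hn⟩ := Cu.exists_le_ofPos_cut ht
    obtain ⟨k, hk, hka⟩ := a.exists_unit_cut_self (ε := 1 / ((m : ℝ) + 1)) (by positivity)
    obtain ⟨l, hl, hlb⟩ := b.exists_unit_cut_self (ε := 1 / ((n : ℝ) + 1)) (by positivity)
    rw [tensorCu_ofPos, tensorCu_ofPos]
    refine .mono_left (s := Cu.ofPos ((a.cut (1 / ((m : ℝ) + 1))).tmul
      (b.cut (1 / ((n : ℝ) + 1))))) ?_ ?_
    · exact Cu.ofPos_le_ofPos.2 ((Cu.ofPos_le_ofPos.1 hm).tmul (Cu.ofPos_le_ofPos.1 hn))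
    · refine Cu.ofPos_wayBelow_of_unit (k := k.tmul l) ?_ (hka.tmul hlb)
      change CTensor.tmul k.1 l.1 * CTensor.tmul (a.cut _).1 (b.cut _).1 =
        CTensor.tmul (a.cut _).1 (b.cut _).1
      rw [CTensor.tmul_mul_tmul, hk, hl]

end Bimorphism

end

end CuTensor

end

theorem mainTheorem8 (A : Type*) (B : Type*)
    [NonUnitalCStarAlgebra A] [NonUnitalCStarAlgebra B]
    (hA : CuTensor.IsStable A) (hB : CuTensor.IsStable B)
    (hA' : CuTensor.IsNuclear A) (hB' : CuTensor.IsNuclear B) :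
    ∃ φ : CuTensor.Cu A → CuTensor.Cu B → CuTensor.Cu (CuTensor.CTensor A B),
      (∀ (a : CuTensor.PosCone A) (b : CuTensor.PosCone B),
        φ (CuTensor.Cu.ofPos a) (CuTensor.Cu.ofPos b) = CuTensor.Cu.ofPos (a.tmul b)) ∧
      CuTensor.IsBimorphism φ ∧
      ∀ ψ : CuTensor.Cu A → CuTensor.Cu B → CuTensor.Cu (CuTensor.CTensor A B),
        (∀ (a : CuTensor.PosCone A) (b : CuTensor.PosCone B),
          ψ (CuTensor.Cu.ofPos a) (CuTensor.Cu.ofPos b) = CuTensor.Cu.ofPos (a.tmul b)) →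
        ψ = φ := by
  refine ⟨CuTensor.tensorCu hA hB, CuTensor.tensorCu_ofPos hA hB,
    CuTensor.isBimorphism_tensorCu hA hB, fun ψ hψ => ?_⟩
  funext s t
  obtain ⟨a, rfl⟩ := CuTensor.Cu.ofPos_surjective hA s
  obtain ⟨b, rfl⟩ := CuTensor.Cu.ofPos_surjective hB t
  rw [hψ, CuTensor.tensorCu_ofPos]
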